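/- Let $n\in\mathbb N$, $b>0$, $T>0$, $A\in\mathbb R^{n\times n}$, let $f\in C^2(\mathbb R^n,\mathbb R^n)$ be such that for some $\lambda>0$ the matrix $Df(x)+\lambda I$ is positive semi-definite for every $x\in\mathbb R^n$ (that is, $\langle Df(x)v+\lambda v,v\rangle\ge 0$ for all $x,v\in\mathbb R^n$), and let $\varphi\in H^2(-b,0;\mathbb R^n)$ (identified with its continuous representative) and $g\in H^1(0,T;\mathbb R^n)$. For $\tau\in[0,b]$, a solution of the delay equation $$\dot x(t)+f(x(t))=A\,x(t-\tau)+g(t)\ \text{ in }(0,T),\qquad x(t)=\varphi(t)\ \text{ in }[-b,0],$$ is a function $x\in C([-b,T],\mathbb R^n)$ with $x|_{[0,T]}\in H^1(0,T;\mathbb R^n)$ that satisfies the first equation a.e. in $(0,T)$ and the second on $[-b,0]$. Let $$L^2_{[0]}=\{w\in L^2(-b,T;\mathbb R^n): w(t)=0\text{ for a.e. }t\in(-b,0)\}.$$ Then for every $\tau\in[0,b]$ there is exactly one solution $x[\tau]$, and $x[\tau]\in H^1(-b,T;\mathbb R^n)$. The map $\tau\mapsto x[\tau]$ is differentiable from $[0,b]$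 (one-sidedly at the endpoints) to $H^1(-b,T;\mathbb R^n)$ with derivative $x'[\tau]$, the map $\tau\mapsto x'[\tau]$ is differentiable from $[0,b]$ to $L^2(-b,T;\mathbb R^n)$, and its derivative $x''[\tau]$ belongs to $L^2_{[0]}$. Moreover, for every $\tau\in[0,b]$, $y=x''[\tau]$ is the unique $y\in L^2_{[0]}$ that satisfies, for a.e. $t\in(0,T)$, $$y(t)=\int_0^t\Big\{-\big[D^2f(x[\tau])(x'[\tau],x'[\tau])+Df(x[\tau])\,y\big](s)+A\,y(s-\tau)\Big\}\,ds-2A\,x'[\tau](t-\tau)+A\,\dot x[\tau](t-\tau)-A\,\dot\varphi(-\tau).$$ Here $\dot x[\tau]$ is the weak time derivative of $x[\tau]$ on $(-b,T)$, and $\dot\varphi(-\tau)$ is the value at $-\tau$ of the classical derivative of $\varphi\in C^1([-b,0];\mathbb R^n)$ (one-sided at the endpoints). -/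

import Mathlib

open MeasureTheory Set
open scoped ContDiff

/-- `v` is the weak derivative of `u` on the open interval `(a, b)`. -/
def IsWeakDeriv {n : ℕ} (a b : ℝ) (u v : ℝ → EuclideanSpace ℝ (Fin n)) : Prop :=
  ∀ η : ℝ → ℝ, ContDiff ℝ ∞ η → HasCompactSupport η → tsupport η ⊆ Ioo a b →
    ∫ t in Ioo a b, deriv η t • u t = - ∫ t in Ioo a b, η t • v t

/-- `u ∈ H¹(a, b; ℝⁿ)` with weak derivative `v`, for functions `u`, `v`. -/
structure HasH1Deriv {n : ℕ} (a b : ℝ) (u v : ℝ → EuclideanSpace ℝ (Fin n)) : Prop where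
  memLp : MemLp u 2 (volume.restrict (Ioo a b))
  memLp_deriv : MemLp v 2 (volume.restrict (Ioo a b))
  isWeakDeriv : IsWeakDeriv a b u v

/-- `u ∈ H¹(a, b; ℝⁿ)`. -/
def MemH1 {n : ℕ} (a b : ℝ) (u : ℝ → EuclideanSpace ℝ (Fin n)) : Prop :=
  ∃ v, HasH1Deriv a b u v

/-- `u ∈ H²(a, b; ℝⁿ)`. -/
def MemH2 {n : ℕ} (a b : ℝ) (u : ℝ → EuclideanSpace ℝ (Fin n)) : Prop :=
  ∃ v, HasH1Deriv a b u v ∧ MemH1 a b v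

/-- The Hilbert space `L²(a, b; ℝⁿ)`. -/
abbrev L2 (n : ℕ) (a b : ℝ) : Type :=
  Lp (EuclideanSpace ℝ (Fin n)) 2 (volume.restrict (Ioo a b))

theorem integrable_smul_of_memLp_two {n : ℕ} {a b : ℝ} {c : ℝ → ℝ}
    (hc : Continuous c) (hs : HasCompactSupport c) {u : ℝ → EuclideanSpace ℝ (Fin n)}
    (hu : MemLp u 2 (volume.restrict (Ioo a b))) :
    Integrable (fun t => c t • u t) (volume.restrict (Ioo a b)) := by
  obtain ⟨C, hC⟩ := hs.exists_bound_of_continuous hc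
  exact (hu.integrable one_le_two).bdd_smul C hc.aestronglyMeasurable
    (Filter.Eventually.of_forall hC)

/-- The Sobolev space `H¹(a, b; ℝⁿ)`: pairs `(u, u̇)` in `L² × L²` with `u̇` the weak derivative
of `u`. The norm is `(‖u‖² + ‖u̇‖²)^(1/2)`. -/
def H1 (n : ℕ) (a b : ℝ) : Submodule ℝ (WithLp 2 (L2 n a b × L2 n a b)) where
  carrier := {p | IsWeakDeriv a b p.fst p.snd}
  zero_mem' := by
    intro η _ _ _
    have h : ∀ c : ℝ → ℝ, ∫ t in Ioo a b, c t • (0 : L2 n a b) t = 0 := by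
      intro c
      rw [← integral_zero ℝ (EuclideanSpace ℝ (Fin n)) (μ := volume.restrict (Ioo a b))]
      refine integral_congr_ae ?_
      filter_upwards [Lp.coeFn_zero (EuclideanSpace ℝ (Fin n)) 2 (volume.restrict (Ioo a b))]
        with t ht
      rw [ht]; simp
    simp only [WithLp.zero_fst, WithLp.zero_snd]
    rw [h, h, neg_zero]
  add_mem' := by
    intro p q hp hq η hη hs ht
    have key : ∀ c : ℝ → ℝ, Continuous c → HasCompactSupport c → ∀ u v : L2 n a b,
        ∫ t in Ioo a b, c t • (u + v : L2 n a b) t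
          = (∫ t in Ioo a b, c t • u t) + ∫ t in Ioo a b, c t • v t := by
      intro c hc hcs u v
      rw [← integral_add (integrable_smul_of_memLp_two hc hcs (Lp.memLp u))
        (integrable_smul_of_memLp_two hc hcs (Lp.memLp v))]
      refine integral_congr_ae ?_
      filter_upwards [Lp.coeFn_add u v] with t ht
      rw [ht]; simp
    have hd : Continuous (deriv η) := hη.continuous_deriv (by simp)
    simp only [WithLp.add_fst, WithLp.add_snd]
    rw [key _ hd hs.deriv, key _ hη.continuous hs, hp η hη hs ht, hq η hη hs ht, neg_add]
  smul_mem' := by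
    intro r p hp η hη hs ht
    have key : ∀ c : ℝ → ℝ, ∀ u : L2 n a b,
        ∫ t in Ioo a b, c t • (r • u : L2 n a b) t = r • ∫ t in Ioo a b, c t • u t := by
      intro c u
      rw [← integral_smul]
      refine integral_congr_ae ?_
      filter_upwards [Lp.coeFn_smul r u] with t ht
      rw [ht, Pi.smul_apply, smul_comm]
    simp only [WithLp.smul_fst, WithLp.smul_snd]
    rw [key, key, hp η hη hs ht, smul_neg]

/-- The element of `L²(a, b; ℝⁿ)` underlying an element of `H¹(a, b; ℝⁿ)`. -/
noncomputable def H1.toL2 {n : ℕ} {a b : ℝ} (u : H1 n a b) : L2 n a b :=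
  (u : WithLp 2 (L2 n a b × L2 n a b)).fst

/-- The weak derivative of an element of `H¹(a, b; ℝⁿ)`. -/
noncomputable def H1.dot {n : ℕ} {a b : ℝ} (u : H1 n a b) : L2 n a b :=
  (u : WithLp 2 (L2 n a b × L2 n a b)).snd

/-- The closed subspace of `L²(a, b; ℝⁿ)` of functions vanishing a.e. at negative times. -/
def L2zero (n : ℕ) (a b : ℝ) : Submodule ℝ (L2 n a b) where
  carrier := {w | ∀ᵐ t ∂(volume.restrict (Ioo a b)), t < 0 → w t = 0}
  zero_mem' := by
    filter_upwards [Lp.coeFn_zero (EuclideanSpace ℝ (Fin n)) 2 (volume.restrict (Ioo a b))]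
      with t ht _
    rw [ht]; rfl
  add_mem' := by
    intro u v hu hv
    filter_upwards [hu, hv, Lp.coeFn_add u v] with t h1 h2 h3 h0
    rw [h3, Pi.add_apply, h1 h0, h2 h0, add_zero]
  smul_mem' := by
    intro r u hu
    filter_upwards [hu, Lp.coeFn_smul r u] with t h1 h2 h0
    rw [h2, Pi.smul_apply, h1 h0, smul_zero]

/-- `x` is a solution of the delay equation `ẋ(t) + f(x(t)) = A x(t - τ) + g(t)` in `(0, T)`,
`x = φ` on `[-b, 0]`. -/
structure IsDelaySolution {n : ℕ} (A : Matrix (Fin n) (Fin n) ℝ)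
    (f : EuclideanSpace ℝ (Fin n) → EuclideanSpace ℝ (Fin n))
    (g φ : ℝ → EuclideanSpace ℝ (Fin n)) (b T τ : ℝ)
    (x : ℝ → EuclideanSpace ℝ (Fin n)) : Prop where
  continuousOn : ContinuousOn x (Icc (-b) T)
  initial : EqOn x φ (Icc (-b) 0)
  equation : ∃ v, HasH1Deriv 0 T x v ∧
    ∀ᵐ t ∂(volume.restrict (Ioo 0 T)),
      v t + f (x t) = Matrix.toEuclideanCLM (𝕜 := ℝ) A (x (t - τ)) + g t

/-- `y` satisfies, for almost every `t ∈ (0, T)`,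
`y(t) = ∫₀ᵗ {-[D²f(x)(x', x') + Df(x) y](s) + A y(s - τ)} ds
  - 2 A x'(t - τ) + A ẋ(t - τ) - A φ̇(-τ)`.
Here `x' = x1`, `ẋ = xdot`, and `φ̇` is the classical derivative on `[-b, 0]`. -/
def SolvesSecondOrderEq {n : ℕ} (A : Matrix (Fin n) (Fin n) ℝ)
    (f : EuclideanSpace ℝ (Fin n) → EuclideanSpace ℝ (Fin n))
    (φ : ℝ → EuclideanSpace ℝ (Fin n)) (b T τ : ℝ)
    (x xdot x1 y : ℝ → EuclideanSpace ℝ (Fin n)) : Prop :=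
  ∀ᵐ t ∂(volume.restrict (Ioo 0 T)),
    y t = (∫ s in (0 : ℝ)..t,
        (-(fderiv ℝ (fderiv ℝ f) (x s) (x1 s) (x1 s) + fderiv ℝ f (x s) (y s))
          + Matrix.toEuclideanCLM (𝕜 := ℝ) A (y (s - τ))))
      - (2 : ℝ) • Matrix.toEuclideanCLM (𝕜 := ℝ) A (x1 (t - τ))
      + Matrix.toEuclideanCLM (𝕜 := ℝ) A (xdot (t - τ))
      - Matrix.toEuclideanCLM (𝕜 := ℝ) A (derivWithin φ (Icc (-b) 0) (-τ))

/-!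
The delay equation is reduced to one with harmless data, for which both derivatives with respect to
the delay are computed pointwise in time.

*Reduction.* Since `φ ∈ H²` and `g ∈ H¹`, `φ` extends to a `C¹` function on the line
(`exists_contDiff_extension`) and `g` agrees almost everywhere with a bounded continuous function
(`exists_continuous_of_memH1`). The hypothesis on `Df` gives
`⟪f x, x⟫ ≥ -λ ‖x‖² - ‖f 0‖ ‖x‖` (`inner_ge_of_fderiv`), hence an energy estimate that bounds all
solutions on `[0, T]` by one constant (`exists_a_priori_bound`). Multiplying `f` by a cutoff
function with values in `[0, 1]` preserves this inequality (`exists_cutoff`), so the bound holds for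
the cut-off nonlinearity `F` as well; if the cutoff is `1` on a large ball, the solutions for `f`
and for `F` are the same. From then on the first two derivatives of `F` are bounded, and the state
`x` exists by a contraction argument (`exists_delay_volterra_solution`). Its derivatives `z` and `y`
with respect to the delay are defined as the solutions of linear Volterra equations with delay.

*Differentiation.* All estimates come from one Gronwall inequality (`norm_le_of_delay_volterra`),
in which the delayed argument does no harm because the unknown vanishes at negative times. The
remainder `x[σ] - x[τ] - (σ - τ) z` solves a linear equation whose source is the remainder
`x(s - σ) - x(s - τ) + (σ - τ) ẋ(s - τ)` of a shift of `x = x[τ]`, up to quadratic terms. Now `x` is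
Lipschitz, and differentiable except at the kink `0`, so the source is `o(σ - τ)` in `L¹` by
dominated convergence, and the remainder is `o(σ - τ)` uniformly in time. In the equation for
`z[σ] - z[τ] - (σ - τ) y`, the same shift remainder occurs outside the integral, which is why this
quantity is only `o(σ - τ)` at each `t ≠ τ`. The increments are Lipschitz in `σ`, so pointwise
differentiability almost everywhere is differentiability in `L²` (`hasDerivWithinAt_Lp_two`); this
applies to `x`, to `ẋ` and to `z`.

*Uniqueness* of `y` among square-integrable functions is Gronwall's inequality once more
(`ae_eq_zero_of_delay_inequality`).
-/

namespace DelayEquation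

open Filter Topology

set_option linter.unusedSectionVars false

/-! ### Weak derivatives on an interval -/

section Sobolev

variable {E : Type*} [NormedAddCommGroup E] [NormedSpace ℝ E] [CompleteSpace E]

/-- A test function with zero mean is the derivative of a test function. -/
theorem exists_smooth_primitive {a b : ℝ} {χ : ℝ → ℝ} (hχ : ContDiff ℝ ∞ χ)
    (hc : HasCompactSupport χ) (hs : tsupport χ ⊆ Ioo a b) (h0 : ∫ t, χ t = 0) :
    ∃ η : ℝ → ℝ, ContDiff ℝ ∞ η ∧ HasCompactSupport η ∧ tsupport η ⊆ Ioo a b ∧ deriv η = χ := by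
  obtain hemp | hne := (tsupport χ).eq_empty_or_nonempty
  · refine ⟨0, contDiff_const, HasCompactSupport.zero, by simp [tsupport], ?_⟩
    have : χ = 0 := by
      rw [tsupport, closure_empty_iff, Function.support_eq_empty_iff] at hemp
      exact hemp
    rw [this]; ext t; simp
  have hcpt : IsCompact (tsupport χ) := hc
  obtain ⟨a', ha'⟩ := hcpt.exists_isLeast hne
  obtain ⟨b', hb'⟩ := hcpt.exists_isGreatest hne
  have hz1 : ∀ t, t < a' → χ t = 0 := fun t ht => image_eq_zero_of_notMem_tsupport
    fun h => absurd (ha'.2 h) (not_le.2 ht)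
  have hz2 : ∀ t, b' < t → χ t = 0 := fun t ht => image_eq_zero_of_notMem_tsupport
    fun h => absurd (hb'.2 h) (not_le.2 ht)
  have hcont := hχ.continuous
  have hD : ∀ t, HasDerivAt (fun t => ∫ s in a'..t, χ s) (χ t) t := fun t =>
    intervalIntegral.integral_hasDerivAt_right (hcont.intervalIntegrable _ _)
      (hcont.stronglyMeasurableAtFilter _ _) hcont.continuousAt
  have hderiv : deriv (fun t => ∫ s in a'..t, χ s) = χ := funext fun t => (hD t).deriv
  have hab' : a' ≤ b' := ha'.2 hb'.1
  have hfull : ∫ s in a'..b', χ s = 0 := by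
    rw [← h0, intervalIntegral.integral_of_le hab', ← integral_Icc_eq_integral_Ioc]
    refine setIntegral_eq_integral_of_forall_compl_eq_zero fun t ht => ?_
    rw [mem_Icc, not_and_or, not_le, not_le] at ht
    exact ht.elim (hz1 t) (hz2 t)
  have hsupp : Function.support (fun t => ∫ s in a'..t, χ s) ⊆ Icc a' b' := by
    intro t ht
    by_contra hcon
    apply ht
    rw [mem_Icc, not_and_or, not_le, not_le] at hcon
    rcases hcon with h | h
    · refine (intervalIntegral.integral_congr_ae (g := fun _ => (0 : ℝ)) ?_).trans (by simp)
      have : ∀ᵐ s : ℝ, s ≠ a' := by simp [ae_iff]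
      filter_upwards [this] with s hs hs'
      rw [uIoc_of_ge h.le] at hs'
      exact hz1 s (lt_of_le_of_ne hs'.2 hs)
    · change ∫ s in a'..t, χ s = 0
      rw [← intervalIntegral.integral_add_adjacent_intervals
        (hcont.intervalIntegrable a' b') (hcont.intervalIntegrable b' t), hfull, zero_add]
      refine (intervalIntegral.integral_congr_ae (g := fun _ => (0 : ℝ)) ?_).trans (by simp)
      refine Eventually.of_forall fun s hs' => ?_
      rw [uIoc_of_le h.le] at hs'
      exact hz2 s hs'.1
  have hts : tsupport (fun t => ∫ s in a'..t, χ s) ⊆ Icc a' b' :=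
    closure_minimal hsupp isClosed_Icc
  refine ⟨fun t => ∫ s in a'..t, χ s, ?_, ?_, ?_, hderiv⟩
  · rw [contDiff_infty_iff_deriv, hderiv]
    exact ⟨fun t => (hD t).differentiableAt, hχ⟩
  · exact HasCompactSupport.of_support_subset_isCompact isCompact_Icc hsupp
  · exact hts.trans fun t ht => ⟨(hs ha'.1).1.trans_le ht.1, ht.2.trans_lt (hs hb'.1).2⟩

/-- The du Bois-Reymond lemma: a function whose weak derivative vanishes is constant. -/
theorem exists_ae_eq_const_of_integral_deriv_smul_eq_zero {a b : ℝ} {w : ℝ → E}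
    (hw : IntegrableOn w (Ioo a b))
    (h : ∀ η : ℝ → ℝ, ContDiff ℝ ∞ η → HasCompactSupport η → tsupport η ⊆ Ioo a b →
      ∫ t in Ioo a b, deriv η t • w t = 0) :
    ∃ c : E, ∀ᵐ t ∂(volume.restrict (Ioo a b)), w t = c := by
  rcases le_or_gt b a with hab | hab
  · exact ⟨0, by simp [Ioo_eq_empty (not_lt.2 hab)]⟩
  have hbi : ∀ ψ : ℝ → ℝ, Continuous ψ → HasCompactSupport ψ →
      ∀ u : ℝ → E, IntegrableOn u (Ioo a b) → IntegrableOn (fun t => ψ t • u t) (Ioo a b) := by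
    intro ψ hψ hψc u hu
    obtain ⟨C, hC⟩ := hψc.exists_bound_of_continuous hψ
    exact Integrable.bdd_smul hu C hψ.aestronglyMeasurable (Eventually.of_forall hC)
  let B : ContDiffBump ((a + b) / 2) := ⟨(b - a) / 8, (b - a) / 4, by linarith, by linarith⟩
  set θ := B.normed volume with hθ
  have hθs : ContDiff ℝ ∞ θ := B.contDiff_normed
  have hθc : HasCompactSupport θ := B.hasCompactSupport_normed
  have hθi : ∫ t, θ t = 1 := B.integral_normed
  have hθt : tsupport θ ⊆ Ioo a b := by
    rw [hθ, B.tsupport_normed_eq, Real.closedBall_eq_Icc]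
    intro t ht
    have h1 : B.rOut = (b - a) / 4 := rfl
    rw [h1] at ht
    constructor <;> [linarith [ht.1]; linarith [ht.2]]
  refine ⟨∫ t in Ioo a b, θ t • w t, ?_⟩
  set c := ∫ t in Ioo a b, θ t • w t
  have hwc : IntegrableOn (fun t => w t - c) (Ioo a b) :=
    hw.sub (integrableOn_const (by simp))
  have key := isOpen_Ioo.ae_eq_zero_of_integral_contDiff_smul_eq_zero (μ := volume)
    (f := fun t => w t - c) (U := Ioo a b) hwc.locallyIntegrableOn ?_
  · rw [ae_restrict_iff' measurableSet_Ioo]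
    filter_upwards [key] with t ht hm
    exact sub_eq_zero.1 (ht hm)
  intro ψ hψ hψc hψt
  have hψz : ∀ t ∉ Ioo a b, ψ t = 0 := fun t ht =>
    image_eq_zero_of_notMem_tsupport fun h => ht (hψt h)
  set m := ∫ t, ψ t with hm
  have hψint : Integrable ψ := hψ.continuous.integrable_of_hasCompactSupport hψc
  have hθint : Integrable θ := hθs.continuous.integrable_of_hasCompactSupport hθc
  have hsmul : HasCompactSupport (fun t => m * θ t) := hθc.mul_left
  obtain ⟨η, h1, h2, h3, h4⟩ := exists_smooth_primitive (a := a) (b := b)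
    (χ := fun t => ψ t - m * θ t) (hψ.sub (contDiff_const.mul hθs))
    (hψc.sub hsmul)
    ((tsupport_sub ψ _).trans (union_subset hψt ((tsupport_mul_subset_right).trans hθt)))
    (by rw [integral_sub hψint (hθint.const_mul m), integral_const_mul, hθi, mul_one, sub_self])
  have h5 := h η h1 h2 h3
  rw [h4] at h5
  have h6 : ∫ t in Ioo a b, ψ t • w t = m • c := by
    have : ∀ t, (ψ t - m * θ t) • w t = ψ t • w t - m • (θ t • w t) := by
      intro t; rw [sub_smul, mul_smul]
    simp_rw [this] at h5
    rw [integral_sub (hbi ψ hψ.continuous hψc w hw)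
      (by exact (hbi θ hθs.continuous hθc w hw).smul m), integral_smul] at h5
    exact sub_eq_zero.1 h5
  have h7 : ∫ t in Ioo a b, ψ t • c = m • c := by
    rw [integral_smul_const, setIntegral_eq_integral_of_forall_compl_eq_zero hψz]
  rw [← setIntegral_eq_integral_of_forall_compl_eq_zero (s := Ioo a b)
    (fun t ht => by rw [hψz t ht, zero_smul])]
  simp_rw [smul_sub]
  rw [integral_sub (hbi ψ hψ.continuous hψc w hw)
    (hbi ψ hψ.continuous hψc _ (integrableOn_const (by simp))), h6, h7, sub_self]

/-- Integration by parts against a primitive of an integrable function. -/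
theorem integral_deriv_smul_primitive {a b : ℝ} {v : ℝ → E} (hv : IntegrableOn v (Ioo a b))
    {η : ℝ → ℝ} (hη : ContDiff ℝ ∞ η) (hc : HasCompactSupport η) (hs : tsupport η ⊆ Ioo a b) :
    ∫ t in Ioo a b, deriv η t • (∫ s in a..t, v s) = - ∫ t in Ioo a b, η t • v t := by
  rcases le_or_gt b a with hab | hab
  · simp [Ioo_eq_empty (not_lt.2 hab)]
  have hd : Continuous (deriv η) := hη.continuous_deriv (by simp)
  obtain ⟨C, hC⟩ := hc.deriv.exists_bound_of_continuous hd
  set μ := volume.restrict (Ioo a b) with hμ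
  have hdi : Integrable (deriv η) μ :=
    (hd.integrable_of_hasCompactSupport hc.deriv).integrableOn
  have hprod : Integrable (fun p : ℝ × ℝ => deriv η p.1 • v p.2) (μ.prod μ) :=
    hdi.smul_prod hv
  have hmeas : MeasurableSet {p : ℝ × ℝ | p.2 < p.1} :=
    measurableSet_lt measurable_snd measurable_fst
  have hswap := integral_integral_swap (μ := μ) (ν := μ)
    (f := fun t s => ({p : ℝ × ℝ | p.2 < p.1}).indicator (fun p => deriv η p.1 • v p.2) (t, s))
    (hprod.indicator hmeas)
  have hL : ∀ t ∈ Ioo a b, ∫ s, ({p : ℝ × ℝ | p.2 < p.1}).indicator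
      (fun p => deriv η p.1 • v p.2) (t, s) ∂μ = deriv η t • (∫ s in a..t, v s) := by
    intro t ht
    have : ∀ s, ({p : ℝ × ℝ | p.2 < p.1}).indicator
      (fun p => deriv η p.1 • v p.2) (t, s) = (Iio t).indicator (fun s => deriv η t • v s) s := by
      intro s; simp [indicator]
    simp_rw [this]
    rw [integral_indicator measurableSet_Iio, integral_smul, hμ,
      Measure.restrict_restrict measurableSet_Iio, intervalIntegral.integral_of_le ht.1.le,
      integral_Ioc_eq_integral_Ioo]
    congr 3
    ext s; simp only [mem_inter_iff, mem_Iio, mem_Ioo]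
    exact ⟨fun h => ⟨h.2.1, h.1⟩, fun h => ⟨h.2, h.1, h.2.trans ht.2⟩⟩
  have hR : ∀ s ∈ Ioo a b, ∫ t, ({p : ℝ × ℝ | p.2 < p.1}).indicator
      (fun p => deriv η p.1 • v p.2) (t, s) ∂μ = - (η s • v s) := by
    intro s hs'
    have : ∀ t, ({p : ℝ × ℝ | p.2 < p.1}).indicator
      (fun p => deriv η p.1 • v p.2) (t, s) = (Ioi s).indicator (fun t => deriv η t • v s) t := by
      intro t; simp [indicator]
    simp_rw [this]
    have hset : Ioi s ∩ Ioo a b = Ioo s b := by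
      ext t; simp only [mem_inter_iff, mem_Ioi, mem_Ioo]
      exact ⟨fun h => ⟨h.1, h.2.2⟩, fun h => ⟨h.1, hs'.1.trans h.1, h.2⟩⟩
    rw [integral_indicator measurableSet_Ioi, integral_smul_const, hμ,
      Measure.restrict_restrict measurableSet_Ioi, hset, ← integral_Ioc_eq_integral_Ioo,
      ← intervalIntegral.integral_of_le hs'.2.le,
      intervalIntegral.integral_deriv_eq_sub
        (fun x _ => (hη.differentiable (by simp)).differentiableAt) (hd.intervalIntegrable _ _),
      image_eq_zero_of_notMem_tsupport (fun h => absurd (hs h).2 (lt_irrefl b)), zero_sub,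
      neg_smul]
  rw [← integral_neg]
  exact (setIntegral_congr_fun measurableSet_Ioo hL).symm.trans
    (hswap.trans (setIntegral_congr_fun measurableSet_Ioo hR))

variable {n : ℕ}

theorem exists_ae_eq_primitive_of_hasH1Deriv {a b : ℝ} {u v : ℝ → EuclideanSpace ℝ (Fin n)}
    (h : HasH1Deriv a b u v) :
    ∃ c, ∀ᵐ t ∂(volume.restrict (Ioo a b)), u t = c + ∫ s in a..t, v s := by
  have hu : IntegrableOn u (Ioo a b) := h.memLp.integrable one_le_two
  have hv : IntegrableOn v (Ioo a b) := h.memLp_deriv.integrable one_le_two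
  rcases le_or_gt b a with hab | hab
  · exact ⟨0, by simp [Ioo_eq_empty (not_lt.2 hab)]⟩
  have hvi : IntervalIntegrable v volume a b := by
    rwa [intervalIntegrable_iff_integrableOn_Ioo_of_le hab.le]
  have hW : ContinuousOn (fun t => ∫ s in a..t, v s) (Icc a b) := by
    have := intervalIntegral.continuousOn_primitive_interval' hvi left_mem_uIcc
    rwa [uIcc_of_le hab.le] at this
  have hWi : IntegrableOn (fun t => ∫ s in a..t, v s) (Ioo a b) :=
    (hW.integrableOn_Icc).mono_set Ioo_subset_Icc_self
  obtain ⟨c, hc⟩ := exists_ae_eq_const_of_integral_deriv_smul_eq_zero (hu.sub hWi) (by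
    intro η hη hηc hηs
    have hd : Continuous (deriv η) := hη.continuous_deriv (by simp)
    obtain ⟨C, hC⟩ := hηc.deriv.exists_bound_of_continuous hd
    have hbi : ∀ u : ℝ → EuclideanSpace ℝ (Fin n), IntegrableOn u (Ioo a b) →
        IntegrableOn (fun t => deriv η t • u t) (Ioo a b) := fun u hu =>
      Integrable.bdd_smul hu C hd.aestronglyMeasurable (Eventually.of_forall hC)
    simp only [Pi.sub_apply, smul_sub]
    rw [integral_sub (hbi u hu) (hbi _ hWi), h.isWeakDeriv η hη hηc hηs,
      integral_deriv_smul_primitive hv hη hηc hηs, sub_self])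
  refine ⟨c, ?_⟩
  filter_upwards [hc] with t ht
  rw [← ht, Pi.sub_apply, sub_add_cancel]

/-- The fundamental theorem of calculus for the continuous representative. -/
theorem eq_add_integral_of_hasH1Deriv {a b : ℝ} (hab : a < b)
    {u v : ℝ → EuclideanSpace ℝ (Fin n)} (h : HasH1Deriv a b u v)
    (hu : ContinuousOn u (Icc a b)) : ∀ t ∈ Icc a b, u t = u a + ∫ s in a..t, v s := by
  obtain ⟨c, hc⟩ := exists_ae_eq_primitive_of_hasH1Deriv h
  have hv : IntegrableOn v (Ioo a b) := h.memLp_deriv.integrable one_le_two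
  have hvi : IntervalIntegrable v volume a b := by
    rwa [intervalIntegrable_iff_integrableOn_Ioo_of_le hab.le]
  have hW : ContinuousOn (fun t => ∫ s in a..t, v s) (Icc a b) := by
    have := intervalIntegral.continuousOn_primitive_interval' hvi left_mem_uIcc
    rwa [uIcc_of_le hab.le] at this
  have heq : EqOn u (fun t => c + ∫ s in a..t, v s) (Icc a b) := by
    refine Measure.eqOn_Icc_of_ae_eq volume hab.ne ?_ hu (continuousOn_const.add hW)
    rw [Measure.restrict_congr_set Ioo_ae_eq_Icc.symm]
    exact hc
  intro t ht
  have h0 := heq (left_mem_Icc.2 hab.le)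
  simp only [intervalIntegral.integral_same, add_zero] at h0
  rw [heq ht, h0]

/-- A member of `H¹` on a nonempty interval agrees almost everywhere with a bounded continuous
function on the line. -/
theorem exists_continuous_of_memH1 {a b : ℝ} (hab : a < b)
    {u : ℝ → EuclideanSpace ℝ (Fin n)} (h : MemH1 a b u) :
    ∃ w : ℝ → EuclideanSpace ℝ (Fin n), Continuous w ∧ (∃ C, ∀ t, ‖w t‖ ≤ C) ∧
      ∀ᵐ t ∂(volume.restrict (Ioo a b)), u t = w t := by
  obtain ⟨v, h⟩ := h
  obtain ⟨c, hc⟩ := exists_ae_eq_primitive_of_hasH1Deriv h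
  have hv : IntegrableOn v (Ioo a b) := h.memLp_deriv.integrable one_le_two
  have hvi : IntervalIntegrable v volume a b := by
    rwa [intervalIntegrable_iff_integrableOn_Ioo_of_le hab.le]
  have hW : ContinuousOn (fun t => c + ∫ s in a..t, v s) (Icc a b) := by
    have := intervalIntegral.continuousOn_primitive_interval' hvi left_mem_uIcc
    rw [uIcc_of_le hab.le] at this
    exact continuousOn_const.add this
  obtain ⟨C, hC⟩ := isCompact_Icc.exists_bound_of_continuousOn hW
  refine ⟨IccExtend hab.le (domRestrict (Icc a b) (fun t => c + ∫ s in a..t, v s)),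
    (continuousOn_iff_continuous_domRestrict.1 hW).Icc_extend', ⟨C, fun t => ?_⟩, ?_⟩
  · exact hC _ (projIcc a b hab.le t).2
  · rw [ae_restrict_iff' measurableSet_Ioo] at hc ⊢
    filter_upwards [hc] with t ht hm
    rw [ht hm, IccExtend_of_mem _ _ (Ioo_subset_Icc_self hm)]
    rfl

/-- A continuous function that is differentiable off a countable set, with square-integrable
derivative, has that derivative as its weak derivative. -/
theorem hasH1Deriv_of_hasDerivAt_off_countable {a b : ℝ} (hab : a ≤ b)
    {u v : ℝ → EuclideanSpace ℝ (Fin n)} {s : Set ℝ} (hs : s.Countable)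
    (hu : ContinuousOn u (Icc a b)) (hd : ∀ t ∈ Ioo a b \ s, HasDerivAt u (v t) t)
    (hv : MemLp v 2 (volume.restrict (Ioo a b))) : HasH1Deriv a b u v := by
  have hvI : IntegrableOn v (Ioo a b) := hv.integrable one_le_two
  obtain ⟨C, hC⟩ := isCompact_Icc.exists_bound_of_continuousOn hu
  have huL : MemLp u 2 (volume.restrict (Ioo a b)) := by
    refine MemLp.of_bound ((hu.mono Ioo_subset_Icc_self).aestronglyMeasurable
      measurableSet_Ioo) C ?_
    rw [ae_restrict_iff' measurableSet_Ioo]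
    exact Eventually.of_forall fun t ht => hC t (Ioo_subset_Icc_self ht)
  refine ⟨huL, hv, fun η hη hc hsupp => ?_⟩
  have hdη : Continuous (deriv η) := hη.continuous_deriv (by simp)
  have i1 : IntegrableOn (fun t => deriv η t • u t) (Ioo a b) :=
    integrable_smul_of_memLp_two hdη hc.deriv huL
  have i2 : IntegrableOn (fun t => η t • v t) (Ioo a b) :=
    integrable_smul_of_memLp_two hη.continuous hc hv
  have key := integral_eq_of_hasDerivAt_off_countable_of_le (fun t => η t • u t)
    (fun t => η t • v t + deriv η t • u t) hab hs (hη.continuous.continuousOn.smul hu)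
    (fun t ht => ((hη.differentiable (by simp)).differentiableAt.hasDerivAt).smul (hd t ht))
    (by rw [intervalIntegrable_iff_integrableOn_Ioo_of_le hab]; exact i2.add i1)
  rw [image_eq_zero_of_notMem_tsupport (fun h => absurd (hsupp h).2 (lt_irrefl b)),
    image_eq_zero_of_notMem_tsupport (fun h => absurd (hsupp h).1 (lt_irrefl a)), zero_smul,
    zero_smul, sub_zero, intervalIntegral.integral_of_le hab, integral_Ioc_eq_integral_Ioo,
    integral_add i2 i1] at key
  rw [eq_neg_iff_add_eq_zero, add_comm]
  exact key

end Sobolev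

/-! ### Gronwall's inequality with delay, and limits under the integral sign -/

section Gronwall

/-- Gronwall's inequality in integrated form, for merely integrable functions. -/
theorem integral_le_mul_exp_of_le_add_mul_integral {T K : ℝ} (hK : 0 ≤ K)
    {u h : ℝ → ℝ} (hu : IntegrableOn u (Icc 0 T)) (hh : IntegrableOn h (Icc 0 T))
    (hu0 : ∀ t, 0 ≤ u t) (hh0 : ∀ t, 0 ≤ h t)
    (hle : ∀ᵐ t ∂(volume.restrict (Icc 0 T)), u t ≤ h t + K * ∫ s in (0 : ℝ)..t, u s) :
    ∀ t ∈ Icc 0 T, ∫ s in (0 : ℝ)..t, u s ≤ (∫ s in (0 : ℝ)..T, h s) * Real.exp (K * T) := by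
  intro t ht
  have hT : 0 ≤ T := ht.1.trans ht.2
  have ii : ∀ {w : ℝ → ℝ}, IntegrableOn w (Icc 0 T) → ∀ t ∈ Icc 0 T,
      IntervalIntegrable w volume 0 t := fun hw t ht => by
    rw [intervalIntegrable_iff_integrableOn_Icc_of_le ht.1]
    exact hw.mono_set (Icc_subset_Icc_right ht.2)
  set U : ℝ → ℝ := fun t => ∫ s in (0 : ℝ)..t, u s with hU
  set H := ∫ s in (0 : ℝ)..T, h s with hH
  have hUc : ContinuousOn U (Icc 0 T) := by
    have := intervalIntegral.continuousOn_primitive_interval' (ii hu T ⟨hT, le_rfl⟩)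
      left_mem_uIcc
    rwa [uIcc_of_le hT] at this
  have hU0 : ∀ t ∈ Icc 0 T, 0 ≤ U t := fun t ht =>
    intervalIntegral.integral_nonneg ht.1 fun s _ => hu0 s
  have hUi : IntegrableOn U (Icc 0 T) := hUc.integrableOn_Icc
  set V : ℝ → ℝ := fun t => ∫ s in (0 : ℝ)..t, U s with hV
  have hV0 : ∀ t ∈ Icc 0 T, 0 ≤ V t := fun t ht =>
    intervalIntegral.integral_nonneg ht.1 fun s hs => hU0 s ⟨hs.1, hs.2.trans ht.2⟩
  have hUV : ∀ t ∈ Icc 0 T, U t ≤ H + K * V t := by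
    intro t ht
    calc U t ≤ ∫ s in (0 : ℝ)..t, (h s + K * U s) := by
          refine intervalIntegral.integral_mono_ae_restrict ht.1 (ii hu t ht)
            ((ii hh t ht).add ((ii hUi t ht).const_mul K)) ?_
          exact ae_restrict_of_ae_restrict_of_subset (Icc_subset_Icc_right ht.2) hle
      _ = (∫ s in (0 : ℝ)..t, h s) + K * V t := by
          rw [intervalIntegral.integral_add (ii hh t ht) ((ii hUi t ht).const_mul K),
            intervalIntegral.integral_const_mul]
      _ ≤ H + K * V t := by
          gcongr
          exact intervalIntegral.integral_mono_interval le_rfl ht.1 ht.2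
            (Eventually.of_forall hh0) (ii hh T ⟨hT, le_rfl⟩)
  have hVc : ContinuousOn V (Icc 0 T) := by
    have := intervalIntegral.continuousOn_primitive_interval' (ii hUi T ⟨hT, le_rfl⟩)
      left_mem_uIcc
    rwa [uIcc_of_le hT] at this
  have hVd : ∀ t ∈ Ico 0 T, HasDerivWithinAt V (U t) (Ici t) t := by
    intro t ht
    have hmem : Icc 0 T ∈ 𝓝[>] t := mem_of_superset (Ioo_mem_nhdsGT ht.2)
      fun s hs => ⟨ht.1.trans hs.1.le, hs.2.le⟩
    refine intervalIntegral.integral_hasDerivWithinAt_right (ii hUi t ⟨ht.1, ht.2.le⟩)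
      (s := Ici t) (t := Ioi t) ?_ ?_
    · exact ⟨Icc 0 T, hmem, hUi.aestronglyMeasurable⟩
    · exact (hUc t ⟨ht.1, ht.2.le⟩).mono_of_mem_nhdsWithin hmem
  have hg := norm_le_gronwallBound_of_norm_deriv_right_le (δ := 0) (K := K) (ε := H) hVc hVd
    (by simp [hV]) (fun s hs => by
      have hs' : s ∈ Icc 0 T := ⟨hs.1, hs.2.le⟩
      rw [Real.norm_of_nonneg (hU0 s hs'), Real.norm_of_nonneg (hV0 s hs')]
      linarith [hUV s hs']) t ht
  rw [Real.norm_of_nonneg (hV0 t ht), sub_zero] at hg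
  have hH0 : 0 ≤ H := intervalIntegral.integral_nonneg hT fun s _ => hh0 s
  calc U t ≤ H + K * V t := hUV t ht
    _ ≤ H + K * gronwallBound 0 K H t := by gcongr
    _ = H * Real.exp (K * t) := by
      rcases eq_or_ne K 0 with h0 | h0
      · simp [h0]
      · rw [gronwallBound_of_K_ne_0 h0]; field_simp; ring
    _ ≤ H * Real.exp (K * T) := by
      have := ht.2
      gcongr

/-- For a nonnegative function that vanishes at negative times, delaying the argument does not
increase the integral over `[0, t]`. -/
theorem integral_comp_sub_le {T τ t : ℝ} (hτ : 0 ≤ τ) {u : ℝ → ℝ}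
    (hu : IntegrableOn u (Icc 0 T)) (hu0 : ∀ t, 0 ≤ u t) (hneg : ∀ t < 0, u t = 0)
    (ht : t ∈ Icc 0 T) :
    IntervalIntegrable (fun s => u (s - τ)) volume 0 t ∧
      ∫ s in (0 : ℝ)..t, u (s - τ) ≤ ∫ s in (0 : ℝ)..t, u s := by
  have hI : ∀ a c, a ≤ T → c ≤ T → IntervalIntegrable u volume a c := by
    have key : ∀ a, a ≤ T → IntervalIntegrable u volume a 0 := by
      intro a ha
      rcases le_total 0 a with h | h
      · refine IntervalIntegrable.symm ?_
        rw [intervalIntegrable_iff_integrableOn_Icc_of_le h]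
        exact hu.mono_set (Icc_subset_Icc_right ha)
      · rw [intervalIntegrable_iff_integrableOn_Ioo_of_le h]
        exact (integrableOn_congr_fun (g := fun _ => (0 : ℝ)) (fun s hs => hneg s hs.2)
          measurableSet_Ioo).2 integrableOn_zero
    exact fun a c ha hc => (key a ha).trans (key c hc).symm
  constructor
  · have h := hI (0 - τ) (t - τ) (by linarith [ht.1, ht.2]) (by linarith [ht.2])
    have := h.comp_sub_right τ
    simpa using this
  · rw [intervalIntegral.integral_comp_sub_right (fun s => u s) τ]
    have h1 : ∫ s in (0 - τ)..(t - τ), u s ≤ ∫ s in (0 - τ)..t, u s :=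
      intervalIntegral.integral_mono_interval le_rfl (by linarith [ht.1]) (by linarith)
        (Eventually.of_forall hu0) (hI _ _ (by linarith [ht.1, ht.2]) ht.2)
    have h2 : ∫ s in (0 - τ)..0, u s = 0 := by
      rw [intervalIntegral.integral_of_le (by linarith), integral_Ioc_eq_integral_Ioo]
      exact setIntegral_eq_zero_of_forall_eq_zero fun s hs => hneg s hs.2
    rw [← intervalIntegral.integral_add_adjacent_intervals
      (hI (0 - τ) 0 (by linarith [ht.1, ht.2]) (ht.1.trans ht.2))
      (hI 0 t (ht.1.trans ht.2) ht.2), h2, zero_add] at h1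
    exact h1

/-- Gronwall's inequality for a nonnegative function that vanishes at negative times: the delayed
term costs no more than the undelayed one. -/
theorem integral_le_of_delay_inequality {T τ K₁ K₂ : ℝ} (hτ : 0 ≤ τ) (hK₁ : 0 ≤ K₁)
    (hK₂ : 0 ≤ K₂) {u h : ℝ → ℝ} (hu : IntegrableOn u (Icc 0 T))
    (hh : IntegrableOn h (Icc 0 T)) (hu0 : ∀ t, 0 ≤ u t) (hneg : ∀ t < 0, u t = 0)
    (hh0 : ∀ t, 0 ≤ h t)
    (hle : ∀ᵐ t ∂(volume.restrict (Icc 0 T)),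
      u t ≤ h t + ∫ s in (0 : ℝ)..t, (K₁ * u s + K₂ * u (s - τ))) :
    ∀ t ∈ Icc 0 T, ∫ s in (0 : ℝ)..t, (K₁ * u s + K₂ * u (s - τ)) ≤
      (K₁ + K₂) * Real.exp ((K₁ + K₂) * T) * ∫ s in (0 : ℝ)..T, h s := by
  have hstep : ∀ t ∈ Icc 0 T, ∫ s in (0 : ℝ)..t, (K₁ * u s + K₂ * u (s - τ)) ≤
      (K₁ + K₂) * ∫ s in (0 : ℝ)..t, u s := by
    intro t ht
    obtain ⟨h1, h2⟩ := integral_comp_sub_le hτ hu hu0 hneg ht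
    have h3 : IntervalIntegrable u volume 0 t := by
      rw [intervalIntegrable_iff_integrableOn_Icc_of_le ht.1]
      exact hu.mono_set (Icc_subset_Icc_right ht.2)
    rw [intervalIntegral.integral_add (h3.const_mul _) (h1.const_mul _),
      intervalIntegral.integral_const_mul, intervalIntegral.integral_const_mul, add_mul]
    gcongr
  have hg := integral_le_mul_exp_of_le_add_mul_integral (K := K₁ + K₂) (by positivity) hu hh
    hu0 hh0 (by
      filter_upwards [hle, ae_restrict_mem measurableSet_Icc] with t h1 h2
      exact h1.trans (by gcongr; exact hstep t h2))
  intro t ht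
  refine (hstep t ht).trans ?_
  rw [mul_assoc, mul_comm (Real.exp _)]
  have := hg t ht
  gcongr

theorem le_of_delay_inequality {T τ K₁ K₂ : ℝ} (hτ : 0 ≤ τ) (hK₁ : 0 ≤ K₁)
    (hK₂ : 0 ≤ K₂) {u h : ℝ → ℝ} (hu : IntegrableOn u (Icc 0 T))
    (hh : IntegrableOn h (Icc 0 T)) (hu0 : ∀ t, 0 ≤ u t) (hneg : ∀ t < 0, u t = 0)
    (hh0 : ∀ t, 0 ≤ h t)
    (hle : ∀ t ∈ Icc 0 T, u t ≤ h t + ∫ s in (0 : ℝ)..t, (K₁ * u s + K₂ * u (s - τ))) :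
    ∀ t ∈ Icc 0 T, u t ≤
      h t + (K₁ + K₂) * Real.exp ((K₁ + K₂) * T) * ∫ s in (0 : ℝ)..T, h s := by
  intro t ht
  have := integral_le_of_delay_inequality hτ hK₁ hK₂ hu hh hu0 hneg hh0
    ((ae_restrict_mem measurableSet_Icc).mono hle) t ht
  linarith [hle t ht]

end Gronwall

section Limits

/-- Dominated convergence for remainders: a remainder that is `o(σ - τ)` at almost every time and
`O(σ - τ)` uniformly has an integral that is `o(σ - τ)`. -/
theorem isLittleO_integral {T τ C : ℝ} (hT : 0 ≤ T) {S : Set ℝ} {r : ℝ → ℝ → ℝ}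
    (hm : ∀ σ ∈ S, AEStronglyMeasurable (r σ) (volume.restrict (Ioc 0 T)))
    (hC : ∀ σ ∈ S, ∀ t ∈ Ioc 0 T, |r σ t| ≤ C * |σ - τ|)
    (ho : ∀ᵐ t ∂(volume.restrict (Ioc 0 T)),
      (fun σ => r σ t) =o[𝓝[S] τ] fun σ => σ - τ) :
    (fun σ => ∫ t in (0 : ℝ)..T, r σ t) =o[𝓝[S] τ] fun σ => σ - τ := by
  have hz : ∀ σ ∈ S, σ - τ = 0 → ∫ t in (0 : ℝ)..T, r σ t = 0 := by
    intro σ hσ h0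
    rw [intervalIntegral.integral_of_le hT]
    refine setIntegral_eq_zero_of_forall_eq_zero fun t ht => ?_
    simpa [h0] using hC σ hσ t ht
  rw [Asymptotics.isLittleO_iff_tendsto' (eventually_mem_nhdsWithin.mono hz)]
  have heq : ∀ σ, (∫ t in (0 : ℝ)..T, r σ t) / (σ - τ) = ∫ t in Ioc 0 T, r σ t / (σ - τ) := by
    intro σ; rw [intervalIntegral.integral_of_le hT, integral_div]
  simp_rw [heq]
  have := tendsto_integral_filter_of_dominated_convergence (μ := volume.restrict (Ioc 0 T))
    (l := 𝓝[S] τ) (F := fun σ t => r σ t / (σ - τ)) (f := fun _ => (0 : ℝ)) (fun _ => |C|) ?_ ?_ ?_ ?_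
  · simpa using this
  · filter_upwards [eventually_mem_nhdsWithin] with σ hσ
    simpa only [div_eq_mul_inv] using (hm σ hσ).mul_const _
  · filter_upwards [eventually_mem_nhdsWithin] with σ hσ
    filter_upwards [ae_restrict_mem measurableSet_Ioc] with t ht
    rw [norm_div, Real.norm_eq_abs, Real.norm_eq_abs]
    exact div_le_of_le_mul₀ (abs_nonneg _) (abs_nonneg _)
      ((hC σ hσ t ht).trans (by gcongr; exact le_abs_self C))
  · exact integrable_const _
  · filter_upwards [ho] with t ht
    exact ht.tendsto_div_nhds_zero

/-- A pointwise derivative with respect to a parameter is a derivative in `L²` if the increments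
are uniformly Lipschitz. -/
theorem hasDerivWithinAt_Lp_two {n : ℕ} {μ : Measure ℝ} [IsFiniteMeasure μ] {S : Set ℝ} {τ C : ℝ}
    (hτ : τ ∈ S) {u : ℝ → ℝ → EuclideanSpace ℝ (Fin n)} {u' : ℝ → EuclideanSpace ℝ (Fin n)}
    {f : ℝ → Lp (EuclideanSpace ℝ (Fin n)) 2 μ} {f' : Lp (EuclideanSpace ℝ (Fin n)) 2 μ}
    (hf : ∀ σ ∈ S, f σ =ᵐ[μ] u σ) (hf' : f' =ᵐ[μ] u')
    (hC : ∀ σ ∈ S, ∀ᵐ t ∂μ, ‖u σ t - u τ t‖ ≤ C * |σ - τ|)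
    (hC' : ∀ᵐ t ∂μ, ‖u' t‖ ≤ C)
    (hd : ∀ᵐ t ∂μ, HasDerivWithinAt (fun σ => u σ t) (u' t) S τ) :
    HasDerivWithinAt f f' S τ := by
  have hrep : ∀ σ ∈ S, (f σ - f τ - (σ - τ) • f' : Lp (EuclideanSpace ℝ (Fin n)) 2 μ) =ᵐ[μ]
      fun t => u σ t - u τ t - (σ - τ) • u' t := by
    intro σ hσ
    filter_upwards [Lp.coeFn_sub (f σ - f τ) ((σ - τ) • f'), Lp.coeFn_sub (f σ) (f τ),
      Lp.coeFn_smul (σ - τ) f', hf σ hσ, hf τ hτ, hf'] with t h1 h2 h3 h4 h5 h6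
    rw [h1, Pi.sub_apply, h2, Pi.sub_apply, h3, Pi.smul_apply, h4, h5, h6]
  have hsq : ∀ w : Lp (EuclideanSpace ℝ (Fin n)) 2 μ, ‖w‖ ^ 2 = ∫ t, ‖w t‖ ^ 2 ∂μ := by
    intro w
    rw [← real_inner_self_eq_norm_sq, L2.inner_def]
    simp_rw [real_inner_self_eq_norm_sq]
  rw [hasDerivWithinAt_iff_tendsto]
  have key : Tendsto (fun σ => (‖σ - τ‖⁻¹ * ‖f σ - f τ - (σ - τ) • f'‖) ^ 2) (𝓝[S] τ) (𝓝 0) := by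
    have heq : ∀ᶠ σ in 𝓝[S] τ, (∫ t, (‖σ - τ‖⁻¹ * ‖u σ t - u τ t - (σ - τ) • u' t‖) ^ 2 ∂μ) =
        (‖σ - τ‖⁻¹ * ‖f σ - f τ - (σ - τ) • f'‖) ^ 2 := by
      filter_upwards [eventually_mem_nhdsWithin] with σ hσ
      simp_rw [mul_pow]
      rw [hsq, integral_const_mul]
      congr 1
      refine integral_congr_ae ?_
      filter_upwards [hrep σ hσ] with t ht
      rw [ht]
    refine Tendsto.congr' heq ?_
    have := tendsto_integral_filter_of_dominated_convergence (μ := μ) (l := 𝓝[S] τ)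
      (F := fun σ t => (‖σ - τ‖⁻¹ * ‖u σ t - u τ t - (σ - τ) • u' t‖) ^ 2)
      (f := fun _ => (0 : ℝ)) (fun _ => (2 * C) ^ 2) ?_ ?_ (integrable_const _) ?_
    · simpa using this
    · filter_upwards [eventually_mem_nhdsWithin] with σ hσ
      have : AEStronglyMeasurable (fun t => u σ t - u τ t - (σ - τ) • u' t) μ :=
        (Lp.aestronglyMeasurable _).congr (hrep σ hσ)
      exact (this.norm.const_mul _).pow 2
    · filter_upwards [eventually_mem_nhdsWithin] with σ hσ
      filter_upwards [hC σ hσ, hC'] with t h1 h2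
      have hle : ‖σ - τ‖⁻¹ * ‖u σ t - u τ t - (σ - τ) • u' t‖ ≤ 2 * C := by
        have hC0 : 0 ≤ C := (norm_nonneg _).trans h2
        rw [inv_mul_eq_div]
        refine div_le_of_le_mul₀ (norm_nonneg _) (by positivity) ?_
        calc _ ≤ ‖u σ t - u τ t‖ + ‖(σ - τ) • u' t‖ := norm_sub_le _ _
          _ ≤ C * |σ - τ| + |σ - τ| * C := by
            rw [norm_smul, Real.norm_eq_abs]; gcongr
          _ = _ := by rw [Real.norm_eq_abs]; ring
      rw [norm_pow, Real.norm_of_nonneg (by positivity)]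
      gcongr
    · filter_upwards [hd] with t ht
      rw [hasDerivWithinAt_iff_tendsto] at ht
      simpa using ht.pow 2
  have := key.sqrt
  simp only [Real.sqrt_zero] at this
  refine this.congr fun σ => Real.sqrt_sq (by positivity)

end Limits

/-! ### Volterra equations with delay -/

section Existence

variable {E : Type*} [NormedAddCommGroup E] [NormedSpace ℝ E] [CompleteSpace E]

open scoped BoundedContinuousFunction in
/-- A Volterra equation with delay, Lipschitz in the unknown, is solvable on all of `[0, T]`:
the Picard operator contracts for an exponentially weighted supremum norm. -/
theorem exists_delay_volterra_solution {T τ K C : ℝ} (hT : 0 ≤ T) (hτ : 0 ≤ τ) (hK : 0 ≤ K)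
    (G : ℝ → E → E → E)
    (hLip : ∀ s ∈ Icc 0 T, ∀ u u' w w', ‖G s u w - G s u' w'‖ ≤ K * (‖u - u'‖ + ‖w - w'‖))
    (hmeas : ∀ u w : ℝ → E, Continuous u → Continuous w →
      AEStronglyMeasurable (fun s => G s (u s) (w s)) (volume.restrict (Icc 0 T)))
    (hC : ∀ s ∈ Icc 0 T, ‖G s 0 0‖ ≤ C) :
    ∃ u : ℝ → E, Continuous u ∧ (∀ t ≤ 0, u t = 0) ∧
      ∀ t ∈ Icc 0 T, u t = ∫ s in (0 : ℝ)..t, G s (u s) (u (s - τ)) := by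
  set κ : ℝ := 4 * K + 1 with hκ
  have hκ0 : 0 < κ := by positivity
  set cl : ℝ → ℝ := fun t => max 0 (min t T) with hcl
  have hclc : Continuous cl := by fun_prop
  have hclm : ∀ t, cl t ∈ Icc 0 T := fun t => ⟨le_max_left _ _, max_le hT (min_le_right _ _)⟩
  have hcle : ∀ t ∈ Icc 0 T, cl t = t := fun t ht => by
    simp only [hcl]; rw [min_eq_left ht.2, max_eq_right ht.1]
  have hclmono : Monotone cl := fun a c hac => by simp only [hcl]; gcongr
  -- The unknown is sought as `exp (κ t) • w t` with `w` bounded.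
  set U : (ℝ →ᵇ E) → ℝ → E := fun w t => Real.exp (κ * cl t) • w t with hU
  have hUc : ∀ w, Continuous (U w) := fun w => by
    have := w.continuous
    simp only [hU]; fun_prop
  have hUn : ∀ w w' : ℝ →ᵇ E, ∀ t, ‖U w t - U w' t‖ ≤ Real.exp (κ * cl t) * dist w w' := by
    intro w w' t
    simp only [hU]
    rw [← smul_sub, norm_smul, Real.norm_eq_abs, Real.abs_exp, ← dist_eq_norm]
    gcongr
    exact BoundedContinuousFunction.dist_coe_le_dist t
  have hU0 : ∀ t, U 0 t = 0 := fun t => by simp [hU]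
  set J : (ℝ →ᵇ E) → ℝ → E := fun w s => G s (U w s) (U w (s - τ)) with hJ
  have hJm : ∀ w, AEStronglyMeasurable (J w) (volume.restrict (Icc 0 T)) := fun w =>
    hmeas _ _ (hUc w) ((hUc w).comp (continuous_id.sub continuous_const))
  have hJd : ∀ w w' : ℝ →ᵇ E, ∀ s ∈ Icc 0 T,
      ‖J w s - J w' s‖ ≤ 2 * K * dist w w' * Real.exp (κ * s) := by
    intro w w' s hs
    have h1 := hUn w w' s
    have h2 := hUn w w' (s - τ)
    have h3 : Real.exp (κ * cl (s - τ)) ≤ Real.exp (κ * s) := by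
      have := hclmono (show s - τ ≤ s by linarith)
      rw [hcle s hs] at this
      gcongr
    rw [hcle s hs] at h1
    calc _ ≤ K * (‖U w s - U w' s‖ + ‖U w (s - τ) - U w' (s - τ)‖) := hLip s hs _ _ _ _
      _ ≤ K * (Real.exp (κ * s) * dist w w' + Real.exp (κ * s) * dist w w') := by
        gcongr
        exact h2.trans (by gcongr)
      _ = _ := by ring
  have hJb : ∀ w : ℝ →ᵇ E, ∃ M, ∀ s ∈ Icc 0 T, ‖J w s‖ ≤ M := by
    intro w
    refine ⟨2 * K * dist w 0 * Real.exp (κ * T) + C, fun s hs => ?_⟩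
    have h0 : J 0 s = G s 0 0 := by simp only [hJ, hU0]
    calc ‖J w s‖ = ‖(J w s - J 0 s) + J 0 s‖ := by rw [sub_add_cancel]
      _ ≤ ‖J w s - J 0 s‖ + ‖J 0 s‖ := norm_add_le _ _
      _ ≤ 2 * K * dist w 0 * Real.exp (κ * s) + C := by
        gcongr
        · exact hJd w 0 s hs
        · rw [h0]; exact hC s hs
      _ ≤ _ := by
        have := hs.2
        gcongr
  have hJi : ∀ w, IntegrableOn (J w) (Icc 0 T) := by
    intro w
    obtain ⟨M, hM⟩ := hJb w
    exact Integrable.of_bound (hJm w) M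
      ((ae_restrict_mem measurableSet_Icc).mono hM)
  have hJii : ∀ w, ∀ t ∈ Icc 0 T, IntervalIntegrable (J w) volume 0 t := fun w t ht => by
    rw [intervalIntegrable_iff_integrableOn_Icc_of_le ht.1]
    exact (hJi w).mono_set (Icc_subset_Icc_right ht.2)
  have hPc : ∀ w, Continuous fun t => ∫ s in (0 : ℝ)..cl t, J w s := by
    intro w
    have h1 : ContinuousOn (fun t => ∫ s in (0 : ℝ)..t, J w s) (Icc 0 T) := by
      have := intervalIntegral.continuousOn_primitive_interval' (hJii w T ⟨hT, le_rfl⟩)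
        left_mem_uIcc
      rwa [uIcc_of_le hT] at this
    exact h1.comp_continuous hclc hclm
  have hexp : ∀ t, Real.exp (-(κ * cl t)) ≤ 1 := fun t =>
    Real.exp_le_one_iff.2 (by have := (hclm t).1; simp only [Left.neg_nonpos_iff]; positivity)
  have hΦb : ∀ w : ℝ →ᵇ E, ∃ M, ∀ t,
      ‖Real.exp (-(κ * cl t)) • ∫ s in (0 : ℝ)..cl t, J w s‖ ≤ M := by
    intro w
    obtain ⟨M, hM⟩ := hJb w
    have hM0 : 0 ≤ M := (norm_nonneg _).trans (hM 0 ⟨le_rfl, hT⟩)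
    refine ⟨1 * (M * T), fun t => ?_⟩
    have h1 := intervalIntegral.norm_integral_le_of_norm_le_const (a := (0 : ℝ)) (b := cl t)
      (f := J w) (C := M) (fun s hs => by
        rw [uIoc_of_le (hclm t).1] at hs
        exact hM s ⟨hs.1.le, hs.2.trans (hclm t).2⟩)
    rw [sub_zero, abs_of_nonneg (hclm t).1] at h1
    rw [norm_smul, Real.norm_eq_abs, Real.abs_exp]
    have := (hclm t).2
    gcongr
    · exact hexp t
    · exact h1.trans (by gcongr)
  choose M hM using hΦb
  set Φ : (ℝ →ᵇ E) → (ℝ →ᵇ E) := fun w =>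
    BoundedContinuousFunction.ofNormedAddCommGroup
      (fun t => Real.exp (-(κ * cl t)) • ∫ s in (0 : ℝ)..cl t, J w s)
      (by have := hPc w; fun_prop) (M w) (hM w) with hΦ
  have hΦapp : ∀ w t, Φ w t = Real.exp (-(κ * cl t)) • ∫ s in (0 : ℝ)..cl t, J w s :=
    fun _ _ => rfl
  have hcontr : ContractingWith (1 / 2) Φ := by
    refine ⟨by rw [← NNReal.coe_lt_coe]; norm_num, LipschitzWith.of_dist_le_mul fun w w' => ?_⟩
    rw [BoundedContinuousFunction.dist_le (by positivity)]
    intro t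
    rw [hΦapp, hΦapp, dist_eq_norm, ← smul_sub, norm_smul, Real.norm_eq_abs, Real.abs_exp,
      ← intervalIntegral.integral_sub (hJii w _ (hclm t)) (hJii w' _ (hclm t))]
    have h1 : ‖∫ s in (0 : ℝ)..cl t, (J w s - J w' s)‖ ≤
        ∫ s in (0 : ℝ)..cl t, 2 * K * dist w w' * Real.exp (κ * s) :=
      intervalIntegral.norm_integral_le_of_norm_le (hclm t).1
        (Eventually.of_forall fun s hs => hJd w w' s ⟨hs.1.le, hs.2.trans (hclm t).2⟩)
        (Continuous.intervalIntegrable (by fun_prop) _ _)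
    have h2 : ∫ s in (0 : ℝ)..cl t, 2 * K * dist w w' * Real.exp (κ * s) =
        2 * K * dist w w' * ((Real.exp (κ * cl t) - 1) / κ) := by
      rw [intervalIntegral.integral_const_mul,
        intervalIntegral.integral_comp_mul_left (fun s => Real.exp s) hκ0.ne', integral_exp]
      simp [div_eq_inv_mul]
    calc _ ≤ Real.exp (-(κ * cl t)) * (2 * K * dist w w' * ((Real.exp (κ * cl t) - 1) / κ)) := by
          rw [← h2]; gcongr
      _ ≤ Real.exp (-(κ * cl t)) * (2 * K * dist w w' * (Real.exp (κ * cl t) / κ)) := by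
          gcongr; linarith
      _ = 2 * K / κ * dist w w' := by
          have : Real.exp (-(κ * cl t)) * Real.exp (κ * cl t) = 1 := by
            rw [← Real.exp_add]; simp
          linear_combination (2 * K / κ * dist w w') * this
      _ ≤ ((1 / 2 : NNReal) : ℝ) * dist w w' := by
          gcongr
          rw [div_le_iff₀ hκ0]
          push_cast; linarith
  have hfix := hcontr.fixedPoint_isFixedPt
  set w := ContractingWith.fixedPoint Φ hcontr
  have hUw : ∀ t, U w t = ∫ s in (0 : ℝ)..cl t, J w s := by
    intro t
    have h1 : Φ w t = w t := by rw [hfix]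
    rw [hΦapp] at h1
    simp only [hU]
    rw [← h1, smul_smul, ← Real.exp_add]
    simp
  refine ⟨U w, hUc w, fun t ht => ?_, fun t ht => ?_⟩
  · rw [hUw]
    have : cl t = 0 := by simp only [hcl]; rw [min_eq_left (ht.trans hT), max_eq_left ht]
    rw [this, intervalIntegral.integral_same]
  · rw [hUw, hcle t ht]

end Existence

/-! ### The delay equation with a globally Lipschitz nonlinearity -/

section Calculus

variable {E : Type*} [NormedAddCommGroup E] [NormedSpace ℝ E]

theorem intervalIntegrable_of_bound {f : ℝ → E} {a b c d C : ℝ} (hf : StronglyMeasurable f)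
    (hC : ∀ t ∈ Icc a b, ‖f t‖ ≤ C) (hc : c ∈ Icc a b) (hd : d ∈ Icc a b) :
    IntervalIntegrable f volume c d := by
  rw [intervalIntegrable_iff]
  refine Measure.integrableOn_of_bounded (M := C) (by simp [uIoc]) hf.aestronglyMeasurable ?_
  refine (ae_restrict_mem measurableSet_uIoc).mono fun t ht => hC t ?_
  exact (uIcc_subset_Icc hc hd) (uIoc_subset_uIcc ht)

theorem norm_taylor_le {F : E → E} {L : ℝ} (hF : ContDiff ℝ 2 F)
    (hL : ∀ x, ‖fderiv ℝ (fderiv ℝ F) x‖ ≤ L) (x y : E) :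
    ‖F y - F x - fderiv ℝ F x (y - x)‖ ≤ L * ‖y - x‖ ^ 2 := by
  have hd : Differentiable ℝ F := hF.differentiable (by simp)
  have hd' : Differentiable ℝ (fderiv ℝ F) :=
    (hF.fderiv_right (m := 1) (by norm_num)).differentiable (by simp)
  have hL0 : 0 ≤ L := (norm_nonneg _).trans (hL x)
  have h1 := (convex_closedBall x ‖y - x‖).norm_image_sub_le_of_norm_hasFDerivWithin_le'
    (f := F) (f' := fderiv ℝ F) (φ := fderiv ℝ F x) (C := L * ‖y - x‖)
    (fun c _ => (hd c).hasFDerivAt.hasFDerivWithinAt)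
    (fun c hc => by
      have := convex_univ.norm_image_sub_le_of_norm_fderiv_le (f := fderiv ℝ F)
        (fun z _ => hd' z) (fun z _ => hL z) (mem_univ x) (mem_univ c)
      refine this.trans ?_
      rw [Metric.mem_closedBall, dist_eq_norm] at hc
      gcongr)
    (Metric.mem_closedBall_self (norm_nonneg _))
    (show y ∈ _ by rw [Metric.mem_closedBall, dist_eq_norm])
  rw [pow_two, ← mul_assoc]; exact h1

/-- Gronwall's inequality for a linear Volterra equation with delay `σ`, source terms `e` (under
the integral) and `k` (outside). -/
theorem norm_le_of_delay_volterra {T σ L a : ℝ} (hT : 0 ≤ T) (hσ : 0 ≤ σ) (hL : 0 ≤ L)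
    (ha : 0 ≤ a) {q Φ : ℝ → E} {e k : ℝ → ℝ} (hq : IntegrableOn q (Icc 0 T))
    (hneg : ∀ t < 0, q t = 0) (he : IntegrableOn e (Icc 0 T)) (he0 : ∀ t, 0 ≤ e t)
    (hk : IntegrableOn k (Icc 0 T)) (hk0 : ∀ t, 0 ≤ k t)
    (hqle : ∀ t ∈ Icc 0 T, ‖q t‖ ≤ ‖∫ s in (0 : ℝ)..t, Φ s‖ + k t)
    (hΦ : ∀ s ∈ Ioc 0 T, ‖Φ s‖ ≤ L * ‖q s‖ + a * ‖q (s - σ)‖ + e s) :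
    ∀ t ∈ Icc 0 T, ‖q t‖ ≤ k t + (1 + (L + a) * Real.exp ((L + a) * T) * T) *
      (∫ s in (0 : ℝ)..T, e s) + (L + a) * Real.exp ((L + a) * T) * ∫ s in (0 : ℝ)..T, k s := by
  have hTm : T ∈ Icc 0 T := ⟨hT, le_rfl⟩
  have ii : ∀ {w : ℝ → ℝ}, IntegrableOn w (Icc 0 T) → ∀ t ∈ Icc 0 T,
      IntervalIntegrable w volume 0 t := fun hw t ht => by
    rw [intervalIntegrable_iff_integrableOn_Icc_of_le ht.1]
    exact hw.mono_set (Icc_subset_Icc_right ht.2)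
  set e₀ := ∫ s in (0 : ℝ)..T, e s with he₀
  have he₀0 : 0 ≤ e₀ := intervalIntegral.integral_nonneg hT fun s _ => he0 s
  have hqn : IntegrableOn (fun t => ‖q t‖) (Icc 0 T) := hq.norm
  have hneg' : ∀ t < 0, ‖q t‖ = 0 := fun t ht => by rw [hneg t ht, norm_zero]
  have main := le_of_delay_inequality (T := T) (u := fun t => ‖q t‖) (h := fun t => k t + e₀)
    hσ hL ha hqn (hk.add (integrableOn_const (by simp))) (fun t => norm_nonneg _) hneg'
    (fun t => add_nonneg (hk0 t) he₀0) (fun t ht => by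
      have hd := (integral_comp_sub_le hσ hqn (fun t => norm_nonneg _) hneg' ht).1
      have h1 := ((ii hqn t ht).const_mul L).add (hd.const_mul a)
      have h2 : ‖∫ s in (0 : ℝ)..t, Φ s‖ ≤
          ∫ s in (0 : ℝ)..t, (L * ‖q s‖ + a * ‖q (s - σ)‖ + e s) :=
        intervalIntegral.norm_integral_le_of_norm_le ht.1
          (Eventually.of_forall fun s hs => hΦ s ⟨hs.1, hs.2.trans ht.2⟩) (h1.add (ii he t ht))
      rw [intervalIntegral.integral_add h1 (ii he t ht)] at h2
      have h3 : ∫ s in (0 : ℝ)..t, e s ≤ e₀ :=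
        intervalIntegral.integral_mono_interval le_rfl ht.1 ht.2
          (Eventually.of_forall he0) (ii he T hTm)
      linarith [hqle t ht])
  intro t ht
  refine (main t ht).trans (le_of_eq ?_)
  rw [intervalIntegral.integral_add (ii hk T hTm) (by simp), intervalIntegral.integral_const,
    sub_zero, smul_eq_mul]
  ring

variable [CompleteSpace E]

theorem integral_eq_sub_of_bounded_deriv {u v : ℝ → E} {a b C : ℝ} {S : Set ℝ}
    (hS : S.Countable) (hu : ContinuousOn u (Icc a b))
    (hd : ∀ t ∈ Ioo a b \ S, HasDerivAt u (v t) t) (hv : StronglyMeasurable v)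
    (hC : ∀ t ∈ Icc a b, ‖v t‖ ≤ C) {c d : ℝ} (hc : c ∈ Icc a b) (hd' : d ∈ Icc a b) :
    ∫ t in c..d, v t = u d - u c := by
  refine integral_eq_of_hasDerivAt_off_countable u v hS (hu.mono (uIcc_subset_Icc hc hd'))
    (fun t ht => hd t ⟨⟨?_, ?_⟩, ht.2⟩) (intervalIntegrable_of_bound hv hC hc hd')
  · exact (le_min hc.1 hd'.1).trans_lt ht.1.1
  · exact ht.1.2.trans_le (max_le hc.2 hd'.2)

theorem norm_sub_le_of_bounded_deriv {u v : ℝ → E} {a b C : ℝ} {S : Set ℝ}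
    (hS : S.Countable) (hu : ContinuousOn u (Icc a b))
    (hd : ∀ t ∈ Ioo a b \ S, HasDerivAt u (v t) t) (hv : StronglyMeasurable v)
    (hC : ∀ t ∈ Icc a b, ‖v t‖ ≤ C) {c d : ℝ} (hc : c ∈ Icc a b) (hd' : d ∈ Icc a b) :
    ‖u d - u c‖ ≤ C * |d - c| := by
  rw [← integral_eq_sub_of_bounded_deriv hS hu hd hv hC hc hd']
  exact intervalIntegral.norm_integral_le_of_norm_le_const fun t ht =>
    hC t ((uIcc_subset_Icc hc hd') (uIoc_subset_uIcc ht))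

end Calculus

/-- The data of the delay equation, with the initial history `φ` extended to a `C¹` function and
the source `g` to a continuous function on the line, and with a nonlinearity `F` whose first two
derivatives are bounded by `L`. -/
structure DelayProblem (E : Type*) [NormedAddCommGroup E] [NormedSpace ℝ E] where
  F : E → E
  A : E →L[ℝ] E
  φ : ℝ → E
  φ' : ℝ → E
  g : ℝ → E
  b : ℝ
  T : ℝ
  L : ℝ
  b_pos : 0 < b
  T_pos : 0 < T
  contDiff : ContDiff ℝ 2 F
  norm_fderiv_le : ∀ x, ‖fderiv ℝ F x‖ ≤ L
  norm_fderiv_fderiv_le : ∀ x, ‖fderiv ℝ (fderiv ℝ F) x‖ ≤ L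
  hasDerivAt_φ : ∀ t, HasDerivAt φ (φ' t) t
  continuous_φ' : Continuous φ'
  continuous_g : Continuous g

namespace DelayProblem

variable {E : Type*} [NormedAddCommGroup E] [NormedSpace ℝ E] (P : DelayProblem E)

theorem L_nonneg : 0 ≤ P.L := (norm_nonneg _).trans (P.norm_fderiv_le 0)

theorem continuous_φ : Continuous P.φ :=
  continuous_iff_continuousAt.2 fun t => (P.hasDerivAt_φ t).continuousAt

theorem differentiable_F : Differentiable ℝ P.F := P.contDiff.differentiable (by simp)

theorem contDiff_fderiv : ContDiff ℝ 1 (fderiv ℝ P.F) :=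
  P.contDiff.fderiv_right (m := 1) (by norm_num)

theorem differentiable_fderiv : Differentiable ℝ (fderiv ℝ P.F) :=
  P.contDiff_fderiv.differentiable (by simp)

theorem continuous_fderiv : Continuous (fderiv ℝ P.F) := P.contDiff_fderiv.continuous

theorem continuous_fderiv_fderiv : Continuous (fderiv ℝ (fderiv ℝ P.F)) :=
  P.contDiff_fderiv.continuous_fderiv (by simp)

theorem norm_F_sub_le (x y : E) : ‖P.F x - P.F y‖ ≤ P.L * ‖x - y‖ :=
  convex_univ.norm_image_sub_le_of_norm_fderiv_le (fun z _ => P.differentiable_F z)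
    (fun z _ => P.norm_fderiv_le z) (mem_univ y) (mem_univ x)

theorem norm_fderiv_sub_le (x y : E) : ‖fderiv ℝ P.F x - fderiv ℝ P.F y‖ ≤ P.L * ‖x - y‖ :=
  convex_univ.norm_image_sub_le_of_norm_fderiv_le (fun z _ => P.differentiable_fderiv z)
    (fun z _ => P.norm_fderiv_fderiv_le z) (mem_univ y) (mem_univ x)

/-- `x` solves the delay equation with delay `τ`, in integrated form. -/
structure IsState (τ : ℝ) (x : ℝ → E) : Prop where
  continuous : Continuous x
  history : ∀ t ≤ 0, x t = P.φ t
  eq : ∀ t ∈ Icc 0 P.T,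
    x t = P.φ 0 + ∫ s in (0 : ℝ)..t, (-P.F (x s) + P.A (x (s - τ)) + P.g s)

/-- The time derivative of the state `x`. At the possible kink `t = 0` the right derivative is
chosen. -/
noncomputable def velocity (τ : ℝ) (x : ℝ → E) (t : ℝ) : E :=
  if t < 0 then P.φ' t else -P.F (x t) + P.A (x (t - τ)) + P.g t

/-- `z` solves, in integrated form, the equation obtained by differentiating the delay equation
once with respect to the delay. The forcing term `-A ẋ(t - τ)` is integrated exactly. -/
structure IsSensitivity (τ : ℝ) (x z : ℝ → E) : Prop where
  continuous : Continuous z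
  history : ∀ t ≤ 0, z t = 0
  eq : ∀ t ∈ Icc 0 P.T,
    z t = (∫ s in (0 : ℝ)..t, (-fderiv ℝ P.F (x s) (z s) + P.A (z (s - τ))))
      - P.A (x (t - τ) - P.φ (-τ))

/-- The time derivative of the sensitivity `z`. -/
noncomputable def sensitivityVelocity (τ : ℝ) (x z : ℝ → E) (t : ℝ) : E :=
  if t < 0 then 0 else
    -fderiv ℝ P.F (x t) (z t) + P.A (z (t - τ)) - P.A (P.velocity τ x (t - τ))

/-- `y` solves the integral equation for the second derivative with respect to the delay. -/
structure IsSecondSensitivity (τ : ℝ) (x z y : ℝ → E) : Prop where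
  stronglyMeasurable : StronglyMeasurable y
  bounded : ∃ C, ∀ t ≤ P.T, ‖y t‖ ≤ C
  history : ∀ t ≤ 0, y t = 0
  eq : ∀ t ∈ Ioc 0 P.T,
    y t = (∫ s in (0 : ℝ)..t,
        (-(fderiv ℝ (fderiv ℝ P.F) (x s) (z s) (z s) + fderiv ℝ P.F (x s) (y s))
          + P.A (y (s - τ))))
      - (2 : ℝ) • P.A (z (t - τ)) + P.A (P.velocity τ x (t - τ)) - P.A (P.φ' (-τ))

variable {P}

theorem IsState.continuous_rhs {τ : ℝ} {x : ℝ → E} (hx : P.IsState τ x) :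
    Continuous fun s => -P.F (x s) + P.A (x (s - τ)) + P.g s := by
  have := hx.continuous
  have := P.continuous_g
  have := P.differentiable_F.continuous
  fun_prop

variable [CompleteSpace E]

theorem exists_isState {τ : ℝ} (hτ : τ ∈ Icc 0 P.b) : ∃ x, P.IsState τ x := by
  have hφ := P.continuous_φ
  have hg := P.continuous_g
  have hF := P.differentiable_F.continuous
  set G : ℝ → E → E → E := fun s u w =>
    -P.F (P.φ 0 + u) + P.A (P.φ (min (s - τ) 0) + w) + P.g s with hG
  have hG0 : Continuous fun s => G s 0 0 := by simp only [hG]; fun_prop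
  obtain ⟨C, hC⟩ := (isCompact_Icc (a := 0) (b := P.T)).exists_bound_of_continuousOn
    hG0.continuousOn
  obtain ⟨u, hu, hu0, hueq⟩ := exists_delay_volterra_solution (K := P.L + ‖P.A‖) P.T_pos.le hτ.1
    (add_nonneg P.L_nonneg (norm_nonneg _)) G (fun s _ u u' w w' => by
      have h1 := P.norm_F_sub_le (P.φ 0 + u') (P.φ 0 + u)
      have h2 := P.A.le_opNorm (w - w')
      rw [add_sub_add_left_eq_sub, norm_sub_rev u' u] at h1
      have h3 : G s u w - G s u' w' = (P.F (P.φ 0 + u') - P.F (P.φ 0 + u)) + P.A (w - w') := by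
        simp only [hG, map_add, map_sub]; abel
      rw [h3]
      have h4 : 0 ≤ P.L * ‖w - w'‖ := mul_nonneg P.L_nonneg (norm_nonneg _)
      have h5 : 0 ≤ ‖P.A‖ * ‖u - u'‖ := by positivity
      linarith [norm_add_le (P.F (P.φ 0 + u') - P.F (P.φ 0 + u)) (P.A (w - w'))])
    (fun u w hu hw => by
      refine Continuous.aestronglyMeasurable ?_
      simp only [hG]; fun_prop) hC
  refine ⟨fun t => P.φ (min t 0) + u t, by fun_prop, fun t ht => ?_, fun t ht => ?_⟩
  · simp only [min_eq_left ht, hu0 t ht, add_zero]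
  · simp only [min_eq_right ht.1]
    rw [hueq t ht]
    congr 1
    refine intervalIntegral.integral_congr fun s hs => ?_
    rw [uIcc_of_le ht.1] at hs
    simp only [hG, min_eq_right hs.1]

/-- Solvability of the linear equation `w = h + ∫ (f - DF(x) w + A w(· - τ))`, in terms of the
continuous part `u = w - h`. -/
theorem exists_linear_delay_solution {τ : ℝ} (hτ : τ ∈ Icc 0 P.b) {x : ℝ → E}
    (hx : Continuous x) {f h : ℝ → E} {C : ℝ} (hf : StronglyMeasurable f)
    (hfC : ∀ t ∈ Icc 0 P.T, ‖f t‖ ≤ C) (hh : StronglyMeasurable h)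
    (hhC : ∀ t ∈ Icc (-P.b) P.T, ‖h t‖ ≤ C) :
    ∃ u : ℝ → E, Continuous u ∧ (∀ t ≤ 0, u t = 0) ∧ ∀ t ∈ Icc 0 P.T, u t =
      ∫ s in (0 : ℝ)..t, (f s - fderiv ℝ P.F (x s) (u s + h s)
        + P.A (u (s - τ) + h (s - τ))) := by
  have hDF := P.continuous_fderiv
  set G : ℝ → E → E → E := fun s u w =>
    f s - fderiv ℝ P.F (x s) (u + h s) + P.A (w + h (s - τ)) with hG
  have hb := P.b_pos
  refine exists_delay_volterra_solution (K := P.L + ‖P.A‖) (C := C + P.L * C + ‖P.A‖ * C)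
    P.T_pos.le hτ.1 (add_nonneg P.L_nonneg (norm_nonneg _)) G (fun s _ u u' w w' => ?_)
    (fun u w hu hw => ?_) (fun s hs => ?_)
  · have h1 := (fderiv ℝ P.F (x s)).le_of_opNorm_le (P.norm_fderiv_le _) (u' - u)
    have h2 := P.A.le_opNorm (w - w')
    rw [norm_sub_rev u' u] at h1
    have h3 : G s u w - G s u' w' = fderiv ℝ P.F (x s) (u' - u) + P.A (w - w') := by
      simp only [hG, map_add, map_sub]; abel
    rw [h3]
    have h4 : 0 ≤ P.L * ‖w - w'‖ := mul_nonneg P.L_nonneg (norm_nonneg _)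
    have h5 : 0 ≤ ‖P.A‖ * ‖u - u'‖ := by positivity
    linarith [norm_add_le (fderiv ℝ P.F (x s) (u' - u)) (P.A (w - w'))]
  · have h1 : StronglyMeasurable fun s => fderiv ℝ P.F (x s) (u s + h s) :=
      isBoundedBilinearMap_apply.continuous.comp_stronglyMeasurable
        ((hDF.comp hx).stronglyMeasurable.prodMk (hu.stronglyMeasurable.add hh))
    have h2 : StronglyMeasurable fun s => P.A (w s + h (s - τ)) :=
      P.A.continuous.comp_stronglyMeasurable (hw.stronglyMeasurable.add
        (hh.comp_measurable (measurable_id.sub_const τ)))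
    exact ((hf.sub h1).add h2).aestronglyMeasurable
  · simp only [hG, zero_add]
    have hC0 : 0 ≤ C := (norm_nonneg _).trans (hfC s hs)
    have h1 := (fderiv ℝ P.F (x s)).le_of_opNorm_le_of_le (P.norm_fderiv_le _)
      (hhC s ⟨by linarith [hs.1], hs.2⟩)
    have h2 := P.A.le_opNorm_of_le (hhC (s - τ)
      ⟨by linarith [hs.1, hτ.2], by linarith [hs.2, hτ.1]⟩)
    exact (norm_add_le _ _).trans (add_le_add ((norm_sub_le _ _).trans
      (add_le_add (hfC s hs) h1)) h2)

section State

variable {τ : ℝ} {x : ℝ → E}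

theorem IsState.stronglyMeasurable_velocity (hx : P.IsState τ x) :
    StronglyMeasurable (P.velocity τ x) :=
  StronglyMeasurable.ite (measurableSet_lt measurable_id measurable_const)
    P.continuous_φ'.stronglyMeasurable hx.continuous_rhs.stronglyMeasurable

theorem IsState.exists_velocity_bound (hx : P.IsState τ x) :
    ∃ C, ∀ t ∈ Icc (-P.b) P.T, ‖P.velocity τ x t‖ ≤ C := by
  obtain ⟨C₁, h₁⟩ := (isCompact_Icc (a := -P.b) (b := P.T)).exists_bound_of_continuousOn
    P.continuous_φ'.continuousOn
  obtain ⟨C₂, h₂⟩ := (isCompact_Icc (a := -P.b) (b := P.T)).exists_bound_of_continuousOn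
    hx.continuous_rhs.continuousOn
  refine ⟨max C₁ C₂, fun t ht => ?_⟩
  unfold velocity
  split_ifs
  · exact (h₁ t ht).trans (le_max_left _ _)
  · exact (h₂ t ht).trans (le_max_right _ _)

theorem IsState.hasDerivAt (hx : P.IsState τ x) {t : ℝ} (ht : t < P.T) (h0 : t ≠ 0) :
    HasDerivAt x (P.velocity τ x t) t := by
  rcases lt_or_gt_of_ne h0 with h | h
  · rw [velocity, if_pos h]
    refine (P.hasDerivAt_φ t).congr_of_eventuallyEq ?_
    filter_upwards [gt_mem_nhds h] with s hs using hx.history s hs.le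
  · rw [velocity, if_neg h.not_gt]
    have hc := hx.continuous_rhs
    have hd : HasDerivAt (fun t => P.φ 0 + ∫ s in (0 : ℝ)..t,
        (-P.F (x s) + P.A (x (s - τ)) + P.g s)) (-P.F (x t) + P.A (x (t - τ)) + P.g t) t :=
      (intervalIntegral.integral_hasDerivAt_right (hc.intervalIntegrable _ _)
        (hc.stronglyMeasurableAtFilter _ _) hc.continuousAt).const_add _
    refine hd.congr_of_eventuallyEq ?_
    filter_upwards [Ioo_mem_nhds h ht] with s hs using hx.eq s ⟨hs.1.le, hs.2.le⟩

theorem IsState.integral_velocity (hx : P.IsState τ x) {c d : ℝ} (hc : c ∈ Icc (-P.b) P.T)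
    (hd : d ∈ Icc (-P.b) P.T) : ∫ t in c..d, P.velocity τ x t = x d - x c := by
  obtain ⟨C, hC⟩ := hx.exists_velocity_bound
  exact integral_eq_sub_of_bounded_deriv (countable_singleton 0) hx.continuous.continuousOn
    (fun t ht => hx.hasDerivAt ht.1.2 ht.2) hx.stronglyMeasurable_velocity hC hc hd

theorem IsState.exists_lipschitz (hx : P.IsState τ x) :
    ∃ C, 0 ≤ C ∧ ∀ c ∈ Icc (-P.b) P.T, ∀ d ∈ Icc (-P.b) P.T, ‖x d - x c‖ ≤ C * |d - c| := by
  obtain ⟨C, hC⟩ := hx.exists_velocity_bound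
  have hb := P.b_pos
  have hT := P.T_pos
  exact ⟨C, (norm_nonneg _).trans (hC 0 ⟨by linarith, hT.le⟩), fun c hc d hd =>
    norm_sub_le_of_bounded_deriv (countable_singleton 0)
      hx.continuous.continuousOn (fun t ht => hx.hasDerivAt ht.1.2 ht.2)
      hx.stronglyMeasurable_velocity hC hc hd⟩

/-- States depend Lipschitz continuously on the delay. -/
theorem IsState.exists_dist_le (hτ : τ ∈ Icc 0 P.b) (hx : P.IsState τ x) :
    ∃ C, 0 ≤ C ∧ ∀ σ ∈ Icc 0 P.b, ∀ y, P.IsState σ y → ∀ t ≤ P.T, ‖y t - x t‖ ≤ C * |σ - τ| := by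
  obtain ⟨M, hM0, hM⟩ := hx.exists_lipschitz
  have hb := P.b_pos
  have hT := P.T_pos
  have hL := P.L_nonneg
  set κ := (P.L + ‖P.A‖) * Real.exp ((P.L + ‖P.A‖) * P.T) with hκ
  have hκ0 : 0 ≤ κ := by positivity
  refine ⟨(1 + κ * P.T) * (P.T * (‖P.A‖ * M)), by positivity, fun σ hσ y hy t ht => ?_⟩
  have hneg : ∀ t ≤ 0, y t - x t = 0 := fun t ht => by
    rw [hx.history t ht, hy.history t ht, sub_self]
  rcases le_total t 0 with h0 | h0
  · rw [hneg t h0, norm_zero]; positivity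
  have hxc := hx.continuous
  have hyc := hy.continuous
  have hIc : ∀ {f : ℝ → E}, Continuous f → IntegrableOn f (Icc 0 P.T) := fun hf =>
    hf.continuousOn.integrableOn_Icc
  have key := norm_le_of_delay_volterra (T := P.T) (σ := σ) (L := P.L) (a := ‖P.A‖)
    (q := fun t => y t - x t) (e := fun _ => ‖P.A‖ * M * |σ - τ|) (k := fun _ => 0)
    (Φ := fun s => (-P.F (y s) + P.A (y (s - σ)) + P.g s) -
      (-P.F (x s) + P.A (x (s - τ)) + P.g s))
    hT.le hσ.1 hL (norm_nonneg _) (hIc (hyc.sub hxc)) (fun t ht => hneg t ht.le)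
    (integrableOn_const (by simp)) (fun _ => by positivity) integrableOn_zero (fun _ => le_rfl)
    (fun t ht => by
      rw [hx.eq t ht, hy.eq t ht, add_sub_add_left_eq_sub, ← intervalIntegral.integral_sub
        (hy.continuous_rhs.intervalIntegrable _ _) (hx.continuous_rhs.intervalIntegrable _ _),
        add_zero])
    (fun s hs => by
      have h1 := P.norm_F_sub_le (x s) (y s)
      rw [norm_sub_rev (x s)] at h1
      have h2 := P.A.le_opNorm (y (s - σ) - x (s - σ))
      have h3 := P.A.le_opNorm_of_le (hM (s - τ) ⟨by linarith [hs.1, hτ.2], by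
        linarith [hs.2, hτ.1]⟩ (s - σ) ⟨by linarith [hs.1, hσ.2], by linarith [hs.2, hσ.1]⟩)
      rw [show s - σ - (s - τ) = -(σ - τ) by ring, abs_neg] at h3
      have h4 : (-P.F (y s) + P.A (y (s - σ)) + P.g s) - (-P.F (x s) + P.A (x (s - τ)) + P.g s) =
        (P.F (x s) - P.F (y s)) + P.A (y (s - σ) - x (s - σ)) + P.A (x (s - σ) - x (s - τ)) := by
        simp only [map_sub]; abel
      rw [h4, mul_assoc]
      exact norm_add₃_le.trans (by linarith))
    t ⟨h0, ht⟩
  refine key.trans (le_of_eq ?_)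
  simp only [intervalIntegral.integral_const, intervalIntegral.integral_zero, smul_eq_mul]
  ring

theorem IsState.unique (hτ : τ ∈ Icc 0 P.b) (hx : P.IsState τ x) {y : ℝ → E}
    (hy : P.IsState τ y) : ∀ t ≤ P.T, y t = x t := by
  obtain ⟨C, -, hC⟩ := hx.exists_dist_le hτ
  intro t ht
  simpa [sub_eq_zero] using hC τ hτ y hy t ht

/-- The first-order remainder, at the point `s - τ`, of a shift of the state. -/
noncomputable def shiftRemainder (P : DelayProblem E) (τ : ℝ) (x : ℝ → E) (σ s : ℝ) : E :=
  x (s - σ) - x (s - τ) + (σ - τ) • P.velocity τ x (s - τ)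

theorem IsState.stronglyMeasurable_shiftRemainder (hx : P.IsState τ x) (σ : ℝ) :
    StronglyMeasurable (P.shiftRemainder τ x σ) := by
  have hc := hx.continuous
  have h1 : Continuous fun s => x (s - σ) - x (s - τ) := by fun_prop
  exact h1.stronglyMeasurable.add ((hx.stronglyMeasurable_velocity.comp_measurable
    (measurable_id.sub_const τ)).const_smul (σ - τ))

theorem IsState.exists_shiftRemainder_bound (hτ : τ ∈ Icc 0 P.b) (hx : P.IsState τ x) :
    ∃ C, 0 ≤ C ∧ ∀ σ ∈ Icc 0 P.b, ∀ s ∈ Icc 0 P.T, ‖P.shiftRemainder τ x σ s‖ ≤ C * |σ - τ| := by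
  obtain ⟨M, hM0, hM⟩ := hx.exists_lipschitz
  obtain ⟨C, hC⟩ := hx.exists_velocity_bound
  have hb := P.b_pos
  have hT := P.T_pos
  have hC0 : 0 ≤ C := (norm_nonneg _).trans (hC 0 ⟨by linarith, hT.le⟩)
  refine ⟨M + C, by positivity, fun σ hσ s hs => ?_⟩
  have hm : ∀ ρ ∈ Icc 0 P.b, s - ρ ∈ Icc (-P.b) P.T := fun ρ hρ =>
    ⟨by linarith [hs.1, hρ.2], by linarith [hs.2, hρ.1]⟩
  have h1 := hM _ (hm τ hτ) _ (hm σ hσ)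
  rw [show s - σ - (s - τ) = -(σ - τ) by ring, abs_neg] at h1
  have h2 := hC _ (hm τ hτ)
  calc _ ≤ ‖x (s - σ) - x (s - τ)‖ + ‖(σ - τ) • P.velocity τ x (s - τ)‖ := norm_add_le _ _
    _ ≤ M * |σ - τ| + |σ - τ| * C := by rw [norm_smul, Real.norm_eq_abs]; gcongr
    _ = _ := by ring

theorem IsState.isLittleO_shiftRemainder (hτ : τ ∈ Icc 0 P.b) (hx : P.IsState τ x) {s : ℝ}
    (hs : s ∈ Ioo 0 P.T) (hne : s ≠ τ) (S : Set ℝ) :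
    (fun σ => P.shiftRemainder τ x σ s) =o[𝓝[S] τ] fun σ => σ - τ := by
  have h1 := hx.hasDerivAt (t := s - τ) (by linarith [hs.2, hτ.1]) (sub_ne_zero.2 hne)
  have h2 : HasDerivAt (fun σ => s - σ) (-1) τ := by
    simpa using (hasDerivAt_id τ).const_sub s
  have h3 : HasDerivAt (fun σ => x (s - σ)) ((-1 : ℝ) • P.velocity τ x (s - τ)) τ :=
    HasDerivAt.scomp τ h1 h2
  have h4 := (hasDerivAt_iff_isLittleO.1 h3).mono (nhdsWithin_le_nhds (s := S))
  refine h4.congr_left fun σ => ?_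
  rw [shiftRemainder]; simp

end State

end DelayProblem

/-! ### First derivative with respect to the delay -/

namespace DelayProblem

variable {E : Type*} [NormedAddCommGroup E] [NormedSpace ℝ E] [CompleteSpace E]
  {P : DelayProblem E} {τ : ℝ} {x z : ℝ → E}

section Sensitivity

theorem IsState.exists_isSensitivity (hτ : τ ∈ Icc 0 P.b) (hx : P.IsState τ x) :
    ∃ z, P.IsSensitivity τ x z := by
  have hxc := hx.continuous
  -- Replacing `t` by `max t 0` makes the term outside the integral vanish at negative times.
  set h : ℝ → E := fun t => -P.A (x (max t 0 - τ) - P.φ (-τ)) with hh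
  have hhc : Continuous h := by simp only [hh]; fun_prop
  obtain ⟨C, hC⟩ := (isCompact_Icc (a := -P.b) (b := P.T)).exists_bound_of_continuousOn
    hhc.continuousOn
  have hC0 : 0 ≤ C := (norm_nonneg _).trans (hC 0 ⟨by linarith [P.b_pos], P.T_pos.le⟩)
  obtain ⟨u, hu, hu0, hueq⟩ := exists_linear_delay_solution (f := fun _ => 0) (C := C) hτ hxc
    stronglyMeasurable_const (fun t _ => by simpa using hC0) hhc.stronglyMeasurable hC
  refine ⟨fun t => u t + h t, by fun_prop, fun t ht => ?_, fun t ht => ?_⟩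
  · simp only [hu0 t ht, hh, max_eq_right ht, zero_sub, zero_add]
    rw [hx.history _ (by linarith [hτ.1]), sub_self, map_zero, neg_zero]
  · simp only [zero_sub] at hueq
    rw [hueq t ht, sub_eq_add_neg]
    simp only [hh, max_eq_left ht.1]

theorem IsSensitivity.continuous_integrand (hx : P.IsState τ x) (hz : P.IsSensitivity τ x z) :
    Continuous fun s => -fderiv ℝ P.F (x s) (z s) + P.A (z (s - τ)) := by
  have := hx.continuous
  have := hz.continuous
  have := P.continuous_fderiv
  fun_prop

theorem IsSensitivity.stronglyMeasurable_velocity (hx : P.IsState τ x)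
    (hz : P.IsSensitivity τ x z) : StronglyMeasurable (P.sensitivityVelocity τ x z) :=
  StronglyMeasurable.ite (measurableSet_lt measurable_id measurable_const)
    stronglyMeasurable_const ((hz.continuous_integrand hx).stronglyMeasurable.sub
      (P.A.continuous.comp_stronglyMeasurable
        (hx.stronglyMeasurable_velocity.comp_measurable (measurable_id.sub_const τ))))

theorem IsSensitivity.exists_velocity_bound (hτ : τ ∈ Icc 0 P.b) (hx : P.IsState τ x)
    (hz : P.IsSensitivity τ x z) :
    ∃ C, ∀ t ∈ Icc (-P.b) P.T, ‖P.sensitivityVelocity τ x z t‖ ≤ C := by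
  obtain ⟨C₁, h₁⟩ := (isCompact_Icc (a := -P.b) (b := P.T)).exists_bound_of_continuousOn
    (hz.continuous_integrand hx).continuousOn
  obtain ⟨C₂, h₂⟩ := hx.exists_velocity_bound
  refine ⟨max 0 (C₁ + ‖P.A‖ * C₂), fun t ht => ?_⟩
  unfold sensitivityVelocity
  split_ifs with h
  · simp
  · have h0 : 0 ≤ t := not_lt.1 h
    refine le_trans ?_ (le_max_right _ _)
    exact (norm_sub_le _ _).trans (add_le_add (h₁ t ht) (P.A.le_opNorm_of_le
      (h₂ _ ⟨by linarith [hτ.2], by linarith [hτ.1, ht.2]⟩)))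

theorem IsSensitivity.hasDerivAt (hτ : τ ∈ Icc 0 P.b) (hx : P.IsState τ x)
    (hz : P.IsSensitivity τ x z) {t : ℝ} (ht : t < P.T) (h0 : t ≠ 0) (hne : t ≠ τ) :
    HasDerivAt z (P.sensitivityVelocity τ x z t) t := by
  rcases lt_or_gt_of_ne h0 with h | h
  · rw [sensitivityVelocity, if_pos h]
    refine (hasDerivAt_const t (0 : E)).congr_of_eventuallyEq ?_
    filter_upwards [gt_mem_nhds h] with s hs using hz.history s hs.le
  · rw [sensitivityVelocity, if_neg h.not_gt]
    have hc := hz.continuous_integrand hx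
    have hd := intervalIntegral.integral_hasDerivAt_right (hc.intervalIntegrable 0 t)
        (hc.stronglyMeasurableAtFilter _ _) hc.continuousAt
    have hd2 : HasDerivAt (fun t => x (t - τ)) (P.velocity τ x (t - τ)) t :=
      HasDerivAt.comp_sub_const t τ
        (hx.hasDerivAt (by linarith [hτ.1]) (sub_ne_zero.2 hne))
    have hd3 := P.A.hasFDerivAt.comp_hasDerivAt t (hd2.sub_const (P.φ (-τ)))
    refine (hd.sub hd3).congr_of_eventuallyEq ?_
    filter_upwards [Ioo_mem_nhds h ht] with s hs using hz.eq s ⟨hs.1.le, hs.2.le⟩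

theorem IsSensitivity.integral_velocity (hτ : τ ∈ Icc 0 P.b) (hx : P.IsState τ x)
    (hz : P.IsSensitivity τ x z) {t : ℝ} (ht : t ∈ Icc 0 P.T) :
    ∫ s in (0 : ℝ)..t, P.sensitivityVelocity τ x z s = z t := by
  obtain ⟨C, hC⟩ := hz.exists_velocity_bound hτ hx
  have := integral_eq_sub_of_bounded_deriv (a := -P.b) (b := P.T) (c := 0) (d := t)
    (Set.Countable.insert 0 (countable_singleton τ)) hz.continuous.continuousOn
    (fun t ht => hz.hasDerivAt hτ hx ht.1.2 (fun h => ht.2 (by simp [h]))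
      (fun h => ht.2 (by simp [h]))) (hz.stronglyMeasurable_velocity hx) hC
    ⟨by linarith [P.b_pos], P.T_pos.le⟩ ⟨by linarith [P.b_pos, ht.1], ht.2⟩
  rw [this, hz.history 0 le_rfl, sub_zero]

theorem IsSensitivity.exists_lipschitz (hτ : τ ∈ Icc 0 P.b) (hx : P.IsState τ x)
    (hz : P.IsSensitivity τ x z) :
    ∃ C, 0 ≤ C ∧ ∀ c ∈ Icc (-P.b) P.T, ∀ d ∈ Icc (-P.b) P.T, ‖z d - z c‖ ≤ C * |d - c| := by
  obtain ⟨C, hC⟩ := hz.exists_velocity_bound hτ hx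
  have hb := P.b_pos
  have hT := P.T_pos
  exact ⟨C, (norm_nonneg _).trans (hC 0 ⟨by linarith, hT.le⟩), fun c hc d hd =>
    norm_sub_le_of_bounded_deriv (Set.Countable.insert 0 (countable_singleton τ))
      hz.continuous.continuousOn (fun t ht => hz.hasDerivAt hτ hx ht.1.2
        (fun h => ht.2 (by simp [h])) (fun h => ht.2 (by simp [h])))
      (hz.stronglyMeasurable_velocity hx) hC hc hd⟩

theorem IsSensitivity.exists_bound (hz : P.IsSensitivity τ x z) :
    ∃ C, 0 ≤ C ∧ ∀ t ≤ P.T, ‖z t‖ ≤ C := by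
  obtain ⟨C, hC⟩ := (isCompact_Icc (a := 0) (b := P.T)).exists_bound_of_continuousOn
    hz.continuous.continuousOn
  have hC0 : 0 ≤ C := (norm_nonneg _).trans (hC 0 ⟨le_rfl, P.T_pos.le⟩)
  refine ⟨C, hC0, fun t ht => ?_⟩
  rcases le_total t 0 with h | h
  · rw [hz.history t h, norm_zero]; exact hC0
  · exact hC t ⟨h, ht⟩

end Sensitivity

section FirstDerivative

/-- The modulus that controls, up to a constant, the first-order remainder of the state. -/
noncomputable def remainderModulus (P : DelayProblem E) (τ : ℝ) (x : ℝ → E) (σ : ℝ) : ℝ :=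
  |σ - τ| ^ 2 + ∫ s in (0 : ℝ)..P.T, ‖P.shiftRemainder τ x σ s‖

theorem isLittleO_abs_sub_sq (S : Set ℝ) :
    (fun σ : ℝ => |σ - τ| ^ 2) =o[𝓝[S] τ] fun σ => σ - τ := by
  have h : Tendsto (fun σ : ℝ => σ - τ) (𝓝[S] τ) (𝓝 0) := by
    have : Tendsto (fun σ : ℝ => σ - τ) (𝓝 τ) (𝓝 (τ - τ)) := by
      exact (continuous_id.sub continuous_const).tendsto τ
    rw [sub_self] at this
    exact this.mono_left nhdsWithin_le_nhds
  have h2 : (fun r : ℝ => |r| ^ 2) =o[𝓝 0] fun r => r := by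
    simp_rw [sq_abs]
    simpa using Asymptotics.isLittleO_pow_id (𝕜 := ℝ) (n := 2) (by norm_num)
  exact h2.comp_tendsto h

theorem IsState.integrableOn_shiftRemainder (hτ : τ ∈ Icc 0 P.b) (hx : P.IsState τ x)
    {σ : ℝ} (hσ : σ ∈ Icc 0 P.b) :
    IntegrableOn (fun s => ‖P.shiftRemainder τ x σ s‖) (Icc 0 P.T) := by
  obtain ⟨C, -, hC⟩ := hx.exists_shiftRemainder_bound hτ
  exact Integrable.norm (Measure.integrableOn_of_bounded (M := C * |σ - τ|) (by simp)
    (hx.stronglyMeasurable_shiftRemainder σ).aestronglyMeasurable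
    ((ae_restrict_mem measurableSet_Icc).mono fun s hs => hC σ hσ s hs))

theorem remainderModulus_nonneg (σ : ℝ) : 0 ≤ P.remainderModulus τ x σ :=
  add_nonneg (by positivity)
    (intervalIntegral.integral_nonneg P.T_pos.le fun _ _ => norm_nonneg _)

theorem IsState.exists_remainderModulus_le (hτ : τ ∈ Icc 0 P.b) (hx : P.IsState τ x) :
    ∃ C, 0 ≤ C ∧ ∀ σ ∈ Icc 0 P.b, P.remainderModulus τ x σ ≤ C * |σ - τ| := by
  obtain ⟨C, hC0, hC⟩ := hx.exists_shiftRemainder_bound hτ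
  have hb := P.b_pos
  have hT := P.T_pos
  refine ⟨P.b + C * P.T, by positivity, fun σ hσ => ?_⟩
  have h1 : |σ - τ| ≤ P.b := by rw [abs_le]; constructor <;> linarith [hσ.1, hσ.2, hτ.1, hτ.2]
  have h2 : ∫ s in (0 : ℝ)..P.T, ‖P.shiftRemainder τ x σ s‖ ≤ C * |σ - τ| * P.T := by
    have := intervalIntegral.norm_integral_le_of_norm_le_const (a := (0 : ℝ)) (b := P.T)
      (f := fun s => ‖P.shiftRemainder τ x σ s‖) (C := C * |σ - τ|) (fun s hs => by
        rw [uIoc_of_le hT.le] at hs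
        rw [norm_norm]
        exact hC σ hσ s ⟨hs.1.le, hs.2⟩)
    rw [sub_zero, abs_of_pos hT] at this
    exact (le_abs_self _).trans this
  have h3 : |σ - τ| ^ 2 ≤ P.b * |σ - τ| := by rw [pow_two]; gcongr
  unfold remainderModulus
  linarith

theorem IsState.isLittleO_remainderModulus (hτ : τ ∈ Icc 0 P.b) (hx : P.IsState τ x) :
    P.remainderModulus τ x =o[𝓝[Icc 0 P.b] τ] fun σ => σ - τ := by
  obtain ⟨C, hC0, hC⟩ := hx.exists_shiftRemainder_bound hτ
  refine (isLittleO_abs_sub_sq _).add (isLittleO_integral (C := C) P.T_pos.le ?_ ?_ ?_)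
  · exact fun σ _ => (hx.stronglyMeasurable_shiftRemainder σ).norm.aestronglyMeasurable
  · intro σ hσ t ht
    rw [abs_norm]
    exact hC σ hσ t ⟨ht.1.le, ht.2⟩
  · rw [ae_restrict_iff' measurableSet_Ioc]
    have h1 : ∀ᵐ s : ℝ, s ≠ τ := by simp [ae_iff]
    have h2 : ∀ᵐ s : ℝ, s ≠ P.T := by simp [ae_iff]
    filter_upwards [h1, h2] with s hs1 hs2 hs
    exact (hx.isLittleO_shiftRemainder hτ ⟨hs.1, lt_of_le_of_ne hs.2 hs2⟩ hs1 _).norm_left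

/-- The first-order remainder of the velocity is controlled by that of the state, a quadratic term,
and the remainder of a shift of the unperturbed state. -/
theorem IsState.exists_velocity_remainder_le (hτ : τ ∈ Icc 0 P.b) (hx : P.IsState τ x)
    (hz : P.IsSensitivity τ x z) :
    ∃ C, 0 ≤ C ∧ ∀ σ ∈ Icc 0 P.b, ∀ y, P.IsState σ y → ∀ s ∈ Icc 0 P.T,
      ‖P.velocity σ y s - P.velocity τ x s - (σ - τ) • P.sensitivityVelocity τ x z s‖ ≤
        P.L * ‖y s - x s - (σ - τ) • z s‖
          + ‖P.A‖ * ‖y (s - σ) - x (s - σ) - (σ - τ) • z (s - σ)‖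
          + (C * |σ - τ| ^ 2 + ‖P.A‖ * ‖P.shiftRemainder τ x σ s‖) := by
  obtain ⟨C, hC0, hC⟩ := hx.exists_dist_le hτ
  obtain ⟨M, hM0, hM⟩ := hz.exists_lipschitz hτ hx
  have hL := P.L_nonneg
  refine ⟨P.L * C ^ 2 + ‖P.A‖ * M, by positivity, fun σ hσ y hy s hs => ?_⟩
  have h1 := norm_taylor_le P.contDiff P.norm_fderiv_fderiv_le (x s) (y s)
  have h2 := hC σ hσ y hy s hs.2
  have h1' : ‖P.F (y s) - P.F (x s) - fderiv ℝ P.F (x s) (y s - x s)‖ ≤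
      P.L * C ^ 2 * |σ - τ| ^ 2 := by
    refine h1.trans ?_
    rw [mul_assoc, ← mul_pow]
    gcongr
  have h3 := (fderiv ℝ P.F (x s)).le_of_opNorm_le (P.norm_fderiv_le _)
    (y s - x s - (σ - τ) • z s)
  have h4 := P.A.le_opNorm (y (s - σ) - x (s - σ) - (σ - τ) • z (s - σ))
  have h5 := P.A.le_opNorm (P.shiftRemainder τ x σ s)
  have hm : ∀ ρ ∈ Icc 0 P.b, s - ρ ∈ Icc (-P.b) P.T := fun ρ hρ =>
    ⟨by linarith [hs.1, hρ.2], by linarith [hs.2, hρ.1]⟩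
  have h6 := P.A.le_opNorm_of_le (hM _ (hm τ hτ) _ (hm σ hσ))
  rw [show s - σ - (s - τ) = -(σ - τ) by ring, abs_neg] at h6
  have h7 : ‖(σ - τ) • P.A (z (s - σ) - z (s - τ))‖ ≤ ‖P.A‖ * M * |σ - τ| ^ 2 := by
    rw [norm_smul, Real.norm_eq_abs]
    calc _ ≤ |σ - τ| * (‖P.A‖ * (M * |σ - τ|)) := by gcongr
      _ = _ := by ring
  -- Split `x[σ](s - σ) - x[τ](s - τ)` at `x[τ](s - σ)`; the increment of `z` is Lipschitz.
  have key : P.velocity σ y s - P.velocity τ x s - (σ - τ) • P.sensitivityVelocity τ x z s =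
      -(P.F (y s) - P.F (x s) - fderiv ℝ P.F (x s) (y s - x s))
      - fderiv ℝ P.F (x s) (y s - x s - (σ - τ) • z s)
      + P.A (y (s - σ) - x (s - σ) - (σ - τ) • z (s - σ))
      + (σ - τ) • P.A (z (s - σ) - z (s - τ)) + P.A (P.shiftRemainder τ x σ s) := by
    simp only [velocity, sensitivityVelocity, if_neg hs.1.not_gt, shiftRemainder, map_sub,
      map_add, map_smul, smul_sub, smul_add, smul_neg]
    abel_nf
  rw [key]
  refine (norm_add_le _ _).trans ((add_le_add_left (norm_add_le _ _) _).trans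
    ((add_le_add_left (add_le_add_left (norm_add_le _ _) _) _).trans
    ((add_le_add_left (add_le_add_left (add_le_add_left (norm_sub_le _ _) _) _) _).trans ?_)))
  rw [norm_neg]
  linarith

/-- The first-order remainder of the state is of smaller order than the increment of the delay,
uniformly in time. -/
theorem IsState.exists_remainder_le (hτ : τ ∈ Icc 0 P.b) (hx : P.IsState τ x)
    (hz : P.IsSensitivity τ x z) :
    ∃ C, 0 ≤ C ∧ ∀ σ ∈ Icc 0 P.b, ∀ y, P.IsState σ y → ∀ t ≤ P.T,
      ‖y t - x t - (σ - τ) • z t‖ ≤ C * P.remainderModulus τ x σ := by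
  obtain ⟨C, hC0, hC⟩ := hx.exists_velocity_remainder_le hτ hz
  have hb := P.b_pos
  have hT := P.T_pos
  have hL := P.L_nonneg
  set κ := (P.L + ‖P.A‖) * Real.exp ((P.L + ‖P.A‖) * P.T) with hκ
  have hκ0 : 0 ≤ κ := by positivity
  refine ⟨(1 + κ * P.T) * (C * P.T + ‖P.A‖), by positivity, fun σ hσ y hy t ht => ?_⟩
  have hmod := remainderModulus_nonneg (P := P) (τ := τ) (x := x) σ
  have hneg : ∀ t ≤ 0, y t - x t - (σ - τ) • z t = 0 := fun t ht => by
    rw [hx.history t ht, hy.history t ht, hz.history t ht, sub_self, smul_zero, sub_zero]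
  rcases le_total t 0 with h0 | h0
  · rw [hneg t h0, norm_zero]; positivity
  have hxc := hx.continuous
  have hyc := hy.continuous
  have hzc := hz.continuous
  have hqc : Continuous fun t => y t - x t - (σ - τ) • z t := by fun_prop
  have hri := hx.integrableOn_shiftRemainder hτ hσ
  obtain ⟨C₁, h₁⟩ := hx.exists_velocity_bound
  obtain ⟨C₂, h₂⟩ := hy.exists_velocity_bound
  obtain ⟨C₃, h₃⟩ := hz.exists_velocity_bound hτ hx
  have h0m : (0 : ℝ) ∈ Icc (-P.b) P.T := ⟨by linarith, hT.le⟩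
  have key := norm_le_of_delay_volterra (T := P.T) (σ := σ) (L := P.L) (a := ‖P.A‖)
    (q := fun t => y t - x t - (σ - τ) • z t)
    (e := fun s => C * |σ - τ| ^ 2 + ‖P.A‖ * ‖P.shiftRemainder τ x σ s‖) (k := fun _ => 0)
    (Φ := fun s => P.velocity σ y s - P.velocity τ x s
      - (σ - τ) • P.sensitivityVelocity τ x z s)
    hT.le hσ.1 hL (norm_nonneg _) hqc.continuousOn.integrableOn_Icc (fun t ht => hneg t ht.le)
    ((integrableOn_const (by simp)).add (hri.const_mul _)) (fun _ => by positivity)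
    integrableOn_zero (fun _ => le_rfl)
    (fun t ht => by
      have htm : t ∈ Icc (-P.b) P.T := ⟨by linarith [ht.1], ht.2⟩
      have i1 := intervalIntegrable_of_bound hx.stronglyMeasurable_velocity h₁ h0m htm
      have i2 := intervalIntegrable_of_bound hy.stronglyMeasurable_velocity h₂ h0m htm
      have i3 : IntervalIntegrable (fun s => (σ - τ) • P.sensitivityVelocity τ x z s) volume 0 t :=
        (intervalIntegrable_of_bound (hz.stronglyMeasurable_velocity hx) h₃ h0m htm).smul _
      rw [intervalIntegral.integral_sub (i2.sub i1) i3,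
        intervalIntegral.integral_sub i2 i1, intervalIntegral.integral_smul,
        hy.integral_velocity h0m htm, hx.integral_velocity h0m htm, hz.integral_velocity hτ hx ht,
        hx.history 0 le_rfl, hy.history 0 le_rfl, sub_sub_sub_cancel_right, add_zero])
    (fun s hs => hC σ hσ y hy s ⟨hs.1.le, hs.2⟩) t ⟨h0, ht⟩
  rw [← hκ] at key
  refine key.trans ?_
  have hri' : IntervalIntegrable (fun s => ‖P.shiftRemainder τ x σ s‖) volume 0 P.T := by
    rwa [intervalIntegrable_iff_integrableOn_Icc_of_le hT.le]
  rw [intervalIntegral.integral_add (by simp) (hri'.const_mul _),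
    intervalIntegral.integral_const_mul, intervalIntegral.integral_const_mul,
    intervalIntegral.integral_const, intervalIntegral.integral_zero, mul_zero, add_zero, zero_add, sub_zero, smul_eq_mul, mul_assoc (1 + κ * P.T)]
  rw [remainderModulus]
  have hI : 0 ≤ ∫ s in (0 : ℝ)..P.T, ‖P.shiftRemainder τ x σ s‖ :=
    intervalIntegral.integral_nonneg hT.le fun _ _ => norm_nonneg _
  refine mul_le_mul_of_nonneg_left ?_ (by positivity)
  have h1 : 0 ≤ C * P.T * ∫ s in (0 : ℝ)..P.T, ‖P.shiftRemainder τ x σ s‖ := by positivity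
  have h2 : 0 ≤ ‖P.A‖ * |σ - τ| ^ 2 := by positivity
  linarith

/-- At each time, the derivative of the state with respect to the delay is the sensitivity. -/
theorem IsSensitivity.hasDerivWithinAt_state (hτ : τ ∈ Icc 0 P.b) {X : ℝ → ℝ → E}
    (hX : ∀ σ ∈ Icc 0 P.b, P.IsState σ (X σ)) (hz : P.IsSensitivity τ (X τ) z) {t : ℝ}
    (ht : t ≤ P.T) : HasDerivWithinAt (fun σ => X σ t) (z t) (Icc 0 P.b) τ := by
  obtain ⟨C, hC0, hC⟩ := (hX τ hτ).exists_remainder_le hτ hz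
  rw [hasDerivWithinAt_iff_isLittleO]
  refine Asymptotics.IsBigO.trans_isLittleO (.of_bound C ?_)
    ((hX τ hτ).isLittleO_remainderModulus hτ)
  filter_upwards [eventually_mem_nhdsWithin] with σ hσ
  rw [Real.norm_of_nonneg (remainderModulus_nonneg σ)]
  exact hC σ hσ _ (hX σ hσ) t ht

/-- The velocities are differentiable with respect to the delay at almost every time. -/
theorem IsSensitivity.hasDerivWithinAt_velocity (hτ : τ ∈ Icc 0 P.b) {X : ℝ → ℝ → E}
    (hX : ∀ σ ∈ Icc 0 P.b, P.IsState σ (X σ)) (hz : P.IsSensitivity τ (X τ) z) {t : ℝ}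
    (ht : t < P.T) (h0 : t ≠ 0) (hne : t ≠ τ) :
    HasDerivWithinAt (fun σ => P.velocity σ (X σ) t) (P.sensitivityVelocity τ (X τ) z t)
      (Icc 0 P.b) τ := by
  rcases lt_or_gt_of_ne h0 with h | h
  · simp only [velocity, sensitivityVelocity, if_pos h]
    exact hasDerivWithinAt_const _ _ _
  obtain ⟨C, hC0, hC⟩ := (hX τ hτ).exists_remainder_le hτ hz
  obtain ⟨C', hC0', hC'⟩ := (hX τ hτ).exists_velocity_remainder_le hτ hz
  have ho := (hX τ hτ).isLittleO_remainderModulus hτ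
  have hr := (hX τ hτ).isLittleO_shiftRemainder hτ ⟨h, ht⟩ hne (Icc 0 P.b)
  rw [hasDerivWithinAt_iff_isLittleO]
  have hsum := ((ho.const_mul_left (P.L * C)).add (ho.const_mul_left (‖P.A‖ * C))).add
    (((isLittleO_abs_sub_sq (Icc 0 P.b)).const_mul_left C').add (hr.norm_left.const_mul_left ‖P.A‖))
  refine Asymptotics.IsBigO.trans_isLittleO (.of_bound 1 ?_) hsum
  filter_upwards [eventually_mem_nhdsWithin] with σ hσ
  have hL := P.L_nonneg
  have h1 := hC σ hσ _ (hX σ hσ) t ht.le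
  have h2 := hC σ hσ _ (hX σ hσ) (t - σ) (by linarith [hσ.1])
  have h3 := hC' σ hσ _ (hX σ hσ) t ⟨h.le, ht.le⟩
  have h1' := mul_le_mul_of_nonneg_left h1 hL
  have h2' := mul_le_mul_of_nonneg_left h2 (norm_nonneg P.A)
  rw [one_mul]
  refine le_trans ?_ (Real.le_norm_self _)
  linarith

/-- Velocities depend Lipschitz continuously on the delay. -/
theorem IsState.exists_velocity_dist_le (hτ : τ ∈ Icc 0 P.b) (hx : P.IsState τ x) :
    ∃ C, 0 ≤ C ∧ ∀ σ ∈ Icc 0 P.b, ∀ y, P.IsState σ y → ∀ t ≤ P.T,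
      ‖P.velocity σ y t - P.velocity τ x t‖ ≤ C * |σ - τ| := by
  obtain ⟨C, hC0, hC⟩ := hx.exists_dist_le hτ
  obtain ⟨M, hM0, hM⟩ := hx.exists_lipschitz
  have hL := P.L_nonneg
  refine ⟨P.L * C + ‖P.A‖ * (C + M), by positivity, fun σ hσ y hy t ht => ?_⟩
  unfold velocity
  split_ifs with h
  · rw [sub_self, norm_zero]; positivity
  have h0 : 0 ≤ t := not_lt.1 h
  have h1 := (P.norm_F_sub_le (x t) (y t)).trans (mul_le_mul_of_nonneg_left
    ((norm_sub_rev _ _).le.trans (hC σ hσ y hy t ht)) hL)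
  have h2 := P.A.le_opNorm_of_le (hC σ hσ y hy (t - σ) (by linarith [hσ.1]))
  have h3 := P.A.le_opNorm_of_le (hM (t - τ) ⟨by linarith [hτ.2], by linarith [hτ.1]⟩ (t - σ)
    ⟨by linarith [hσ.2], by linarith [hσ.1]⟩)
  rw [show t - σ - (t - τ) = -(σ - τ) by ring, abs_neg] at h3
  have h4 : (-P.F (y t) + P.A (y (t - σ)) + P.g t) - (-P.F (x t) + P.A (x (t - τ)) + P.g t) =
      (P.F (x t) - P.F (y t)) + P.A (y (t - σ) - x (t - σ)) + P.A (x (t - σ) - x (t - τ)) := by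
    simp only [map_sub]; abel
  rw [h4]
  exact norm_add₃_le.trans (by linarith)

end FirstDerivative

end DelayProblem

/-! ### Second derivative with respect to the delay -/

namespace DelayProblem

variable {E : Type*} [NormedAddCommGroup E] [NormedSpace ℝ E] [CompleteSpace E]
  {P : DelayProblem E} {τ : ℝ} {x z y : ℝ → E}

section SecondSensitivity

theorem IsSensitivity.continuous_forcing (hx : P.IsState τ x)
    (hz : P.IsSensitivity τ x z) :
    Continuous fun s => fderiv ℝ (fderiv ℝ P.F) (x s) (z s) (z s) := by
  have := hx.continuous
  have := hz.continuous
  have := P.continuous_fderiv_fderiv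
  fun_prop

theorem IsSensitivity.exists_isSecondSensitivity (hτ : τ ∈ Icc 0 P.b) (hx : P.IsState τ x)
    (hz : P.IsSensitivity τ x z) : ∃ y, P.IsSecondSensitivity τ x z y := by
  have hxc := hx.continuous
  have hzc := hz.continuous
  have hfc := hz.continuous_forcing hx
  set h : ℝ → E := fun t => if t ≤ 0 then 0 else
    -((2 : ℝ) • P.A (z (t - τ))) + P.A (P.velocity τ x (t - τ)) - P.A (P.φ' (-τ)) with hh
  have hhm : StronglyMeasurable h := by
    refine StronglyMeasurable.ite (measurableSet_le measurable_id measurable_const)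
      stronglyMeasurable_const ((StronglyMeasurable.add ?_ ?_).sub stronglyMeasurable_const)
    · exact Continuous.stronglyMeasurable (by fun_prop)
    · exact P.A.continuous.comp_stronglyMeasurable
        (hx.stronglyMeasurable_velocity.comp_measurable (measurable_id.sub_const τ))
  obtain ⟨C₁, h₁⟩ := (isCompact_Icc (a := 0) (b := P.T)).exists_bound_of_continuousOn
    hfc.continuousOn
  obtain ⟨C₂, hC₂, h₂⟩ := hz.exists_bound
  obtain ⟨C₃, h₃⟩ := hx.exists_velocity_bound
  have hT := P.T_pos
  have hC₁ : 0 ≤ C₁ := (norm_nonneg _).trans (h₁ 0 ⟨le_rfl, hT.le⟩)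
  have hC₃ : 0 ≤ C₃ := (norm_nonneg _).trans (h₃ 0 ⟨by linarith [P.b_pos], hT.le⟩)
  set C := C₁ + (2 * (‖P.A‖ * C₂) + ‖P.A‖ * C₃ + ‖P.A (P.φ' (-τ))‖) with hC
  have hhC : ∀ t ≤ P.T, ‖h t‖ ≤ C := by
    intro t ht
    simp only [hh]
    split_ifs with h0
    · rw [norm_zero]; positivity
    · rw [not_le] at h0
      have h4 := P.A.le_opNorm_of_le (h₂ (t - τ) (by linarith [hτ.1]))
      have h5 := P.A.le_opNorm_of_le
        (h₃ (t - τ) ⟨by linarith [hτ.2], by linarith [hτ.1]⟩)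
      refine (norm_sub_le _ _).trans ((add_le_add_left (norm_add_le _ _) _).trans ?_)
      rw [norm_neg, norm_smul, Real.norm_eq_abs, abs_two]
      linarith
  obtain ⟨u, hu, hu0, hueq⟩ := exists_linear_delay_solution (C := C)
    (f := fun s => -fderiv ℝ (fderiv ℝ P.F) (x s) (z s) (z s)) hτ hxc
    hfc.neg.stronglyMeasurable (fun t ht => by
      rw [norm_neg]
      exact (h₁ t ht).trans (le_add_of_nonneg_right (by positivity))) hhm (fun t ht => hhC t ht.2)
  have hhz : ∀ t ≤ 0, h t = 0 := fun t ht => by simp only [hh, if_pos ht]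
  obtain ⟨C₄, h₄⟩ := (isCompact_Icc (a := 0) (b := P.T)).exists_bound_of_continuousOn
    hu.continuousOn
  refine ⟨fun t => u t + h t, hu.stronglyMeasurable.add hhm, ⟨C₄ + C, fun t ht => ?_⟩,
    fun t ht => ?_, fun t ht => ?_⟩
  · have hC₄ : 0 ≤ C₄ := (norm_nonneg _).trans (h₄ 0 ⟨le_rfl, hT.le⟩)
    refine (norm_add_le _ _).trans (add_le_add ?_ (hhC t ht))
    rcases le_total t 0 with h0 | h0
    · rw [hu0 t h0, norm_zero]; exact hC₄
    · exact h₄ t ⟨h0, ht⟩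
  · rw [hu0 t ht, hhz t ht, add_zero]
  · have h6 : h t = -((2 : ℝ) • P.A (z (t - τ))) + P.A (P.velocity τ x (t - τ))
        - P.A (P.φ' (-τ)) := by simp only [hh, if_neg ht.1.not_ge]
    have h7 : ∀ s, -fderiv ℝ (fderiv ℝ P.F) (x s) (z s) (z s) - fderiv ℝ P.F (x s) (u s + h s) =
        -(fderiv ℝ (fderiv ℝ P.F) (x s) (z s) (z s) + fderiv ℝ P.F (x s) (u s + h s)) := by
      intro s; abel
    rw [hueq t ⟨ht.1.le, ht.2⟩, h6]
    simp_rw [h7]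
    abel

theorem IsSecondSensitivity.intervalIntegrable_integrand (hτ : τ ∈ Icc 0 P.b)
    (hx : P.IsState τ x) (hz : P.IsSensitivity τ x z) (hy : P.IsSecondSensitivity τ x z y)
    {t : ℝ} (ht : t ∈ Icc 0 P.T) : IntervalIntegrable (fun s =>
      -(fderiv ℝ (fderiv ℝ P.F) (x s) (z s) (z s) + fderiv ℝ P.F (x s) (y s))
          + P.A (y (s - τ))) volume 0 t := by
  obtain ⟨C, hC⟩ := hy.bounded
  obtain ⟨C₁, h₁⟩ := (isCompact_Icc (a := 0) (b := P.T)).exists_bound_of_continuousOn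
    (hz.continuous_forcing hx).continuousOn
  refine intervalIntegrable_of_bound (a := 0) (b := P.T) (C := C₁ + P.L * C + ‖P.A‖ * C) ?_
    (fun s hs => ?_) ⟨le_rfl, P.T_pos.le⟩ ht
  · refine ((hz.continuous_forcing hx).stronglyMeasurable.add ?_).neg.add ?_
    · exact isBoundedBilinearMap_apply.continuous.comp_stronglyMeasurable
        ((P.continuous_fderiv.comp hx.continuous).stronglyMeasurable.prodMk hy.stronglyMeasurable)
    · exact P.A.continuous.comp_stronglyMeasurable
        (hy.stronglyMeasurable.comp_measurable (measurable_id.sub_const τ))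
  · refine (norm_add_le _ _).trans (add_le_add ?_
      (P.A.le_opNorm_of_le (hC _ (by linarith [hs.2, hτ.1]))))
    rw [norm_neg]
    exact (norm_add_le _ _).trans (add_le_add (h₁ s hs)
      ((fderiv ℝ P.F (x s)).le_of_opNorm_le_of_le (P.norm_fderiv_le _) (hC s hs.2)))

end SecondSensitivity

section SecondDerivative

/-- The difference of two shifts of a function that vanishes at nonpositive times has a small
integral: no regularity of the function is needed. -/
theorem integral_shift_sub_shift {w : ℝ → E} {T σ t : ℝ} (hτ : 0 ≤ τ) (hσ : 0 ≤ σ)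
    (hw : StronglyMeasurable w) {C : ℝ} (hC : ∀ t ≤ T, ‖w t‖ ≤ C) (h0 : ∀ t ≤ 0, w t = 0)
    (ht : t ∈ Icc 0 T) :
    IntervalIntegrable (fun s => w (s - σ) - w (s - τ)) volume 0 t ∧
    ∫ s in (0 : ℝ)..t, (w (s - σ) - w (s - τ)) = ∫ s in (t - τ)..(t - σ), w s := by
  have hI : ∀ c d, c ≤ T → d ≤ T → IntervalIntegrable w volume c d := fun c d hc hd =>
    intervalIntegrable_of_bound (a := min c d) (b := T) hw (fun s hs => hC s hs.2)
      ⟨min_le_left _ _, hc⟩ ⟨min_le_right _ _, hd⟩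
  have hT : 0 ≤ T := ht.1.trans ht.2
  have hsh : ∀ ρ, 0 ≤ ρ → IntervalIntegrable (fun s => w (s - ρ)) volume 0 t := fun ρ hρ => by
    have := (hI (0 - ρ) (t - ρ) (by linarith) (by linarith [ht.2])).comp_sub_right ρ
    simpa using this
  have hval : ∀ ρ, 0 ≤ ρ → ∫ s in (0 : ℝ)..t, w (s - ρ) = ∫ s in (0 : ℝ)..(t - ρ), w s := by
    intro ρ hρ
    rw [intervalIntegral.integral_comp_sub_right (fun s => w s) ρ,
      ← intervalIntegral.integral_add_adjacent_intervals (hI (0 - ρ) 0 (by linarith) hT)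
        (hI 0 (t - ρ) hT (by linarith [ht.2]))]
    have : ∫ s in (0 - ρ)..0, w s = 0 := by
      rw [intervalIntegral.integral_of_le (by linarith)]
      exact setIntegral_eq_zero_of_forall_eq_zero fun s hs => h0 s hs.2
    rw [this, zero_add]
  refine ⟨(hsh σ hσ).sub (hsh τ hτ), ?_⟩
  rw [intervalIntegral.integral_sub (hsh σ hσ) (hsh τ hτ), hval σ hσ, hval τ hτ,
    intervalIntegral.integral_interval_sub_left (hI _ _ hT (by linarith [ht.2]))
      (hI _ _ hT (by linarith [ht.2]))]

/-- The first-order remainder of `DF` along the states. -/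
noncomputable def fderivRemainder (P : DelayProblem E) (τ : ℝ) (x z : ℝ → E) (σ : ℝ)
    (x' : ℝ → E) (s : ℝ) : E →L[ℝ] E :=
  fderiv ℝ P.F (x' s) - fderiv ℝ P.F (x s) - (σ - τ) • fderiv ℝ (fderiv ℝ P.F) (x s) (z s)

/-- The first-order remainder of the history `φ` at `-τ`. -/
noncomputable def historyRemainder (P : DelayProblem E) (τ σ : ℝ) : E :=
  P.φ (-σ) - P.φ (-τ) + (σ - τ) • P.φ' (-τ)

/-- The modulus that controls, up to a constant, the first-order remainder of the sensitivity. -/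
noncomputable def secondModulus (P : DelayProblem E) (τ : ℝ) (x z : ℝ → E) (σ : ℝ)
    (x' : ℝ → E) : ℝ :=
  P.remainderModulus τ x σ + (∫ s in (0 : ℝ)..P.T, ‖P.fderivRemainder τ x z σ x' s‖)
    + ‖P.historyRemainder τ σ‖

theorem continuous_fderivRemainder {σ : ℝ} {x' : ℝ → E} (hx : P.IsState τ x)
    (hz : P.IsSensitivity τ x z) (hx' : P.IsState σ x') :
    Continuous (P.fderivRemainder τ x z σ x') := by
  have := hx.continuous
  have := hx'.continuous
  have := hz.continuous
  have := P.continuous_fderiv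
  have := P.continuous_fderiv_fderiv
  unfold fderivRemainder
  fun_prop

theorem remainderModulus_le_secondModulus (σ : ℝ) (x' : ℝ → E) :
    P.remainderModulus τ x σ ≤ P.secondModulus τ x z σ x' := by
  have : 0 ≤ ∫ s in (0 : ℝ)..P.T, ‖P.fderivRemainder τ x z σ x' s‖ :=
    intervalIntegral.integral_nonneg P.T_pos.le fun _ _ => norm_nonneg _
  unfold secondModulus
  linarith [norm_nonneg (P.historyRemainder τ σ)]

theorem exists_fderivRemainder_le (hτ : τ ∈ Icc 0 P.b) (hx : P.IsState τ x)
    (hz : P.IsSensitivity τ x z) : ∃ C, 0 ≤ C ∧ ∀ σ ∈ Icc 0 P.b, ∀ x', P.IsState σ x' →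
      ∀ s ≤ P.T, ‖P.fderivRemainder τ x z σ x' s‖ ≤ C * |σ - τ| := by
  obtain ⟨C₁, hC₁, h₁⟩ := hx.exists_dist_le hτ
  obtain ⟨C₂, hC₂, h₂⟩ := hz.exists_bound
  have hL := P.L_nonneg
  refine ⟨P.L * C₁ + P.L * C₂, by positivity, fun σ hσ x' hx' s hs => ?_⟩
  have h3 := (P.norm_fderiv_sub_le (x' s) (x s)).trans
    (mul_le_mul_of_nonneg_left (h₁ σ hσ x' hx' s hs) hL)
  have h4 := (fderiv ℝ (fderiv ℝ P.F) (x s)).le_of_opNorm_le_of_le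
    (P.norm_fderiv_fderiv_le _) (h₂ s hs)
  refine (norm_sub_le _ _).trans ?_
  rw [norm_smul, Real.norm_eq_abs]
  have := mul_le_mul_of_nonneg_left h4 (abs_nonneg (σ - τ))
  linarith

theorem exists_historyRemainder_le (hτ : τ ∈ Icc 0 P.b) :
    ∃ C, 0 ≤ C ∧ ∀ σ ∈ Icc 0 P.b, ‖P.historyRemainder τ σ‖ ≤ C * |σ - τ| := by
  obtain ⟨C, hC⟩ := (isCompact_Icc (a := -P.b) (b := 0)).exists_bound_of_continuousOn
    P.continuous_φ'.continuousOn
  have hm : ∀ ρ ∈ Icc 0 P.b, -ρ ∈ Icc (-P.b) 0 := fun ρ hρ =>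
    ⟨by linarith [hρ.2], by linarith [hρ.1]⟩
  have hC0 : 0 ≤ C := (norm_nonneg _).trans (hC _ (hm τ hτ))
  refine ⟨C + C, by positivity, fun σ hσ => ?_⟩
  have h1 := norm_sub_le_of_bounded_deriv countable_empty P.continuous_φ.continuousOn
    (fun t _ => P.hasDerivAt_φ t) P.continuous_φ'.stronglyMeasurable hC (hm τ hτ) (hm σ hσ)
  rw [show -σ - -τ = -(σ - τ) by ring, abs_neg] at h1
  have h2 := mul_le_mul_of_nonneg_left (hC _ (hm τ hτ)) (abs_nonneg (σ - τ))
  refine (norm_add_le _ _).trans ?_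
  rw [norm_smul, Real.norm_eq_abs]
  linarith

theorem isLittleO_historyRemainder (S : Set ℝ) :
    P.historyRemainder τ =o[𝓝[S] τ] fun σ => σ - τ := by
  have h3 : HasDerivAt (fun σ => P.φ (-σ)) ((-1 : ℝ) • P.φ' (-τ)) τ :=
    HasDerivAt.scomp τ (P.hasDerivAt_φ (-τ)) (hasDerivAt_neg τ)
  have h4 := (hasDerivAt_iff_isLittleO.1 h3).mono (nhdsWithin_le_nhds (s := S))
  refine h4.congr_left fun σ => ?_
  rw [historyRemainder]; simp

theorem isLittleO_fderivRemainder (hτ : τ ∈ Icc 0 P.b) {X : ℝ → ℝ → E}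
    (hX : ∀ σ ∈ Icc 0 P.b, P.IsState σ (X σ)) (hz : P.IsSensitivity τ (X τ) z) {s : ℝ}
    (hs : s ≤ P.T) :
    (fun σ => P.fderivRemainder τ (X τ) z σ (X σ) s) =o[𝓝[Icc 0 P.b] τ] fun σ => σ - τ := by
  have h := (P.differentiable_fderiv (X τ s)).hasFDerivAt.comp_hasDerivWithinAt τ
    (hz.hasDerivWithinAt_state hτ hX hs)
  exact hasDerivWithinAt_iff_isLittleO.1 h

theorem isLittleO_secondModulus (hτ : τ ∈ Icc 0 P.b) {X : ℝ → ℝ → E}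
    (hX : ∀ σ ∈ Icc 0 P.b, P.IsState σ (X σ)) (hz : P.IsSensitivity τ (X τ) z) :
    (fun σ => P.secondModulus τ (X τ) z σ (X σ)) =o[𝓝[Icc 0 P.b] τ] fun σ => σ - τ := by
  obtain ⟨C, hC0, hC⟩ := exists_fderivRemainder_le hτ (hX τ hτ) hz
  refine (((hX τ hτ).isLittleO_remainderModulus hτ).add (isLittleO_integral (C := C)
    P.T_pos.le ?_ ?_ ?_)).add (isLittleO_historyRemainder _).norm_left
  · exact fun σ hσ =>
      (continuous_fderivRemainder (hX τ hτ) hz (hX σ hσ)).norm.aestronglyMeasurable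
  · intro σ hσ t ht
    rw [abs_norm]
    exact hC σ hσ _ (hX σ hσ) t ht.2
  · exact (ae_restrict_mem measurableSet_Ioc).mono fun s hs =>
      (isLittleO_fderivRemainder hτ hX hz hs.2).norm_left

theorem exists_secondModulus_le (hτ : τ ∈ Icc 0 P.b) (hx : P.IsState τ x)
    (hz : P.IsSensitivity τ x z) : ∃ C, 0 ≤ C ∧ ∀ σ ∈ Icc 0 P.b, ∀ x', P.IsState σ x' →
      P.secondModulus τ x z σ x' ≤ C * |σ - τ| := by
  obtain ⟨C₁, hC₁, h₁⟩ := hx.exists_remainderModulus_le hτ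
  obtain ⟨C₂, hC₂, h₂⟩ := exists_fderivRemainder_le hτ hx hz
  obtain ⟨C₃, hC₃, h₃⟩ := exists_historyRemainder_le (P := P) hτ
  have hT := P.T_pos
  refine ⟨C₁ + C₂ * P.T + C₃, by positivity, fun σ hσ x' hx' => ?_⟩
  have h4 := intervalIntegral.norm_integral_le_of_norm_le_const (a := (0 : ℝ)) (b := P.T)
      (f := fun s => ‖P.fderivRemainder τ x z σ x' s‖) (C := C₂ * |σ - τ|) (fun s hs => by
        rw [uIoc_of_le hT.le] at hs
        rw [norm_norm]
        exact h₂ σ hσ x' hx' s hs.2)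
  rw [sub_zero, abs_of_pos hT] at h4
  have h5 := (Real.le_norm_self _).trans h4
  have h6 := h₁ σ hσ
  have h7 := h₃ σ hσ
  unfold secondModulus
  linarith

/-- Differentiating the integral equation of the sensitivity: the first-order remainder
`p = z' - z - (σ - τ) y` solves a Volterra equation with delay whose source terms are remainders
of known functions. -/
theorem IsSecondSensitivity.remainder_eq {σ : ℝ} (hτ : τ ∈ Icc 0 P.b) (hσ : σ ∈ Icc 0 P.b)
    {x' z' : ℝ → E} (hx : P.IsState τ x) (hz : P.IsSensitivity τ x z)
    (hy : P.IsSecondSensitivity τ x z y) (hx' : P.IsState σ x') (hz' : P.IsSensitivity σ x' z')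
    {t : ℝ} (ht : t ∈ Ioc 0 P.T) :
    z' t - z t - (σ - τ) • y t =
      (∫ s in (0 : ℝ)..t, (-(fderiv ℝ P.F (x' s) (z' s - z s - (σ - τ) • y s)
          + (σ - τ) • (fderiv ℝ P.F (x' s) - fderiv ℝ P.F (x s)) (y s)
          + P.fderivRemainder τ x z σ x' s (z s))
        + P.A (z' (s - σ) - z (s - σ) - (σ - τ) • y (s - σ))))
      + P.A (((∫ s in (t - τ)..(t - σ), z s) + (σ - τ) • z (t - τ))
        + (σ - τ) • (∫ s in (t - τ)..(t - σ), y s)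
        - (x' (t - σ) - x (t - σ) - (σ - τ) • z (t - σ))
        - (σ - τ) • (z (t - σ) - z (t - τ)) - P.shiftRemainder τ x σ t
        + P.historyRemainder τ σ) := by
  have htm : t ∈ Icc 0 P.T := ⟨ht.1.le, ht.2⟩
  obtain ⟨Cz, -, hCz⟩ := hz.exists_bound
  obtain ⟨Cy, hCy⟩ := hy.bounded
  obtain ⟨iz, ez⟩ := integral_shift_sub_shift hτ.1 hσ.1 hz.continuous.stronglyMeasurable hCz
    hz.history htm
  obtain ⟨iy, ey⟩ := integral_shift_sub_shift hτ.1 hσ.1 hy.stronglyMeasurable hCy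
    hy.history htm
  have i1 := (hz'.continuous_integrand hx').intervalIntegrable (μ := volume) 0 t
  have i2 := (hz.continuous_integrand hx).intervalIntegrable (μ := volume) 0 t
  have i3 : IntervalIntegrable (fun s => (σ - τ) •
      (-(fderiv ℝ (fderiv ℝ P.F) (x s) (z s) (z s) + fderiv ℝ P.F (x s) (y s))
          + P.A (y (s - τ)))) volume 0 t :=
    (hy.intervalIntegrable_integrand hτ hx hz htm).smul (σ - τ)
  have i4 : IntervalIntegrable (fun s => P.A (z (s - σ) - z (s - τ))) volume 0 t :=
    ⟨P.A.integrable_comp iz.1, P.A.integrable_comp iz.2⟩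
  have i5 : IntervalIntegrable (fun s => (σ - τ) • P.A (y (s - σ) - y (s - τ))) volume 0 t :=
    IntervalIntegrable.smul (f := fun s => P.A (y (s - σ) - y (s - τ)))
      ⟨P.A.integrable_comp iy.1, P.A.integrable_comp iy.2⟩ (σ - τ)
  -- The increments of `z` and `y` under the change of shift are moved out of the integrand, where
  -- they become integrals over the short interval between `t - τ` and `t - σ`.
  have hsplit : ∀ s, (-(fderiv ℝ P.F (x' s) (z' s - z s - (σ - τ) • y s)
          + (σ - τ) • (fderiv ℝ P.F (x' s) - fderiv ℝ P.F (x s)) (y s)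
          + P.fderivRemainder τ x z σ x' s (z s))
        + P.A (z' (s - σ) - z (s - σ) - (σ - τ) • y (s - σ))) =
      (-fderiv ℝ P.F (x' s) (z' s) + P.A (z' (s - σ)))
      - (-fderiv ℝ P.F (x s) (z s) + P.A (z (s - τ)))
      - (σ - τ) • (-(fderiv ℝ (fderiv ℝ P.F) (x s) (z s) (z s) + fderiv ℝ P.F (x s) (y s))
          + P.A (y (s - τ)))
      - P.A (z (s - σ) - z (s - τ)) - (σ - τ) • P.A (y (s - σ) - y (s - τ)) := by
    intro s
    simp only [fderivRemainder, map_sub, map_smul, sub_apply,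
      smul_apply, smul_sub, smul_add, smul_neg]
    abel
  simp_rw [hsplit]
  rw [intervalIntegral.integral_sub (((i1.sub i2).sub i3).sub i4) i5,
    intervalIntegral.integral_sub ((i1.sub i2).sub i3) i4,
    intervalIntegral.integral_sub (i1.sub i2) i3, intervalIntegral.integral_sub i1 i2,
    intervalIntegral.integral_smul, intervalIntegral.integral_smul,
    P.A.intervalIntegral_comp_comm iz, P.A.intervalIntegral_comp_comm iy, ez, ey,
    hz'.eq t htm, hz.eq t htm, hy.eq t ht]
  simp only [shiftRemainder, historyRemainder, map_sub, map_add, map_smul, smul_sub, smul_add,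
    two_smul]
  abel

/-- The first-order remainder of the sensitivity is of smaller order than the increment of the
delay, at each time where this holds for the shift of the state. -/
theorem IsSecondSensitivity.exists_remainder_le (hτ : τ ∈ Icc 0 P.b)
    (hx : P.IsState τ x) (hz : P.IsSensitivity τ x z) (hy : P.IsSecondSensitivity τ x z y) :
    ∃ C, 0 ≤ C ∧ ∀ σ ∈ Icc 0 P.b, ∀ x' z', P.IsState σ x' → P.IsSensitivity σ x' z' →
      ∀ t ∈ Icc 0 P.T, ‖z' t - z t - (σ - τ) • y t‖ ≤
        C * P.secondModulus τ x z σ x' + ‖P.A‖ * ‖P.shiftRemainder τ x σ t‖ := by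
  obtain ⟨C₁, hC₁, h₁⟩ := hx.exists_dist_le hτ
  obtain ⟨C₂, hC₂, h₂⟩ := hx.exists_remainder_le hτ hz
  obtain ⟨Cz, hCz, hz1⟩ := hz.exists_bound
  obtain ⟨Cy, hy1⟩ := hy.bounded
  have hCy : 0 ≤ Cy := (norm_nonneg _).trans (hy1 0 P.T_pos.le)
  obtain ⟨M, hM, hM1⟩ := hz.exists_lipschitz hτ hx
  have hb := P.b_pos
  have hT := P.T_pos
  have hL := P.L_nonneg
  set κ := (P.L + ‖P.A‖) * Real.exp ((P.L + ‖P.A‖) * P.T) with hκ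
  have hκ0 : 0 ≤ κ := by positivity
  set K := ‖P.A‖ * (2 * M + Cy + C₂ + 1) with hK
  have hK0 : 0 ≤ K := by positivity
  refine ⟨K + (1 + κ * P.T) * (P.L * C₁ * Cy * P.T + Cz) + κ * (K * P.T + ‖P.A‖),
    by positivity, fun σ hσ x' z' hx' hz' t ht => ?_⟩
  set m₂ := P.secondModulus τ x z σ x' with hm₂
  have hm0 := remainderModulus_nonneg (P := P) (τ := τ) (x := x) σ
  have hmm : P.remainderModulus τ x σ ≤ m₂ := remainderModulus_le_secondModulus σ x'
  have hI1 : 0 ≤ ∫ s in (0 : ℝ)..P.T, ‖P.shiftRemainder τ x σ s‖ :=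
    intervalIntegral.integral_nonneg hT.le fun _ _ => norm_nonneg _
  have hI2 : 0 ≤ ∫ s in (0 : ℝ)..P.T, ‖P.fderivRemainder τ x z σ x' s‖ :=
    intervalIntegral.integral_nonneg hT.le fun _ _ => norm_nonneg _
  have hsq : |σ - τ| ^ 2 ≤ P.remainderModulus τ x σ := le_add_of_nonneg_right hI1
  have hshift : ∫ s in (0 : ℝ)..P.T, ‖P.shiftRemainder τ x σ s‖ ≤ m₂ :=
    (le_add_of_nonneg_left (by positivity)).trans hmm
  have hfd : ∫ s in (0 : ℝ)..P.T, ‖P.fderivRemainder τ x z σ x' s‖ ≤ m₂ := by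
    rw [hm₂, secondModulus]; linarith [norm_nonneg (P.historyRemainder τ σ)]
  have hhist : ‖P.historyRemainder τ σ‖ ≤ m₂ := by
    rw [hm₂, secondModulus]; linarith
  have hm₂0 : 0 ≤ m₂ := hm0.trans hmm
  have hneg : ∀ t ≤ 0, z' t - z t - (σ - τ) • y t = 0 := fun t ht => by
    rw [hz.history t ht, hz'.history t ht, hy.history t ht, sub_self, smul_zero, sub_zero]
  have hri := hx.integrableOn_shiftRemainder hτ hσ
  have hfc := continuous_fderivRemainder hx hz hx'
  have hqi : IntegrableOn (fun t => z' t - z t - (σ - τ) • y t) (Icc 0 P.T) := by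
    have h1 : IntegrableOn y (Icc 0 P.T) := Measure.integrableOn_of_bounded (M := Cy) (by simp)
      hy.stronglyMeasurable.aestronglyMeasurable
      ((ae_restrict_mem measurableSet_Icc).mono fun s hs => hy1 s hs.2)
    exact ((hz'.continuous.sub hz.continuous).continuousOn.integrableOn_Icc).sub (h1.smul _)
  have key := norm_le_of_delay_volterra (T := P.T) (σ := σ) (L := P.L) (a := ‖P.A‖)
    (q := fun t => z' t - z t - (σ - τ) • y t)
    (e := fun s => P.L * C₁ * Cy * |σ - τ| ^ 2 + Cz * ‖P.fderivRemainder τ x z σ x' s‖)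
    (k := fun s => K * m₂ + ‖P.A‖ * ‖P.shiftRemainder τ x σ s‖)
    hT.le hσ.1 hL (norm_nonneg _) hqi (fun t ht => hneg t ht.le)
    (Continuous.integrableOn_Icc (by fun_prop)) (fun _ => by positivity)
    ((integrableOn_const (by simp)).add (hri.const_mul _)) (fun _ => by positivity)
    (Φ := fun s => (-(fderiv ℝ P.F (x' s) (z' s - z s - (σ - τ) • y s)
          + (σ - τ) • (fderiv ℝ P.F (x' s) - fderiv ℝ P.F (x s)) (y s)
          + P.fderivRemainder τ x z σ x' s (z s))
        + P.A (z' (s - σ) - z (s - σ) - (σ - τ) • y (s - σ))))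
    (fun t ht => by
      rcases eq_or_lt_of_le ht.1 with h0 | h0
      · rw [hneg t h0.ge, norm_zero]; positivity
      rw [hy.remainder_eq hτ hσ hx hz hx' hz' ⟨h0, ht.2⟩]
      refine (norm_add_le _ _).trans (add_le_add_right ?_ _)
      have hmem : ∀ ρ ∈ Icc 0 P.b, t - ρ ∈ Icc (-P.b) P.T := fun ρ hρ =>
        ⟨by linarith [ht.1, hρ.2], by linarith [ht.2, hρ.1]⟩
      have habs : |t - σ - (t - τ)| = |σ - τ| := by
        rw [show t - σ - (t - τ) = -(σ - τ) by ring, abs_neg]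
      have hu : ∀ s ∈ uIoc (t - τ) (t - σ), s ∈ Icc (-P.b) P.T := fun s hs =>
        (uIcc_subset_Icc (hmem τ hτ) (hmem σ hσ)) (uIoc_subset_uIcc hs)
      have b1 : ‖(∫ s in (t - τ)..(t - σ), z s) + (σ - τ) • z (t - τ)‖ ≤ M * |σ - τ| ^ 2 := by
        have e1 : (∫ s in (t - τ)..(t - σ), z s) + (σ - τ) • z (t - τ) =
            ∫ s in (t - τ)..(t - σ), (z s - z (t - τ)) := by
          rw [intervalIntegral.integral_sub (hz.continuous.intervalIntegrable _ _) (by simp),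
            intervalIntegral.integral_const, show t - σ - (t - τ) = -(σ - τ) by ring, neg_smul,
            sub_neg_eq_add]
        rw [e1]
        refine (intervalIntegral.norm_integral_le_of_norm_le_const (C := M * |σ - τ|)
          fun s hs => ?_).trans (le_of_eq (by rw [habs]; ring))
        refine (hM1 _ (hmem τ hτ) _ (hu s hs)).trans ?_
        rw [← habs]
        exact mul_le_mul_of_nonneg_left (abs_sub_left_of_mem_uIcc (uIoc_subset_uIcc hs)) hM
      have b2 : ‖(σ - τ) • (∫ s in (t - τ)..(t - σ), y s)‖ ≤ Cy * |σ - τ| ^ 2 := by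
        have := intervalIntegral.norm_integral_le_of_norm_le_const (f := y) (C := Cy)
          (a := t - τ) (b := t - σ) fun s hs => hy1 s (hu s hs).2
        rw [habs] at this
        rw [norm_smul, Real.norm_eq_abs]
        calc _ ≤ |σ - τ| * (Cy * |σ - τ|) := by gcongr
          _ = _ := by ring
      have b3 := h₂ σ hσ x' hx' (t - σ) (hmem σ hσ).2
      have b4 : ‖(σ - τ) • (z (t - σ) - z (t - τ))‖ ≤ M * |σ - τ| ^ 2 := by
        have := hM1 _ (hmem τ hτ) _ (hmem σ hσ)
        rw [habs] at this
        rw [norm_smul, Real.norm_eq_abs]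
        calc _ ≤ |σ - τ| * (M * |σ - τ|) := by gcongr
          _ = _ := by ring
      have b5 : ‖((∫ s in (t - τ)..(t - σ), z s) + (σ - τ) • z (t - τ))
          + (σ - τ) • (∫ s in (t - τ)..(t - σ), y s)
          - (x' (t - σ) - x (t - σ) - (σ - τ) • z (t - σ))
          - (σ - τ) • (z (t - σ) - z (t - τ)) - P.shiftRemainder τ x σ t
          + P.historyRemainder τ σ‖ ≤ (2 * M + Cy + C₂ + 1) * m₂
            + ‖P.shiftRemainder τ x σ t‖ := by
        refine (norm_add_le _ _).trans ((add_le_add_left (norm_sub_le _ _) _).trans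
          ((add_le_add_left (add_le_add_left (norm_sub_le _ _) _) _).trans
          ((add_le_add_left (add_le_add_left (add_le_add_left (norm_sub_le _ _) _) _) _).trans
          ((add_le_add_left (add_le_add_left (add_le_add_left (add_le_add_left
            (norm_add_le _ _) _) _) _) _).trans ?_))))
        have d1 := mul_le_mul_of_nonneg_left (hsq.trans hmm) hM
        have d2 := mul_le_mul_of_nonneg_left (hsq.trans hmm) hCy
        have d3 := mul_le_mul_of_nonneg_left hmm hC₂
        linarith
      refine (P.A.le_opNorm_of_le b5).trans (le_of_eq ?_)
      rw [hK]; ring)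
    (fun s hs => by
      have d1 := (fderiv ℝ P.F (x' s)).le_of_opNorm_le (P.norm_fderiv_le _)
        (z' s - z s - (σ - τ) • y s)
      have d2 := P.A.le_opNorm (z' (s - σ) - z (s - σ) - (σ - τ) • y (s - σ))
      have d3 : ‖(σ - τ) • (fderiv ℝ P.F (x' s) - fderiv ℝ P.F (x s)) (y s)‖ ≤
          P.L * C₁ * Cy * |σ - τ| ^ 2 := by
        have := (P.norm_fderiv_sub_le (x' s) (x s)).trans
          (mul_le_mul_of_nonneg_left (h₁ σ hσ x' hx' s hs.2) hL)
        have := ContinuousLinearMap.le_of_opNorm_le_of_le _ this (hy1 s hs.2)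
        rw [norm_smul, Real.norm_eq_abs]
        calc _ ≤ |σ - τ| * (P.L * (C₁ * |σ - τ|) * Cy) := by gcongr
          _ = _ := by ring
      have d4 := (P.fderivRemainder τ x z σ x' s).le_opNorm_of_le (hz1 s hs.2)
      refine (norm_add_le _ _).trans ?_
      rw [norm_neg]
      have d5 := norm_add₃_le (a := fderiv ℝ P.F (x' s) (z' s - z s - (σ - τ) • y s))
        (b := (σ - τ) • (fderiv ℝ P.F (x' s) - fderiv ℝ P.F (x s)) (y s))
        (c := P.fderivRemainder τ x z σ x' s (z s))
      linarith)
    t ht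
  rw [← hκ] at key
  have hri' : IntervalIntegrable (fun s => ‖P.shiftRemainder τ x σ s‖) volume 0 P.T := by
    rwa [intervalIntegrable_iff_integrableOn_Icc_of_le hT.le]
  have hfi : IntervalIntegrable (fun s => ‖P.fderivRemainder τ x z σ x' s‖) volume 0 P.T :=
    hfc.norm.intervalIntegrable _ _
  have ie : ∫ s in (0 : ℝ)..P.T, (P.L * C₁ * Cy * |σ - τ| ^ 2
      + Cz * ‖P.fderivRemainder τ x z σ x' s‖) ≤ (P.L * C₁ * Cy * P.T + Cz) * m₂ := by
    rw [intervalIntegral.integral_add (by simp) (hfi.const_mul _),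
      intervalIntegral.integral_const_mul _ (fun s => ‖P.fderivRemainder τ x z σ x' s‖),
      intervalIntegral.integral_const, sub_zero, smul_eq_mul]
    have d1 := mul_le_mul_of_nonneg_left (hsq.trans hmm)
      (show 0 ≤ P.L * C₁ * Cy * P.T by positivity)
    have d2 := mul_le_mul_of_nonneg_left hfd hCz
    linarith
  have ik : ∫ s in (0 : ℝ)..P.T, (K * m₂ + ‖P.A‖ * ‖P.shiftRemainder τ x σ s‖) ≤
      (K * P.T + ‖P.A‖) * m₂ := by
    rw [intervalIntegral.integral_add (by simp) (hri'.const_mul _),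
      intervalIntegral.integral_const_mul _ (fun s => ‖P.shiftRemainder τ x σ s‖),
      intervalIntegral.integral_const, sub_zero, smul_eq_mul]
    have d2 := mul_le_mul_of_nonneg_left hshift (norm_nonneg P.A)
    linarith
  have ie' := mul_le_mul_of_nonneg_left ie (show 0 ≤ 1 + κ * P.T by positivity)
  have ik' := mul_le_mul_of_nonneg_left ik hκ0
  linarith

/-- The derivative of the sensitivity with respect to the delay. It fails to exist at `t = τ` in
general, where the kink of the state at time `0` is seen through the delay. -/
theorem IsSecondSensitivity.hasDerivWithinAt_sensitivity (hτ : τ ∈ Icc 0 P.b)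
    {X Z : ℝ → ℝ → E} (hX : ∀ σ ∈ Icc 0 P.b, P.IsState σ (X σ))
    (hZ : ∀ σ ∈ Icc 0 P.b, P.IsSensitivity σ (X σ) (Z σ))
    (hy : P.IsSecondSensitivity τ (X τ) (Z τ) y) {t : ℝ} (ht : t < P.T) (hne : t ≠ τ) :
    HasDerivWithinAt (fun σ => Z σ t) (y t) (Icc 0 P.b) τ := by
  rw [hasDerivWithinAt_iff_isLittleO]
  rcases le_or_gt t 0 with h | h
  · refine (Asymptotics.isLittleO_zero _ _).congr' ?_ .rfl
    filter_upwards [eventually_mem_nhdsWithin] with σ hσ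
    rw [(hZ σ hσ).history t h, (hZ τ hτ).history t h, hy.history t h]
    simp
  obtain ⟨C, hC0, hC⟩ := hy.exists_remainder_le hτ (hX τ hτ) (hZ τ hτ)
  have hr := (hX τ hτ).isLittleO_shiftRemainder hτ ⟨h, ht⟩ hne (Icc 0 P.b)
  have hsum := ((isLittleO_secondModulus hτ hX (hZ τ hτ)).const_mul_left C).add
    (hr.norm_left.const_mul_left ‖P.A‖)
  refine Asymptotics.IsBigO.trans_isLittleO (.of_bound 1 ?_) hsum
  filter_upwards [eventually_mem_nhdsWithin] with σ hσ
  rw [one_mul]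
  exact (hC σ hσ _ _ (hX σ hσ) (hZ σ hσ) t ⟨h.le, ht.le⟩).trans (Real.le_norm_self _)

/-- Sensitivities depend Lipschitz continuously on the delay. -/
theorem IsSecondSensitivity.exists_sensitivity_dist_le (hτ : τ ∈ Icc 0 P.b)
    (hx : P.IsState τ x) (hz : P.IsSensitivity τ x z) (hy : P.IsSecondSensitivity τ x z y) :
    ∃ C, 0 ≤ C ∧ ∀ σ ∈ Icc 0 P.b, ∀ x' z', P.IsState σ x' → P.IsSensitivity σ x' z' →
      ∀ t ≤ P.T, ‖z' t - z t‖ ≤ C * |σ - τ| := by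
  obtain ⟨C, hC0, hC⟩ := hy.exists_remainder_le hτ hx hz
  obtain ⟨C₁, hC₁, h₁⟩ := exists_secondModulus_le hτ hx hz
  obtain ⟨C₂, hC₂, h₂⟩ := hx.exists_shiftRemainder_bound hτ
  obtain ⟨Cy, hy1⟩ := hy.bounded
  have hCy : 0 ≤ Cy := (norm_nonneg _).trans (hy1 0 P.T_pos.le)
  refine ⟨C * C₁ + ‖P.A‖ * C₂ + Cy, by positivity, fun σ hσ x' z' hx' hz' t ht => ?_⟩
  rcases le_or_gt t 0 with h | h
  · rw [hz.history t h, hz'.history t h, sub_self, norm_zero]; positivity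
  have htm : t ∈ Icc 0 P.T := ⟨h.le, ht⟩
  have h3 := hC σ hσ x' z' hx' hz' t htm
  have h4 := mul_le_mul_of_nonneg_left (h₁ σ hσ x' hx') hC0
  have h5 := mul_le_mul_of_nonneg_left (h₂ σ hσ t htm) (norm_nonneg P.A)
  have h6 : ‖(σ - τ) • y t‖ ≤ |σ - τ| * Cy := by
    rw [norm_smul, Real.norm_eq_abs]
    exact mul_le_mul_of_nonneg_left (hy1 t ht) (abs_nonneg _)
  have h7 := norm_add_le (z' t - z t - (σ - τ) • y t) ((σ - τ) • y t)
  rw [sub_add_cancel] at h7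
  linarith

end SecondDerivative

end DelayProblem

/-! ### A priori bound, cutoff, and uniqueness in L² -/

section Reduction

variable {n : ℕ}

/-- A continuous `H²` function on an interval extends to a `C¹` function on the line. -/
theorem exists_contDiff_extension {b : ℝ} (hb : 0 < b) {φ : ℝ → EuclideanSpace ℝ (Fin n)}
    (hφc : ContinuousOn φ (Icc (-b) 0)) (hφ : MemH2 (-b) 0 φ) :
    ∃ ψ ψ' : ℝ → EuclideanSpace ℝ (Fin n), (∀ t, HasDerivAt ψ (ψ' t) t) ∧ Continuous ψ' ∧
      EqOn φ ψ (Icc (-b) 0) := by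
  obtain ⟨v, hv, hv1⟩ := hφ
  obtain ⟨w, hw, -, hvw⟩ := exists_continuous_of_memH1 (by linarith) hv1
  refine ⟨fun t => φ (-b) + ∫ s in (-b)..t, w s, w, fun t => ?_, hw, fun t ht => ?_⟩
  · exact (intervalIntegral.integral_hasDerivAt_right (hw.intervalIntegrable _ _)
      (hw.stronglyMeasurableAtFilter _ _) hw.continuousAt).const_add _
  · rw [eq_add_integral_of_hasH1Deriv (by linarith) hv hφc t ht]
    congr 1
    rw [intervalIntegral.integral_of_le ht.1, intervalIntegral.integral_of_le ht.1,
      integral_Ioc_eq_integral_Ioo, integral_Ioc_eq_integral_Ioo]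
    exact integral_congr_ae (ae_restrict_of_ae_restrict_of_subset
      (Ioo_subset_Ioo_right ht.2) hvw)

theorem ae_comp_sub_of_ae {b T τ : ℝ} (hτ : τ ∈ Icc 0 b) {p : ℝ → Prop}
    (h : ∀ᵐ t ∂(volume.restrict (Ioo (-b) T)), p t) :
    ∀ᵐ t ∂(volume.restrict (Ioo 0 T)), p (t - τ) := by
  rw [ae_restrict_iff' measurableSet_Ioo] at h ⊢
  have := (measurePreserving_sub_right volume τ).quasiMeasurePreserving.ae h
  filter_upwards [this] with t ht hm
  exact ht ⟨by linarith [hm.1, hτ.2], by linarith [hm.2, hτ.1]⟩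

/-- The lower bound on `Df` integrated along the segment from `0` to `x`. -/
theorem inner_ge_of_fderiv {E : Type*} [NormedAddCommGroup E] [InnerProductSpace ℝ E]
    {f : E → E} (hf : Differentiable ℝ f) {lam : ℝ}
    (h : ∀ x v : E, 0 ≤ inner ℝ (fderiv ℝ f x v + lam • v) v) (x : E) :
    -lam * ‖x‖ ^ 2 - ‖f 0‖ * ‖x‖ ≤ inner ℝ (f x) x := by
  have hd : ∀ s : ℝ, HasDerivAt (fun s : ℝ => inner ℝ (f (s • x) + s • (lam • x)) x)
      (inner ℝ (fderiv ℝ f (s • x) x + lam • x) x) s := by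
    intro s
    have h1 : HasDerivAt (fun s : ℝ => s • x) x s := by
      simpa using (hasDerivAt_id s).smul_const x
    have h2 : HasDerivAt (fun s : ℝ => s • (lam • x)) (lam • x) s := by
      simpa using (hasDerivAt_id s).smul_const (lam • x)
    have h3 := ((hf (s • x)).hasFDerivAt.comp_hasDerivAt s h1).add h2
    simpa using h3.inner ℝ (hasDerivAt_const s x)
  have hmono := monotone_of_hasDerivAt_nonneg hd (fun s => h (s • x) x)
  have h01 := hmono (zero_le_one (α := ℝ))
  simp only [zero_smul, add_zero, one_smul, inner_add_left, real_inner_smul_left,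
    real_inner_self_eq_norm_sq] at h01
  have h4 := abs_real_inner_le_norm (f 0) x
  have h5 := neg_abs_le (inner ℝ (f 0) x)
  linarith

/-- The a priori bound: for a nonlinearity with `⟪F x, x⟫ ≥ -lam ‖x‖² - c ‖x‖`, solutions are
bounded by a constant that does not depend on the nonlinearity otherwise, nor on the delay. -/
theorem exists_a_priori_bound {E : Type*} [NormedAddCommGroup E] [InnerProductSpace ℝ E]
    [CompleteSpace E] (A : E →L[ℝ] E) {φ g : ℝ → E} {b T lam c Cg Cφ : ℝ}
    (hT : 0 ≤ T) (hb : 0 ≤ b) (hlam : 0 ≤ lam) (hg : Continuous g) (hCg : ∀ t, ‖g t‖ ≤ Cg)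
    (hCφ : ∀ t ∈ Icc (-b) 0, ‖φ t‖ ≤ Cφ) :
    ∃ M, ∀ F : E → E, Continuous F → (∀ x, -lam * ‖x‖ ^ 2 - c * ‖x‖ ≤ inner ℝ (F x) x) →
      ∀ τ ∈ Icc 0 b, ∀ x : ℝ → E, Continuous x → (∀ t ≤ 0, x t = φ t) →
        (∀ t ∈ Icc 0 T, x t = φ 0 + ∫ s in (0 : ℝ)..t, (-F (x s) + A (x (s - τ)) + g s)) →
        ∀ t ∈ Icc 0 T, ‖x t‖ ≤ M := by
  set a := ‖A‖
  set K := 2 * lam + 2 + a with hK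
  have ha : 0 ≤ a := norm_nonneg _
  have hK0 : 0 ≤ K := by positivity
  set H := Cφ ^ 2 + T * (c ^ 2 + Cg ^ 2 + a * Cφ ^ 2) with hH
  have hH0 : 0 ≤ H := by positivity
  set κ := (K + a) * Real.exp ((K + a) * T) with hκ
  refine ⟨Real.sqrt (H + κ * (T * H)), fun F hF hdiss τ hτ x hx hhist heq t ht => ?_⟩
  have hCφ0 : 0 ≤ Cφ := (norm_nonneg _).trans (hCφ 0 ⟨by linarith, le_rfl⟩)
  set rhs : ℝ → E := fun s => -F (x s) + A (x (s - τ)) + g s with hrhs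
  have hrc : Continuous rhs := by simp only [hrhs]; fun_prop
  have hd : ∀ s ∈ Ioo 0 T, HasDerivAt x (rhs s) s := by
    intro s hs
    refine ((intervalIntegral.integral_hasDerivAt_right (hrc.intervalIntegrable 0 s)
      (hrc.stronglyMeasurableAtFilter _ _) hrc.continuousAt).const_add
        (φ 0)).congr_of_eventuallyEq ?_
    filter_upwards [Ioo_mem_nhds hs.1 hs.2] with r hr using heq r ⟨hr.1.le, hr.2.le⟩
  -- Gronwall is applied to `‖x‖²` at positive times; the history enters through its bound `Cφ`.
  set u : ℝ → ℝ := fun s => if s < 0 then 0 else ‖x s‖ ^ 2 with hu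
  have hun : ∀ s, 0 ≤ u s := fun s => by
    simp only [hu]; split_ifs <;> positivity
  have hup : ∀ s, 0 ≤ s → u s = ‖x s‖ ^ 2 := fun s hs => by simp only [hu, if_neg hs.not_gt]
  have hneg : ∀ s < 0, u s = 0 := fun s hs => by simp only [hu, if_pos hs]
  have hui : IntegrableOn u (Icc 0 T) :=
    (integrableOn_congr_fun (fun s hs => hup s hs.1) measurableSet_Icc).2
      (Continuous.integrableOn_Icc (by fun_prop))
  have hdelay : ∀ s ∈ Icc 0 T, ‖x (s - τ)‖ ^ 2 ≤ u (s - τ) + Cφ ^ 2 := by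
    intro s hs
    rcases lt_or_ge (s - τ) 0 with h | h
    · rw [hneg _ h, zero_add, hhist _ h.le]
      have := hCφ (s - τ) ⟨by linarith [hs.1, hτ.2], h.le⟩
      gcongr
    · rw [hup _ h]; linarith [sq_nonneg Cφ]
  have hest : ∀ s ∈ Ioo 0 T, 2 * inner ℝ (x s) (rhs s) ≤
      (K * u s + a * u (s - τ)) + (c ^ 2 + Cg ^ 2 + a * Cφ ^ 2) := by
    intro s hs
    have h1 := hdiss (x s)
    have h2 : inner ℝ (x s) (A (x (s - τ))) ≤ ‖x s‖ * (a * ‖x (s - τ)‖) :=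
      (real_inner_le_norm _ _).trans (by gcongr; exact A.le_opNorm _)
    have h3 : inner ℝ (x s) (g s) ≤ ‖x s‖ * Cg :=
      (real_inner_le_norm _ _).trans (by gcongr; exact hCg s)
    have h4 := hdelay s ⟨hs.1.le, hs.2.le⟩
    have h5 : a * ‖x (s - τ)‖ ^ 2 ≤ a * (u (s - τ) + Cφ ^ 2) := by gcongr
    have h6 : 0 ≤ a * (‖x s‖ - ‖x (s - τ)‖) ^ 2 := by positivity
    rw [hup s hs.1.le]
    simp only [hrhs, inner_add_right, inner_neg_right]
    rw [real_inner_comm] at h1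
    nlinarith [sq_nonneg (‖x s‖ - c), sq_nonneg (‖x s‖ - Cg)]
  have hsq : ∀ s ∈ Icc 0 T, ‖x s‖ ^ 2 - ‖x 0‖ ^ 2 = ∫ r in (0 : ℝ)..s, 2 * inner ℝ (x r) (rhs r) := by
    intro s hs
    refine (integral_eq_of_hasDerivAt_off_countable_of_le (fun s => ‖x s‖ ^ 2) _ hs.1
      countable_empty (by fun_prop) (fun r hr => ?_)
      (Continuous.intervalIntegrable (by fun_prop) _ _)).symm
    exact (hd r ⟨hr.1.1, hr.1.2.trans_le hs.2⟩).norm_sq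
  have hmain := le_of_delay_inequality (T := T) (u := u) (h := fun _ => H) hτ.1 hK0 ha hui
    (integrableOn_const (by simp)) hun hneg (fun _ => hH0) (fun s hs => by
      have hii : IntervalIntegrable u volume 0 s := by
        rw [intervalIntegrable_iff_integrableOn_Icc_of_le hs.1]
        exact hui.mono_set (Icc_subset_Icc_right hs.2)
      have hid := (hii.const_mul K).add
        ((integral_comp_sub_le hτ.1 hui hun hneg hs).1.const_mul a)
      have h1 := intervalIntegral.integral_mono_on_of_le_Ioo hs.1
        (Continuous.intervalIntegrable (μ := volume) (by fun_prop) _ _)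
        (hid.add (by simp)) (fun r hr => hest r ⟨hr.1, hr.2.trans_le hs.2⟩)
      rw [← hsq s hs, intervalIntegral.integral_add hid (by simp),
        intervalIntegral.integral_const, sub_zero, smul_eq_mul] at h1
      have h2 : ‖x 0‖ ^ 2 ≤ Cφ ^ 2 := by
        rw [hhist 0 le_rfl]
        have := hCφ 0 ⟨by linarith, le_rfl⟩
        gcongr
      have h3 : s * (c ^ 2 + Cg ^ 2 + a * Cφ ^ 2) ≤ T * (c ^ 2 + Cg ^ 2 + a * Cφ ^ 2) := by
        have := hs.2
        gcongr
      rw [hup s hs.1]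
      linarith) t ht
  rw [hup t ht.1, intervalIntegral.integral_const, sub_zero, smul_eq_mul] at hmain
  exact Real.le_sqrt_of_sq_le hmain

theorem exists_bound_fderiv_of_hasCompactSupport {E F : Type*} [NormedAddCommGroup E]
    [NormedSpace ℝ E] [NormedAddCommGroup F] [NormedSpace ℝ F] {f : E → F} (hf : ContDiff ℝ 1 f)
    (hc : HasCompactSupport f) : ∃ L, ∀ x, ‖fderiv ℝ f x‖ ≤ L :=
  (hc.fderiv ℝ).exists_bound_of_continuous (hf.continuous_fderiv (by simp))

/-- Cutting off outside a large ball makes the first two derivatives bounded and preserves the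
one-sided growth condition behind the a priori bound. -/
theorem exists_cutoff {E : Type*} [NormedAddCommGroup E] [InnerProductSpace ℝ E]
    [FiniteDimensional ℝ E] {f : E → E} (hf : ContDiff ℝ 2 f) {lam c : ℝ} (hlam : 0 ≤ lam)
    (hc : 0 ≤ c) (hdiss : ∀ x, -lam * ‖x‖ ^ 2 - c * ‖x‖ ≤ inner ℝ (f x) x) {R : ℝ} (hR : 0 < R) :
    ∃ (F : E → E) (L : ℝ), ContDiff ℝ 2 F ∧ (∀ x, ‖fderiv ℝ F x‖ ≤ L) ∧
      (∀ x, ‖fderiv ℝ (fderiv ℝ F) x‖ ≤ L) ∧ (∀ x, ‖x‖ < R → F =ᶠ[𝓝 x] f) ∧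
      ∀ x, -lam * ‖x‖ ^ 2 - c * ‖x‖ ≤ inner ℝ (F x) x := by
  obtain ⟨χ, hχ, hχc, hχ0, hχ1, hχR⟩ : ∃ χ : E → ℝ, ContDiff ℝ 2 χ ∧ HasCompactSupport χ ∧
      (∀ x, 0 ≤ χ x) ∧ (∀ x, χ x ≤ 1) ∧ ∀ x ∈ Metric.ball (0 : E) R, χ x = 1 := by
    let B : ContDiffBump (0 : E) := ⟨R, R + 1, hR, by linarith⟩
    exact ⟨B, B.contDiff, B.hasCompactSupport, fun _ => B.nonneg, fun _ => B.le_one,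
      fun x hx => B.one_of_mem_closedBall (Metric.ball_subset_closedBall hx)⟩
  have hF : ContDiff ℝ 2 fun x => χ x • f x := hχ.smul hf
  have hcs : HasCompactSupport fun x => χ x • f x := hχc.smul_right
  generalize hFdef : (fun x => χ x • f x) = F at hF hcs
  have hF1 : ContDiff ℝ 1 (fderiv ℝ F) := hF.fderiv_right (by norm_num)
  obtain ⟨L₁, h₁⟩ := exists_bound_fderiv_of_hasCompactSupport (hF.of_le (by norm_num)) hcs
  obtain ⟨L₂, h₂⟩ := exists_bound_fderiv_of_hasCompactSupport hF1 (hcs.fderiv ℝ)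
  refine ⟨F, max L₁ L₂, hF, fun x => (h₁ x).trans (le_max_left _ _),
    fun x => (h₂ x).trans (le_max_right _ _), fun x hx => ?_, fun x => ?_⟩
  · have : Metric.ball (0 : E) R ∈ 𝓝 x := Metric.isOpen_ball.mem_nhds (by simpa using hx)
    filter_upwards [this] with y hy
    simp only [← hFdef, hχR y hy, one_smul]
  · simp only [← hFdef, real_inner_smul_left]
    have h3 := mul_le_mul_of_nonneg_left (hdiss x) (hχ0 x)
    have h4 : 0 ≤ (1 - χ x) * (lam * ‖x‖ ^ 2 + c * ‖x‖) :=
      mul_nonneg (by linarith [hχ1 x]) (by positivity)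
    linarith

end Reduction

section Uniqueness

/-- Gronwall's inequality for an integrable function that vanishes at negative times. -/
theorem ae_eq_zero_of_delay_inequality {E : Type*} [NormedAddCommGroup E] {b T τ L a : ℝ}
    (hτ : τ ∈ Icc 0 b) (hL : 0 ≤ L) (ha : 0 ≤ a) {d : ℝ → E}
    (hd : IntegrableOn d (Ioo (-b) T))
    (hneg : ∀ᵐ t ∂(volume.restrict (Ioo (-b) T)), t < 0 → d t = 0)
    (hle : ∀ᵐ t ∂(volume.restrict (Ioo 0 T)),
      ‖d t‖ ≤ ∫ s in (0 : ℝ)..t, (L * ‖d s‖ + a * ‖d (s - τ)‖)) :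
    ∀ᵐ t ∂(volume.restrict (Ioo (-b) T)), d t = 0 := by
  have hb : 0 ≤ b := hτ.1.trans hτ.2
  set u : ℝ → ℝ := (Ioo 0 T).indicator fun t => ‖d t‖ with hu
  have hui : Integrable u := by
    rw [hu, integrable_indicator_iff measurableSet_Ioo]
    exact (hd.mono_set (Ioo_subset_Ioo_left (by linarith))).norm
  have hu0 : ∀ t, 0 ≤ u t := fun t => indicator_nonneg (fun _ _ => norm_nonneg _) t
  have h0 : ∀ᵐ t : ℝ, t ≠ 0 := by simp [ae_iff]
  have hud : ∀ᵐ t ∂(volume.restrict (Ioo (-b) T)), u t = ‖d t‖ := by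
    rw [ae_restrict_iff' measurableSet_Ioo] at hneg ⊢
    filter_upwards [hneg, h0] with t h1 h2 ht
    rcases lt_or_gt_of_ne h2 with h | h
    · rw [h1 ht h, hu, indicator_of_notMem (fun hm => absurd hm.1 h.not_gt), norm_zero]
    · rw [hu, indicator_of_mem (show t ∈ Ioo 0 T from ⟨h, ht.2⟩)]
  have hud1 := ae_restrict_of_ae_restrict_of_subset
    (Ioo_subset_Ioo_left (show -b ≤ 0 by linarith)) hud
  have hud2 := ae_comp_sub_of_ae hτ hud
  have hle' : ∀ᵐ t ∂(volume.restrict (Icc 0 T)),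
      u t ≤ (fun _ => (0 : ℝ)) t + ∫ s in (0 : ℝ)..t, (L * u s + a * u (s - τ)) := by
    rw [Measure.restrict_congr_set Ioo_ae_eq_Icc.symm]
    filter_upwards [hle, hud1, ae_restrict_mem measurableSet_Ioo] with t h1 h2 ht
    rw [h2, zero_add]
    refine h1.trans (le_of_eq ?_)
    rw [intervalIntegral.integral_of_le ht.1.le, intervalIntegral.integral_of_le ht.1.le,
      integral_Ioc_eq_integral_Ioo, integral_Ioc_eq_integral_Ioo]
    refine integral_congr_ae ?_
    filter_upwards [ae_restrict_of_ae_restrict_of_subset (Ioo_subset_Ioo_right ht.2.le) hud1,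
      ae_restrict_of_ae_restrict_of_subset (Ioo_subset_Ioo_right ht.2.le) hud2] with s h3 h4
    rw [h3, h4]
  have hfin := integral_le_of_delay_inequality hτ.1 hL ha hui.integrableOn integrableOn_zero hu0
    (fun t ht => indicator_of_notMem (fun hm => absurd hm.1 ht.not_gt) _) (fun _ => le_rfl) hle'
  rw [Measure.restrict_congr_set Ioo_ae_eq_Icc.symm] at hle'
  rw [ae_restrict_iff' measurableSet_Ioo] at hle' hud1 hneg ⊢
  filter_upwards [hle', hud1, hneg, h0] with t h1 h2 h3 h4 ht
  rcases lt_or_gt_of_ne h4 with h | h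
  · exact h3 ht h
  · have h5 := h1 ⟨h, ht.2⟩
    have h6 := hfin t ⟨h.le, ht.2.le⟩
    rw [h2 ⟨h, ht.2⟩] at h5
    simp only [intervalIntegral.integral_zero, mul_zero] at h6
    exact norm_le_zero_iff.1 (by linarith)

end Uniqueness

/-! ### Derivatives in the function spaces -/

section FunctionSpaces

variable {n : ℕ}

/-- A function with a weak derivative defines an element of the space `H1`. -/
theorem exists_H1_of_hasH1Deriv {a b : ℝ} {u v : ℝ → EuclideanSpace ℝ (Fin n)}
    (h : HasH1Deriv a b u v) :
    ∃ U : H1 n a b, H1.toL2 U =ᵐ[volume.restrict (Ioo a b)] u ∧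
      H1.dot U =ᵐ[volume.restrict (Ioo a b)] v := by
  have hu := h.memLp.coeFn_toLp
  have hv := h.memLp_deriv.coeFn_toLp
  refine ⟨⟨WithLp.toLp 2 (h.memLp.toLp u, h.memLp_deriv.toLp v), fun η hη hc hs => ?_⟩, hu, hv⟩
  have h1 := h.isWeakDeriv η hη hc hs
  simp only [WithLp.toLp_fst, WithLp.toLp_snd]
  have e1 : ∫ t in Ioo a b, deriv η t • (h.memLp.toLp u) t = ∫ t in Ioo a b, deriv η t • u t :=
    integral_congr_ae (by filter_upwards [hu] with t ht; rw [ht])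
  have e2 : ∫ t in Ioo a b, η t • (h.memLp_deriv.toLp v) t = ∫ t in Ioo a b, η t • v t :=
    integral_congr_ae (by filter_upwards [hv] with t ht; rw [ht])
  rw [e1, e2, h1]

theorem norm_H1_le {a b : ℝ} (U : H1 n a b) : ‖U‖ ≤ ‖H1.toL2 U‖ + ‖H1.dot U‖ := by
  change ‖(U : WithLp 2 (L2 n a b × L2 n a b))‖ ≤ _
  rw [WithLp.prod_norm_eq_of_L2]
  exact Real.sqrt_le_iff.2 ⟨by positivity, by
    unfold H1.toL2 H1.dot
    nlinarith [norm_nonneg (U : WithLp 2 (L2 n a b × L2 n a b)).fst,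
      norm_nonneg (U : WithLp 2 (L2 n a b × L2 n a b)).snd]⟩

theorem hasDerivWithinAt_H1 {a b : ℝ} {X : ℝ → H1 n a b} {X' : H1 n a b} {S : Set ℝ} {τ : ℝ}
    (h₁ : HasDerivWithinAt (fun σ => H1.toL2 (X σ)) (H1.toL2 X') S τ)
    (h₂ : HasDerivWithinAt (fun σ => H1.dot (X σ)) (H1.dot X') S τ) :
    HasDerivWithinAt X X' S τ := by
  rw [hasDerivWithinAt_iff_isLittleO] at h₁ h₂ ⊢
  refine Asymptotics.IsBigO.trans_isLittleO (.of_bound 1 (Eventually.of_forall fun σ => ?_))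
    (h₁.norm_left.add h₂.norm_left)
  rw [one_mul]
  exact (norm_H1_le _).trans (Real.le_norm_self _)

theorem exists_L2zero_of_memLp {a b : ℝ} {y : ℝ → EuclideanSpace ℝ (Fin n)}
    (hy : MemLp y 2 (volume.restrict (Ioo a b))) (h0 : ∀ t < 0, y t = 0) :
    ∃ Y : L2zero n a b, (Y : L2 n a b) =ᵐ[volume.restrict (Ioo a b)] y := by
  refine ⟨⟨hy.toLp y, ?_⟩, hy.coeFn_toLp⟩
  filter_upwards [hy.coeFn_toLp] with t ht hneg
  rw [ht, h0 t hneg]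

/-- The second-order equation only depends on the classes of the functions involved, and on the
nonlinearity near the trajectory. -/
theorem solvesSecondOrderEq_congr {A : Matrix (Fin n) (Fin n) ℝ}
    {f F : EuclideanSpace ℝ (Fin n) → EuclideanSpace ℝ (Fin n)}
    {φ : ℝ → EuclideanSpace ℝ (Fin n)} {b T τ : ℝ} (hτ : τ ∈ Icc 0 b)
    {x xdot xdot' x1 x1' y y' : ℝ → EuclideanSpace ℝ (Fin n)}
    (hF : ∀ s ∈ Ioo 0 T, fderiv ℝ f (x s) = fderiv ℝ F (x s) ∧
      fderiv ℝ (fderiv ℝ f) (x s) = fderiv ℝ (fderiv ℝ F) (x s))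
    (hd : xdot =ᵐ[volume.restrict (Ioo (-b) T)] xdot')
    (h1 : x1 =ᵐ[volume.restrict (Ioo (-b) T)] x1')
    (hy : y =ᵐ[volume.restrict (Ioo (-b) T)] y')
    (h : SolvesSecondOrderEq A f φ b T τ x xdot x1 y) :
    SolvesSecondOrderEq A F φ b T τ x xdot' x1' y' := by
  have hsub : Ioo 0 T ⊆ Ioo (-b) T := Ioo_subset_Ioo_left (by linarith [hτ.1, hτ.2])
  have h1r := ae_restrict_of_ae_restrict_of_subset hsub h1
  have hyr := ae_restrict_of_ae_restrict_of_subset hsub hy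
  have hds := ae_comp_sub_of_ae hτ hd
  have h1s := ae_comp_sub_of_ae hτ h1
  have hys := ae_comp_sub_of_ae hτ hy
  unfold SolvesSecondOrderEq at h ⊢
  filter_upwards [h, hyr, hds, h1s, ae_restrict_mem measurableSet_Ioo] with t e1 e2 e3 e4 ht
  rw [← e2, ← e3, ← e4, e1]
  congr 3
  rw [intervalIntegral.integral_of_le ht.1.le, intervalIntegral.integral_of_le ht.1.le,
    integral_Ioc_eq_integral_Ioo, integral_Ioc_eq_integral_Ioo]
  have hsub2 : Ioo 0 t ⊆ Ioo 0 T := Ioo_subset_Ioo_right ht.2.le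
  refine integral_congr_ae ?_
  filter_upwards [ae_restrict_of_ae_restrict_of_subset hsub2 h1r,
    ae_restrict_of_ae_restrict_of_subset hsub2 hyr,
    ae_restrict_of_ae_restrict_of_subset hsub2 hys, ae_restrict_mem measurableSet_Ioo]
    with s d1 d2 d3 hs
  rw [d1, d2, d3, (hF s (hsub2 hs)).1, (hF s (hsub2 hs)).2]

end FunctionSpaces

namespace DelayProblem

variable {n : ℕ} {P : DelayProblem (EuclideanSpace ℝ (Fin n))} {τ : ℝ}
  {x z y : ℝ → EuclideanSpace ℝ (Fin n)}

theorem memLp_of_bound {a C : ℝ} (ha : a ∈ Icc (-P.b) P.T) {v : ℝ → EuclideanSpace ℝ (Fin n)}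
    (hv : StronglyMeasurable v) (hC : ∀ t ∈ Icc (-P.b) P.T, ‖v t‖ ≤ C) :
    MemLp v 2 (volume.restrict (Ioo a P.T)) :=
  MemLp.of_bound hv.aestronglyMeasurable C ((ae_restrict_mem measurableSet_Ioo).mono
    fun t ht => hC t ⟨ha.1.trans ht.1.le, ht.2.le⟩)

theorem IsState.hasH1Deriv (hx : P.IsState τ x) {a : ℝ} (ha : a ∈ Icc (-P.b) P.T) :
    HasH1Deriv a P.T x (P.velocity τ x) := by
  obtain ⟨C, hC⟩ := hx.exists_velocity_bound
  exact hasH1Deriv_of_hasDerivAt_off_countable ha.2 (countable_singleton 0)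
    hx.continuous.continuousOn (fun t ht => hx.hasDerivAt ht.1.2 ht.2)
    (memLp_of_bound ha hx.stronglyMeasurable_velocity hC)

theorem IsSensitivity.hasH1Deriv (hτ : τ ∈ Icc 0 P.b) (hx : P.IsState τ x)
    (hz : P.IsSensitivity τ x z) :
    HasH1Deriv (-P.b) P.T z (P.sensitivityVelocity τ x z) := by
  obtain ⟨C, hC⟩ := hz.exists_velocity_bound hτ hx
  have hbT : -P.b ≤ P.T := by linarith [P.b_pos, P.T_pos]
  exact hasH1Deriv_of_hasDerivAt_off_countable hbT (Set.Countable.insert 0 (countable_singleton τ))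
    hz.continuous.continuousOn (fun t ht => hz.hasDerivAt hτ hx ht.1.2
      (fun h => ht.2 (by simp [h])) (fun h => ht.2 (by simp [h])))
    (memLp_of_bound ⟨le_rfl, hbT⟩ (hz.stronglyMeasurable_velocity hx) hC)

theorem IsSecondSensitivity.memLp (hy : P.IsSecondSensitivity τ x z y) :
    MemLp y 2 (volume.restrict (Ioo (-P.b) P.T)) := by
  obtain ⟨C, hC⟩ := hy.bounded
  exact memLp_of_bound ⟨le_rfl, by linarith [P.b_pos, P.T_pos]⟩ hy.stronglyMeasurable
    fun t ht => hC t ht.2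

theorem hasDerivWithinAt_state_H1 (hτ : τ ∈ Icc 0 P.b)
    {x : ℝ → ℝ → EuclideanSpace ℝ (Fin n)} {X : ℝ → H1 n (-P.b) P.T} {X' : H1 n (-P.b) P.T}
    (hx : ∀ σ ∈ Icc 0 P.b, P.IsState σ (x σ)) (hz : P.IsSensitivity τ (x τ) z)
    (hX : ∀ σ ∈ Icc 0 P.b, H1.toL2 (X σ) =ᵐ[volume.restrict (Ioo (-P.b) P.T)] x σ)
    (hXd : ∀ σ ∈ Icc 0 P.b,
      H1.dot (X σ) =ᵐ[volume.restrict (Ioo (-P.b) P.T)] P.velocity σ (x σ))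
    (hX' : H1.toL2 X' =ᵐ[volume.restrict (Ioo (-P.b) P.T)] z)
    (hXd' : H1.dot X' =ᵐ[volume.restrict (Ioo (-P.b) P.T)] P.sensitivityVelocity τ (x τ) z) :
    HasDerivWithinAt X X' (Icc 0 P.b) τ := by
  obtain ⟨C₁, -, h₁⟩ := (hx τ hτ).exists_dist_le hτ
  obtain ⟨C₂, -, h₂⟩ := hz.exists_bound
  obtain ⟨C₃, -, h₃⟩ := (hx τ hτ).exists_velocity_dist_le hτ
  obtain ⟨C₄, h₄⟩ := hz.exists_velocity_bound hτ (hx τ hτ)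
  refine hasDerivWithinAt_H1 ?_ ?_
  · refine hasDerivWithinAt_Lp_two (C := max C₁ C₂) hτ hX hX' (fun σ hσ => ?_) ?_ ?_
    · filter_upwards [ae_restrict_mem measurableSet_Ioo] with t ht
      exact (h₁ σ hσ _ (hx σ hσ) t ht.2.le).trans (by gcongr; exact le_max_left _ _)
    · filter_upwards [ae_restrict_mem measurableSet_Ioo] with t ht
      exact (h₂ t ht.2.le).trans (le_max_right _ _)
    · filter_upwards [ae_restrict_mem measurableSet_Ioo] with t ht
      exact hz.hasDerivWithinAt_state hτ hx ht.2.le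
  · refine hasDerivWithinAt_Lp_two (C := max C₃ C₄) hτ hXd hXd' (fun σ hσ => ?_) ?_ ?_
    · filter_upwards [ae_restrict_mem measurableSet_Ioo] with t ht
      exact (h₃ σ hσ _ (hx σ hσ) t ht.2.le).trans (by gcongr; exact le_max_left _ _)
    · filter_upwards [ae_restrict_mem measurableSet_Ioo] with t ht
      exact (h₄ t ⟨ht.1.le, ht.2.le⟩).trans (le_max_right _ _)
    · have e0 : ∀ᵐ t ∂(volume.restrict (Ioo (-P.b) P.T)), t ≠ 0 :=
        ae_restrict_of_ae (by simp [ae_iff])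
      have e1 : ∀ᵐ t ∂(volume.restrict (Ioo (-P.b) P.T)), t ≠ τ :=
        ae_restrict_of_ae (by simp [ae_iff])
      filter_upwards [ae_restrict_mem measurableSet_Ioo, e0, e1] with t ht h0 h1
      exact hz.hasDerivWithinAt_velocity hτ hx ht.2 h0 h1

theorem hasDerivWithinAt_sensitivity_L2 (hτ : τ ∈ Icc 0 P.b)
    {x z : ℝ → ℝ → EuclideanSpace ℝ (Fin n)} {Z : ℝ → L2 n (-P.b) P.T} {Y : L2 n (-P.b) P.T}
    (hx : ∀ σ ∈ Icc 0 P.b, P.IsState σ (x σ))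
    (hz : ∀ σ ∈ Icc 0 P.b, P.IsSensitivity σ (x σ) (z σ))
    (hy : P.IsSecondSensitivity τ (x τ) (z τ) y)
    (hZ : ∀ σ ∈ Icc 0 P.b, Z σ =ᵐ[volume.restrict (Ioo (-P.b) P.T)] z σ)
    (hY : Y =ᵐ[volume.restrict (Ioo (-P.b) P.T)] y) :
    HasDerivWithinAt Z Y (Icc 0 P.b) τ := by
  obtain ⟨C₁, -, h₁⟩ := hy.exists_sensitivity_dist_le hτ (hx τ hτ) (hz τ hτ)
  obtain ⟨C₂, h₂⟩ := hy.bounded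
  refine hasDerivWithinAt_Lp_two (C := max C₁ C₂) hτ hZ hY (fun σ hσ => ?_) ?_ ?_
  · filter_upwards [ae_restrict_mem measurableSet_Ioo] with t ht
    exact (h₁ σ hσ _ _ (hx σ hσ) (hz σ hσ) t ht.2.le).trans (by gcongr; exact le_max_left _ _)
  · filter_upwards [ae_restrict_mem measurableSet_Ioo] with t ht
    exact (h₂ t ht.2.le).trans (le_max_right _ _)
  · have e1 : ∀ᵐ t ∂(volume.restrict (Ioo (-P.b) P.T)), t ≠ τ :=
      ae_restrict_of_ae (by simp [ae_iff])
    filter_upwards [ae_restrict_mem measurableSet_Ioo, e1] with t ht h1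
    exact hy.hasDerivWithinAt_sensitivity hτ hx hz ht.2 h1

theorem IsSecondSensitivity.solvesSecondOrderEq {A : Matrix (Fin n) (Fin n) ℝ}
    (hA : P.A = Matrix.toEuclideanCLM (𝕜 := ℝ) A) (hτ : τ ∈ Icc 0 P.b)
    {φ : ℝ → EuclideanSpace ℝ (Fin n)} (hφ : EqOn φ P.φ (Icc (-P.b) 0))
    (hy : P.IsSecondSensitivity τ x z y) :
    SolvesSecondOrderEq A P.F φ P.b P.T τ x (P.velocity τ x) z y := by
  have hm : -τ ∈ Icc (-P.b) 0 := ⟨by linarith [hτ.2], by linarith [hτ.1]⟩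
  have hd : derivWithin φ (Icc (-P.b) 0) (-τ) = P.φ' (-τ) :=
    ((P.hasDerivAt_φ (-τ)).hasDerivWithinAt.congr_of_mem hφ hm).derivWithin
      (uniqueDiffOn_Icc (by linarith [P.b_pos]) _ hm)
  unfold SolvesSecondOrderEq
  rw [hd, ← hA]
  filter_upwards [ae_restrict_mem measurableSet_Ioo] with t ht
  exact hy.eq t ⟨ht.1, ht.2.le⟩

/-- The second-order equation has at most one solution in `L²` that vanishes at negative times. -/
theorem ae_eq_of_solvesSecondOrderEq {A : Matrix (Fin n) (Fin n) ℝ}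
    (hA : P.A = Matrix.toEuclideanCLM (𝕜 := ℝ) A) (hτ : τ ∈ Icc 0 P.b)
    (hx : P.IsState τ x) (hz : P.IsSensitivity τ x z) {φ v : ℝ → EuclideanSpace ℝ (Fin n)}
    {y₁ y₂ : L2zero n (-P.b) P.T}
    (h₁ : SolvesSecondOrderEq A P.F φ P.b P.T τ x v z (y₁ : L2 n (-P.b) P.T))
    (h₂ : SolvesSecondOrderEq A P.F φ P.b P.T τ x v z (y₂ : L2 n (-P.b) P.T)) : y₁ = y₂ := by
  have hb := P.b_pos
  have hi : ∀ y : L2 n (-P.b) P.T, IntegrableOn y (Ioo (-P.b) P.T) := fun y =>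
    (Lp.memLp y).integrable one_le_two
  have hint : ∀ y : L2 n (-P.b) P.T, ∀ t ∈ Ioo 0 P.T, IntervalIntegrable y volume 0 t ∧
      IntervalIntegrable (fun s => y (s - τ)) volume 0 t := by
    intro y t ht
    have key : ∀ c d, c ≤ d → -P.b ≤ c → d ≤ P.T → IntervalIntegrable y volume c d := by
      intro c d hcd hc hd
      rw [intervalIntegrable_iff_integrableOn_Ioo_of_le hcd]
      exact (hi y).mono_set (Ioo_subset_Ioo hc hd)
    refine ⟨key 0 t ht.1.le (by linarith) ht.2.le, ?_⟩
    have := (key (0 - τ) (t - τ) (by linarith [ht.1]) (by linarith [hτ.2])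
      (by linarith [ht.2, hτ.1])).comp_sub_right τ
    simpa using this
  have hDF : Continuous fun s => fderiv ℝ P.F (x s) := P.continuous_fderiv.comp hx.continuous
  have hDFy : ∀ y : L2 n (-P.b) P.T, ∀ t ∈ Ioo 0 P.T,
      IntervalIntegrable (fun s => fderiv ℝ P.F (x s) (y s)) volume 0 t := by
    intro y t ht
    have h1 := (hint y t ht).1
    rw [intervalIntegrable_iff] at h1 ⊢
    refine Integrable.mono' (h1.norm.const_mul P.L) ?_ (Eventually.of_forall fun s =>
      (fderiv ℝ P.F (x s)).le_of_opNorm_le (P.norm_fderiv_le _) _)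
    exact isBoundedBilinearMap_apply.continuous.comp_aestronglyMeasurable
      (hDF.aestronglyMeasurable.prodMk h1.aestronglyMeasurable)
  have hall : ∀ y : L2 n (-P.b) P.T, ∀ t ∈ Ioo 0 P.T, IntervalIntegrable (fun s =>
      (-(fderiv ℝ (fderiv ℝ P.F) (x s) (z s) (z s) + fderiv ℝ P.F (x s) (y s))
          + Matrix.toEuclideanCLM (𝕜 := ℝ) A (y (s - τ)))) volume 0 t := by
    intro y t ht
    have h2 := (hint y t ht).2
    refine (((hz.continuous_forcing hx).intervalIntegrable _ _).add (hDFy y t ht)).neg.add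
      ⟨?_, ?_⟩
    · exact ContinuousLinearMap.integrable_comp _ h2.1
    · exact ContinuousLinearMap.integrable_comp _ h2.2
  have hzero := ae_eq_zero_of_delay_inequality (a := ‖P.A‖)
    (d := fun t => (y₁ : L2 n (-P.b) P.T) t - (y₂ : L2 n (-P.b) P.T) t)
    hτ P.L_nonneg (norm_nonneg _) ((hi _).sub (hi _)) (by
      filter_upwards [y₁.2, y₂.2] with t e1 e2 ht
      rw [e1 ht, e2 ht, sub_zero]) (by
      filter_upwards [h₁, h₂, ae_restrict_mem measurableSet_Ioo] with t e1 e2 ht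
      rw [e1, e2, sub_sub_sub_cancel_right, add_sub_add_right_eq_sub, sub_sub_sub_cancel_right,
        ← intervalIntegral.integral_sub (hall _ t ht) (hall _ t ht)]
      refine intervalIntegral.norm_integral_le_of_norm_le ht.1.le (Eventually.of_forall
        fun s _ => ?_) ((((hint _ t ht).1.sub (hint _ t ht).1).norm.const_mul _).add
          (((hint _ t ht).2.sub (hint _ t ht).2).norm.const_mul _))
      have e3 := (fderiv ℝ P.F (x s)).le_of_opNorm_le (P.norm_fderiv_le _)
        ((y₂ : L2 n (-P.b) P.T) s - (y₁ : L2 n (-P.b) P.T) s)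
      rw [norm_sub_rev ((y₂ : L2 n (-P.b) P.T) s)] at e3
      have e4 := P.A.le_opNorm ((y₁ : L2 n (-P.b) P.T) (s - τ) - (y₂ : L2 n (-P.b) P.T) (s - τ))
      refine le_trans (le_of_eq ?_) ((norm_add_le _ _).trans (add_le_add e3 e4))
      rw [hA]
      simp only [map_sub]
      congr 1
      abel)
  refine Subtype.ext (Lp.ext ?_)
  filter_upwards [hzero] with t ht using sub_eq_zero.1 ht

/-- The solution of the delay equation and its first two derivatives with respect to the delay. -/
theorem exists_derivatives (P : DelayProblem (EuclideanSpace ℝ (Fin n))) :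
    ∃ (x z y : ℝ → ℝ → EuclideanSpace ℝ (Fin n)) (X X1 : ℝ → H1 n (-P.b) P.T)
      (X2 : ℝ → L2zero n (-P.b) P.T), ∀ τ ∈ Icc 0 P.b,
      P.IsState τ (x τ) ∧ P.IsSensitivity τ (x τ) (z τ) ∧
      P.IsSecondSensitivity τ (x τ) (z τ) (y τ) ∧
      H1.toL2 (X τ) =ᵐ[volume.restrict (Ioo (-P.b) P.T)] x τ ∧
      H1.dot (X τ) =ᵐ[volume.restrict (Ioo (-P.b) P.T)] P.velocity τ (x τ) ∧
      H1.toL2 (X1 τ) =ᵐ[volume.restrict (Ioo (-P.b) P.T)] z τ ∧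
      (X2 τ : L2 n (-P.b) P.T) =ᵐ[volume.restrict (Ioo (-P.b) P.T)] y τ ∧
      HasDerivWithinAt X (X1 τ) (Icc 0 P.b) τ ∧
      HasDerivWithinAt (fun σ => H1.toL2 (X1 σ)) (X2 τ : L2 n (-P.b) P.T) (Icc 0 P.b) τ := by
  have hbT : -P.b ∈ Icc (-P.b) P.T := ⟨le_rfl, by linarith [P.b_pos, P.T_pos]⟩
  choose! x hx using fun τ (hτ : τ ∈ Icc 0 P.b) => exists_isState hτ
  choose! z hz using fun τ (hτ : τ ∈ Icc 0 P.b) => (hx τ hτ).exists_isSensitivity hτ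
  choose! y hy using fun τ (hτ : τ ∈ Icc 0 P.b) =>
    (hz τ hτ).exists_isSecondSensitivity hτ (hx τ hτ)
  choose! X hX hXd using fun τ (hτ : τ ∈ Icc 0 P.b) =>
    exists_H1_of_hasH1Deriv ((hx τ hτ).hasH1Deriv hbT)
  choose! X1 hX1 hX1d using fun τ (hτ : τ ∈ Icc 0 P.b) =>
    exists_H1_of_hasH1Deriv ((hz τ hτ).hasH1Deriv hτ (hx τ hτ))
  choose! X2 hX2 using fun τ (hτ : τ ∈ Icc 0 P.b) =>
    exists_L2zero_of_memLp (hy τ hτ).memLp fun t ht => (hy τ hτ).history t ht.le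
  exact ⟨x, z, y, X, X1, X2, fun τ hτ => ⟨hx τ hτ, hz τ hτ, hy τ hτ, hX τ hτ, hXd τ hτ, hX1 τ hτ,
    hX2 τ hτ, hasDerivWithinAt_state_H1 hτ hx (hz τ hτ) hX hXd (hX1 τ hτ) (hX1d τ hτ),
    hasDerivWithinAt_sensitivity_L2 hτ hx hz (hy τ hτ) hX1 (hX2 τ hτ)⟩⟩

end DelayProblem

section DelaySolution

variable {n : ℕ} {A : Matrix (Fin n) (Fin n) ℝ}
  {f : EuclideanSpace ℝ (Fin n) → EuclideanSpace ℝ (Fin n)}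
  {g g' φ ψ x : ℝ → EuclideanSpace ℝ (Fin n)} {b T τ : ℝ}

/-- Solutions in the sense of weak derivatives solve the integrated equation. -/
theorem exists_integral_solution_of_isDelaySolution (hT : 0 < T) (hτ : τ ∈ Icc 0 b)
    (hψ : Continuous ψ) (hφψ : EqOn φ ψ (Icc (-b) 0))
    (hg : ∀ᵐ t ∂(volume.restrict (Ioo 0 T)), g t = g' t)
    (hx : IsDelaySolution A f g φ b T τ x) :
    ∃ y : ℝ → EuclideanSpace ℝ (Fin n), Continuous y ∧ (∀ t ≤ 0, y t = ψ t) ∧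
      EqOn x y (Icc (-b) T) ∧ ∀ t ∈ Icc 0 T, y t = ψ 0 + ∫ s in (0 : ℝ)..t,
        (-f (y s) + Matrix.toEuclideanCLM (𝕜 := ℝ) A (y (s - τ)) + g' s) := by
  have hb : 0 ≤ b := hτ.1.trans hτ.2
  have h0m : (0 : ℝ) ∈ Icc (-b) 0 := ⟨by linarith, le_rfl⟩
  have hx0 : x 0 = ψ 0 := (hx.initial h0m).trans (hφψ h0m)
  -- `ψ` to the left of `0`, then `x`, then constant after `T`.
  set y : ℝ → EuclideanSpace ℝ (Fin n) := fun t => ψ (min t 0) + x (max 0 (min t T)) - ψ 0 with hy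
  have hclc : Continuous fun t : ℝ => max 0 (min t T) := by fun_prop
  have hxc : Continuous fun t => x (max 0 (min t T)) :=
    hx.continuousOn.comp_continuous hclc fun t =>
      ⟨(by linarith : -b ≤ 0).trans (le_max_left _ _), max_le hT.le (min_le_right _ _)⟩
  have hyc : Continuous y :=
    ((hψ.comp (by fun_prop)).add hxc).sub continuous_const
  have hyn : ∀ t ≤ 0, y t = ψ t := fun t ht => by
    simp only [hy]
    rw [min_eq_left ht, min_eq_left (ht.trans hT.le), max_eq_left ht, hx0, add_sub_cancel_right]
  have hyp : ∀ t ∈ Icc 0 T, y t = x t := fun t ht => by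
    simp only [hy]
    rw [min_eq_right ht.1, min_eq_left ht.2, max_eq_right ht.1, add_sub_cancel_left]
  have heq : EqOn x y (Icc (-b) T) := fun t ht => by
    rcases le_total t 0 with h | h
    · rw [hyn t h, hx.initial ⟨ht.1, h⟩, hφψ ⟨ht.1, h⟩]
    · rw [hyp t ⟨h, ht.2⟩]
  refine ⟨y, hyc, hyn, heq, fun t ht => ?_⟩
  obtain ⟨v, hv, hveq⟩ := hx.equation
  have hxc' : ContinuousOn x (Icc 0 T) := hx.continuousOn.mono (Icc_subset_Icc_left (by linarith))
  rw [hyp t ht, eq_add_integral_of_hasH1Deriv hT hv hxc' t ht, hx0]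
  congr 1
  rw [intervalIntegral.integral_of_le ht.1, intervalIntegral.integral_of_le ht.1,
    integral_Ioc_eq_integral_Ioo, integral_Ioc_eq_integral_Ioo]
  have hsub : Ioo 0 t ⊆ Ioo 0 T := Ioo_subset_Ioo_right ht.2
  refine integral_congr_ae ?_
  filter_upwards [ae_restrict_of_ae_restrict_of_subset hsub hveq,
    ae_restrict_of_ae_restrict_of_subset hsub hg, ae_restrict_mem measurableSet_Ioo]
    with s e1 e2 hs
  rw [← heq ⟨by linarith [hs.1], (hsub hs).2.le⟩,
    ← heq ⟨by linarith [hs.1, hτ.2], by linarith [(hsub hs).2, hτ.1]⟩, ← e2,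
    eq_sub_of_add_eq e1]
  abel

/-- States solve the delay equation for every nonlinearity that agrees with `F` along them. -/
theorem isDelaySolution_of_isState {P : DelayProblem (EuclideanSpace ℝ (Fin n))}
    (hA : P.A = Matrix.toEuclideanCLM (𝕜 := ℝ) A) (hφ : EqOn φ P.φ (Icc (-P.b) 0))
    (hg : ∀ᵐ t ∂(volume.restrict (Ioo 0 P.T)), g t = P.g t) (hx : P.IsState τ x)
    (hF : ∀ t ∈ Ioo 0 P.T, P.F (x t) = f (x t)) :
    IsDelaySolution A f g φ P.b P.T τ x := by
  have hb := P.b_pos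
  have hT := P.T_pos
  refine ⟨hx.continuous.continuousOn, fun t ht => ?_, P.velocity τ x,
    hx.hasH1Deriv ⟨by linarith, hT.le⟩, ?_⟩
  · rw [hx.history t ht.2, hφ ht]
  · filter_upwards [hg, ae_restrict_mem measurableSet_Ioo] with t e1 ht
    rw [DelayProblem.velocity, if_neg ht.1.not_gt, hF t ht, hA, e1]
    abel

end DelaySolution

end DelayEquation

theorem corollary5p2 (n : ℕ) (A : Matrix (Fin n) (Fin n) ℝ)
    (f : EuclideanSpace ℝ (Fin n) → EuclideanSpace ℝ (Fin n))
    (g φ : ℝ → EuclideanSpace ℝ (Fin n)) (b T : ℝ) (hb : 0 < b) (hT : 0 < T)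
    (hf : ContDiff ℝ 2 f)
    (hfmono : ∃ lam : ℝ, 0 < lam ∧ ∀ x v : EuclideanSpace ℝ (Fin n),
      0 ≤ inner ℝ (fderiv ℝ f x v + lam • v) v)
    (hφc : ContinuousOn φ (Icc (-b) 0)) (hφ : MemH2 (-b) 0 φ)
    (hg : MemH1 0 T g) :
    -- the states `x[τ]`, as functions and as elements `X τ` of `H¹(-b, T; ℝⁿ)`
    ∃ (x : ℝ → ℝ → EuclideanSpace ℝ (Fin n)) (X : ℝ → H1 n (-b) T)
      -- the first and second derivatives `x'[τ]`, `x''[τ]` with respect to the delay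
      (X1 : ℝ → H1 n (-b) T) (X2 : ℝ → L2zero n (-b) T),
      ∀ τ ∈ Icc 0 b,
        IsDelaySolution A f g φ b T τ (x τ) ∧
        (∀ y, IsDelaySolution A f g φ b T τ y → EqOn y (x τ) (Icc (-b) T)) ∧
        H1.toL2 (X τ) =ᵐ[volume.restrict (Ioo (-b) T)] x τ ∧
        HasDerivWithinAt X (X1 τ) (Icc 0 b) τ ∧
        HasDerivWithinAt (fun σ => H1.toL2 (X1 σ)) (X2 τ : L2 n (-b) T) (Icc 0 b) τ ∧
        SolvesSecondOrderEq A f φ b T τ (x τ) (H1.dot (X τ)) (H1.toL2 (X1 τ)) (X2 τ : L2 n (-b) T) ∧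
        ∀ y : L2zero n (-b) T,
          SolvesSecondOrderEq A f φ b T τ (x τ) (H1.dot (X τ)) (H1.toL2 (X1 τ)) (y : L2 n (-b) T) →
            y = X2 τ := by
  obtain ⟨lam, hlam, hmono⟩ := hfmono
  obtain ⟨ψ, ψ', hψ, hψ', hφψ⟩ := DelayEquation.exists_contDiff_extension hb hφc hφ
  obtain ⟨g', hg'c, ⟨Cg, hCg⟩, hgg'⟩ := DelayEquation.exists_continuous_of_memH1 hT hg
  have hψc : Continuous ψ := continuous_iff_continuousAt.2 fun t => (hψ t).continuousAt
  obtain ⟨Cφ, hCφ⟩ := (isCompact_Icc (a := -b) (b := 0)).exists_bound_of_continuousOn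
    hψc.continuousOn
  have hdiss := DelayEquation.inner_ge_of_fderiv (hf.differentiable (by simp)) hmono
  obtain ⟨M, hM⟩ := DelayEquation.exists_a_priori_bound (c := ‖f 0‖)
    (Matrix.toEuclideanCLM (𝕜 := ℝ) A) hT.le hb.le hlam.le hg'c hCg hCφ
  obtain ⟨F, L, hF, hL₁, hL₂, hFf, hFdiss⟩ := DelayEquation.exists_cutoff hf hlam.le
    (norm_nonneg (f 0)) hdiss (R := |M| + 1) (by positivity)
  have hMR : ∀ w : EuclideanSpace ℝ (Fin n), ‖w‖ ≤ M → ‖w‖ < |M| + 1 := fun w hw => by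
    linarith [le_abs_self M]
  obtain ⟨P, hPA, rfl, rfl, rfl, rfl, rfl⟩ :
      ∃ P : DelayEquation.DelayProblem (EuclideanSpace ℝ (Fin n)),
        P.A = Matrix.toEuclideanCLM (𝕜 := ℝ) A ∧ P.F = F ∧ P.φ = ψ ∧ P.g = g' ∧ P.b = b ∧
          P.T = T :=
    ⟨{ F := F, A := Matrix.toEuclideanCLM (𝕜 := ℝ) A, φ := ψ, φ' := ψ', g := g', b := b, T := T
       L := L, b_pos := hb, T_pos := hT, contDiff := hF, norm_fderiv_le := hL₁
       norm_fderiv_fderiv_le := hL₂, hasDerivAt_φ := hψ, continuous_φ' := hψ'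
       continuous_g := hg'c }, rfl, rfl, rfl, rfl, rfl, rfl⟩
  rw [← hPA] at hM
  obtain ⟨x, z, y, X, X1, X2, hall⟩ := P.exists_derivatives
  refine ⟨x, X, X1, X2, fun τ hτ => ?_⟩
  obtain ⟨hx, hz, hy, hX, hXd, hX1, hX2, hder, hder2⟩ := hall τ hτ
  have hnear : ∀ s ∈ Icc 0 P.T, P.F =ᶠ[nhds (x τ s)] f := fun s hs => hFf _ (hMR _
    (hM P.F hF.continuous hFdiss τ hτ (x τ) hx.continuous hx.history hx.eq s hs))
  have hfder : ∀ s ∈ Ioo 0 P.T, fderiv ℝ P.F (x τ s) = fderiv ℝ f (x τ s) ∧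
      fderiv ℝ (fderiv ℝ P.F) (x τ s) = fderiv ℝ (fderiv ℝ f) (x τ s) := fun s hs =>
    have h := hnear s (Ioo_subset_Icc_self hs)
    ⟨h.fderiv_eq, h.fderiv.fderiv_eq⟩
  have hsolves := hy.solvesSecondOrderEq hPA hτ hφψ
  refine ⟨DelayEquation.isDelaySolution_of_isState hPA hφψ hgg' hx
    fun t ht => (hnear t (Ioo_subset_Icc_self ht)).eq_of_nhds, fun w hw => ?_, hX, hder, hder2,
    DelayEquation.solvesSecondOrderEq_congr hτ hfder hXd.symm hX1.symm hX2.symm hsolves,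
    fun Y hY => ?_⟩
  · obtain ⟨w', hw'c, hw'h, hww', hw'eq⟩ :=
      DelayEquation.exists_integral_solution_of_isDelaySolution hT hτ hψc hφψ hgg' hw
    rw [← hPA] at hw'eq
    have hb' := hM f hf.continuous hdiss τ hτ w' hw'c hw'h hw'eq
    have hst : P.IsState τ w' := ⟨hw'c, hw'h, fun t ht => by
      rw [hw'eq t ht]
      congr 1
      refine intervalIntegral.integral_congr fun s hs => ?_
      rw [uIcc_of_le ht.1] at hs
      rw [(hFf _ (hMR _ (hb' s ⟨hs.1, hs.2.trans ht.2⟩))).eq_of_nhds]⟩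
    intro t ht
    rw [hww' ht, hx.unique hτ hst t ht.2]
  · have hYF : SolvesSecondOrderEq A P.F φ P.b P.T τ (x τ) (P.velocity τ (x τ)) (z τ)
        (Y : L2 n (-P.b) P.T) :=
      DelayEquation.solvesSecondOrderEq_congr hτ
        (fun s hs => ⟨(hfder s hs).1.symm, (hfder s hs).2.symm⟩) hXd hX1 Filter.EventuallyEq.rfl hY
    have hX2F : SolvesSecondOrderEq A P.F φ P.b P.T τ (x τ) (P.velocity τ (x τ)) (z τ)
        (X2 τ : L2 n (-P.b) P.T) :=
      DelayEquation.solvesSecondOrderEq_congr (f := P.F) hτ (fun _ _ => ⟨rfl, rfl⟩)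
        Filter.EventuallyEq.rfl Filter.EventuallyEq.rfl hX2.symm hsolves
    exact DelayEquation.DelayProblem.ae_eq_of_solvesSecondOrderEq hPA hτ hx hz hYF hX2F
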